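/- **Setting.** Let $K:\mathbb R\times\mathbb R\to\mathbb R$ be a symmetric, jointly continuous, bounded kernel with $\sup_k\int|K(k,k')|\,dk'<\infty$ (for example the Lieb–Liniger kernel $K(k,k')=-\frac1\pi\frac{c}{c^2+(k-k')^2}$, $c>0$). A *state* is a function $\theta:\mathbb R\to\mathbb R$ with $k^n\theta\in L^2(\mathbb R)$ for all $n\ge 0$. The *dressing* $U[q]$ of $q:\mathbb R\to\mathbb R$ at $\theta$ is the solution $Q\in q+C_b(\mathbb R)$ of $$Q(k)+\int K(k,k')\theta(k')Q(k')\,dk'=q(k),\qquad k\in\mathbb R,$$ with absolutely convergent integrals; one writes $U[q](k)=\int U(k,k')q(k')\,dk'$. Put $q^{(n)}(k)=k^n/n$ for $n\ge1$, $q^{(0)}=1$, ${Q^{(n)}}'=U[{q^{(n)}}']$ for $n\ge1$, $P'={Q^{(1)}}'=U[1]$, $v={Q^{(2)}}'/{Q^{(1)}}'$ and $\rho=\frac1{2\pi}P'\theta$. Let $\mathcal A$ be the set of states $\theta$ for which every bounded continuous source has exactly one bounded continuous dressing and $\inf_kP'(k)>0$. On $\mathcal A$ consider the integro-differential system $$\partial_t\theta(x,t,k)+v[\theta(x,t,\cdot)](k)\,\partial_x\theta(x,t,k)=0.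 \tag{BB}$$ For a functional $F$ of $\theta$ and an open set $\Omega\subseteq\mathbb R$, the functional derivative $k'\mapsto\delta F/\delta\theta(k')$ on $\Omega$ is the locally integrable function $g$ on $\Omega$ such that $\frac{d}{d\varepsilon}F[\theta+\varepsilon\eta]|_{\varepsilon=0}=\int g\,\eta$ for all $\eta\in C_c^\infty(\Omega)$. Where its values at points are used, the derivative is taken on $\mathbb R$ and $g$ is required to be continuous. A *hydrodynamic symmetry* at $\theta$ is a functional $w[\theta](k)$ such that, for every $k$, $\delta\log P'(k)/\delta\theta(\cdot)$ exists and is continuous on $\mathbb R$, and on $\mathbb R\setminus\{k\}$ $$\frac{\delta w(k)}{\delta\theta(k')}=(w(k')-w(k))\,\frac{\delta}{\delta\theta(k')}\log P'(k),\qquad k'\ne k .$$ $w$ has the *continuum WNS property* if at every $\theta\in\mathcal A$ the continuous functional derivative of $w(k)$ exists with $\frac{\delta w(k)}{\delta\theta(k)}=0$ for all $k$, and $$\frac{\delta}{\delta\theta(k'')}\left[\frac{1}{w(k')-w(k)}\frac{\delta w(k)}{\delta\theta(k')}\right]=\frac{\delta}{\delta\theta(k')}\left[\frac{1}{w(k'')-w(k)}\frac{\delta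 w(k)}{\delta\theta(k'')}\right]$$ (both sides existing, with continuous functional derivatives of the brackets) for all pairwise distinct $k,k',k''$ with $w(k')\ne w(k)\ne w(k'')$. **Proposition.** $\mathcal A$ contains all states of sufficiently small $L^2$ norm, and for all $\theta\in\mathcal A$ the functions ${Q^{(n)}}'$ ($n\ge1$) exist and are unique, and $\rho q^{(n)}$ ($n\ge 0$) is integrable in $k$. Moreover: 1. *(WNS flows.)* The functionals $w^{(n-1)}={Q^{(n)}}'/P'$, $n\ge1$, have the continuum WNS property, are hydrodynamic symmetries at every $\theta\in\mathcal A$, and are linearly independent as functions of $k$ at every $\theta\in\mathcal A$. The flows $\partial_s\theta+w^{(n)}[\theta]\partial_x\theta=0$ commute with each other and with (BB): the derivatives of each of the vector fields $\theta\mapsto-w^{(n)}[\theta]\partial_x\theta$, $\theta\mapsto -v[\theta]\partial_x\theta$ along each other exist and their Lie brackets vanish, at every $\mathcal A$-valued field $\theta(x,k)$ that is $C^2$ in $x$ and whose $x$-derivatives of orders $0,1,2$ decay faster than any power of $k$, locally uniformly in $x$. 2. *(First integrals.)* For every $n\ge0$, $\mathcal Q^{(n)}[\theta]=\int dx\int dk\,\rho(x,k)q^{(n)}(k)$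 is a first integral of (BB). That is, for every $\mathcal A$-valued field that is $C^1$ in $x$ and for which $(1+x^2)(1+|k|)^m(|\theta|+|\partial_x\theta|)$ is bounded for every $m$, the integral over $x$ converges and the derivative of $\mathcal Q^{(n)}$ along the vector field $-v[\theta]\partial_x\theta$ exists and is zero; and $\mathcal Q^{(n)}$ is constant along every $\mathcal A$-valued solution of (BB) on an open time interval that is $C^1$ in $(t,x)$ and satisfies these bounds locally uniformly in time. The densities $\rho^{(n)}[\theta]=\int\rho\,q^{(n)}\,dk$ are functionally independent: at every $\theta\in\mathcal A$ they have continuous functional derivatives, and these are linearly independent. 3. *(Hydrodynamic symmetries.)* Let $\theta_0$ be a state (the lower limit of the $\xi$-integrals), $\theta\in\mathcal A$, and let $f(\xi,k)$ be continuous with $|f(\xi,k)|\ge C^{-1}(1+|k|)^{-m}$ for some $C>0$, $m\in\mathbb N$ and all $k$ and $|\xi|\le|\theta_0(k)|+|\theta(k)|+1$ ($f$ is *admissible* at $\theta$). Then the integrals in $$w_f(k)=\frac1{P'(k)}\int dk'\,U(k,k')\int dk''\int_{\theta_0(k'')}^{\theta(k'')}d\xi\,\bigl[\delta(k'-k'')+K(k',k'')\xi\bigr]\frac1{f(\xi,k'')}$$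 converge, the dressing in it exists and is unique, and $w_f$ is a hydrodynamic symmetry at $\theta$. If $f_1,f_2$ are admissible at all $\theta\in\mathcal A$ and $w_{f_1}=w_{f_2}$ on $\mathcal A$, then $f_1=f_2$; and the set of all functionals $w_f$ on $\mathcal A$, for $f$ admissible at all $\theta\in\mathcal A$, is uncountable. -/

import Mathlib

open MeasureTheory Set
open scoped BoundedContinuousFunction ContDiff

namespace BetheBoltzmann

/-- The standing assumptions on the (real) two-particle kernel `K(k,k')`: symmetric, jointly
continuous, bounded, and integrable in one variable uniformly in the other one. -/
structure IsTBAKernel (K : ℝ → ℝ → ℝ) : Prop where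
  symm : ∀ k k', K k k' = K k' k
  continuous : Continuous (Function.uncurry K)
  bounded : ∃ M, ∀ k k', |K k k'| ≤ M
  integrable : ∀ k, Integrable (K k)
  integral_bounded : ∃ M, ∀ k, ∫ k', |K k k'| ≤ M

/-- The kernel of the Lieb-Liniger gas with coupling `c`. -/
noncomputable def liebLinigerKernel (c : ℝ) (k k' : ℝ) : ℝ :=
  -(1 / Real.pi) * (c / (c ^ 2 + (k - k') ^ 2))

/-- The Lieb-Liniger kernel satisfies the standing assumptions. -/
theorem isTBAKernel_liebLiniger {c : ℝ} (hc : 0 < c) : IsTBAKernel (liebLinigerKernel c) := by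
  have hpos : ∀ x : ℝ, 0 < c ^ 2 + x ^ 2 := fun x => by positivity
  have hint : Integrable (fun x : ℝ => -(1 / Real.pi) * (c / (c ^ 2 + x ^ 2))) := by
    have h := (integrable_inv_one_add_sq.comp_div hc.ne').const_mul (-(1 / Real.pi) * (1 / c))
    refine h.congr (Filter.Eventually.of_forall fun x => ?_)
    have := (hpos x).ne'
    have h2 : (1 + (x / c) ^ 2) = (c ^ 2 + x ^ 2) / c ^ 2 := by field_simp
    simp only [h2]
    field_simp
  refine ⟨fun k k' => ?_, ?_, ⟨1 / Real.pi * (1 / c), fun k k' => ?_⟩, fun k => ?_,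
    ⟨∫ x, |(-(1 / Real.pi) * (c / (c ^ 2 + x ^ 2)))|, fun k => ?_⟩⟩
  · unfold liebLinigerKernel
    rw [show (k - k') ^ 2 = (k' - k) ^ 2 by ring]
  · unfold liebLinigerKernel Function.uncurry
    refine continuous_const.mul (continuous_const.div (by fun_prop) fun p => ?_)
    exact (hpos _).ne'
  · unfold liebLinigerKernel
    rw [abs_mul, abs_neg, abs_of_pos (by positivity : 0 < 1 / Real.pi),
      abs_of_pos (div_pos hc (hpos _))]
    refine mul_le_mul_of_nonneg_left ?_ (by positivity)
    rw [div_le_div_iff₀ (hpos _) hc]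
    nlinarith [sq_nonneg (k - k')]
  · exact hint.comp_sub_left k
  · exact le_of_eq (integral_sub_left_eq_self
      (fun x => |(-(1 / Real.pi) * (c / (c ^ 2 + x ^ 2)))|) volume k)

/-! ### States and dressing -/

/-- Elements of `L²(ℝ)`, all of whose moments are again in `L²(ℝ)`, so that all charges are
finite. -/
def IsState (θ : ℝ → ℝ) : Prop :=
  ∀ n : ℕ, MemLp (fun k => k ^ n * θ k) 2 volume

/-- `Q = U[q]`: the solution of `Q(k) + ∫ K(k,k') θ(k') Q(k') dk' = q(k)`, in the class
`q + C_b(ℝ)`. -/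
def IsDressing (K : ℝ → ℝ → ℝ) (θ q Q : ℝ → ℝ) : Prop :=
  (∃ r : ℝ →ᵇ ℝ, ∀ k, Q k = q k + r k) ∧
    ∀ k, Integrable (fun k' => K k k' * θ k' * Q k') ∧
      Q k + ∫ k', K k k' * θ k' * Q k' = q k

open Classical in
/-- The dressed function `U[q](k) = ∫ U(k,k') q(k') dk'` (zero if there is none). -/
noncomputable def dress (K : ℝ → ℝ → ℝ) (θ q : ℝ → ℝ) : ℝ → ℝ :=
  if h : ∃ Q, IsDressing K θ q Q then h.choose else 0

/-- The dressing operator `U = (1 + Kθ)⁻¹` exists on `C_b(ℝ)`. -/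
def Dressable (K : ℝ → ℝ → ℝ) (θ : ℝ → ℝ) : Prop :=
  ∀ g : ℝ →ᵇ ℝ, ∃! h : ℝ →ᵇ ℝ, ∀ k, h k + ∫ k', K k k' * θ k' * h k' = g k

/-- The bare charges `q⁽ⁿ⁾(k) = kⁿ / n`, `n ≥ 1`, preceded by `q⁽⁰⁾ = 1` (particle number). -/
noncomputable def bareCharge : ℕ → ℝ → ℝ
  | 0 => fun _ => 1
  | n + 1 => fun k => k ^ (n + 1) / ((n + 1 : ℕ) : ℝ)

/-- The derivative `Q⁽ⁿ⁾'` of the dressed charge, i.e. the dressing of `q⁽ⁿ⁾'`. -/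
noncomputable def dressedChargeDeriv (K : ℝ → ℝ → ℝ) (n : ℕ) (θ : ℝ → ℝ) : ℝ → ℝ :=
  dress K θ (deriv (bareCharge n))

/-- `P'(k) = ∫ U(k,k') dk'`. -/
noncomputable def momentumDeriv (K : ℝ → ℝ → ℝ) (θ : ℝ → ℝ) : ℝ → ℝ :=
  dress K θ (fun _ => 1)

/-- The characteristic velocity `v(k) = ∫ U(k,k') k' dk' / ∫ U(k,k') dk'`. -/
noncomputable def velocity (K : ℝ → ℝ → ℝ) (θ : ℝ → ℝ) (k : ℝ) : ℝ :=
  dress K θ (fun k' => k') k / dress K θ (fun _ => 1) k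

/-- The domain of the system: the states for which the dressing operator exists and `P'` is
positive and bounded away from zero. -/
def domain (K : ℝ → ℝ → ℝ) : Set (ℝ → ℝ) :=
  {θ | IsState θ ∧ Dressable K θ ∧ ∃ m > 0, ∀ k, m ≤ momentumDeriv K θ k}

/-- The flows `w⁽ⁿ⁻¹⁾ = Q⁽ⁿ⁾' / P'`, `n ≥ 1`. -/
noncomputable def wnsFlow (K : ℝ → ℝ → ℝ) (n : ℕ) (θ : ℝ → ℝ) (k : ℝ) : ℝ :=
  dressedChargeDeriv K (n + 1) θ k / momentumDeriv K θ k

/-- The total density of states `ρᵗ = P' / 2π`. -/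
noncomputable def stateDensity (K : ℝ → ℝ → ℝ) (θ : ℝ → ℝ) (k : ℝ) : ℝ :=
  1 / (2 * Real.pi) * momentumDeriv K θ k

/-- The pseudo-momentum density `ρ = ρᵗ θ`. -/
noncomputable def rootDensity (K : ℝ → ℝ → ℝ) (θ : ℝ → ℝ) (k : ℝ) : ℝ :=
  stateDensity K θ k * θ k

/-- The spatial charge density `∫ ρ(k) q⁽ⁿ⁾(k) dk`. -/
noncomputable def chargeDensity (K : ℝ → ℝ → ℝ) (n : ℕ) (θ : ℝ → ℝ) : ℝ :=
  ∫ k, rootDensity K θ k * bareCharge n k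

/-! ### Functional derivatives -/

/-- On the open set `Ω`, the functional derivative `δF/δθ(·)` at `θ` is the locally integrable
function `g`: `d/dε F[θ + εη] = ∫ g η` at `ε = 0` for all test functions `η` supported in `Ω`. -/
def HasFunctionalDerivOn (Ω : Set ℝ) (F : (ℝ → ℝ) → ℝ) (θ g : ℝ → ℝ) : Prop :=
  LocallyIntegrableOn g Ω ∧
    ∀ η : ℝ → ℝ, ContDiff ℝ ∞ η → HasCompactSupport η → tsupport η ⊆ Ω →
      HasDerivAt (fun ε : ℝ => F (fun k => θ k + ε * η k)) (∫ k, g k * η k) 0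

/-- The functional derivative `δF/δθ(·)` at `θ` is the continuous function `g`; its values at
points are then meaningful, since `g` is unique. -/
def HasFunctionalDeriv (F : (ℝ → ℝ) → ℝ) (θ g : ℝ → ℝ) : Prop :=
  Continuous g ∧ HasFunctionalDerivOn univ F θ g

open Classical in
/-- The continuous functional derivative `k' ↦ δF/δθ(k')` at `θ` (zero if there is none). -/
noncomputable def functionalDeriv (F : (ℝ → ℝ) → ℝ) (θ : ℝ → ℝ) : ℝ → ℝ :=
  if h : ∃ g, HasFunctionalDeriv F θ g then h.choose else 0

/-- `(w(k') - w(k))⁻¹ δw(k)/δθ(k')`, as a functional of `θ`. -/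
noncomputable def connection (w : (ℝ → ℝ) → ℝ → ℝ) (k k' : ℝ) (θ : ℝ → ℝ) : ℝ :=
  1 / (w θ k' - w θ k) * functionalDeriv (fun ϑ => w ϑ k) θ k'

/-- The continuum WNS property on `A`: linear degeneracy `δw(k)/δθ(k) = 0`, and the
semi-Hamiltonian identity wherever the denominators in it do not vanish. -/
def HasContinuumWNS (A : Set (ℝ → ℝ)) (w : (ℝ → ℝ) → ℝ → ℝ) : Prop :=
  ∀ θ ∈ A,
    (∀ k, ∃ g, HasFunctionalDeriv (fun ϑ => w ϑ k) θ g ∧ g k = 0) ∧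
    ∀ k k' k'' : ℝ, k ≠ k' → k' ≠ k'' → k'' ≠ k → w θ k' ≠ w θ k → w θ k'' ≠ w θ k →
      ∃ g' g'', HasFunctionalDeriv (connection w k k') θ g' ∧
        HasFunctionalDeriv (connection w k k'') θ g'' ∧ g' k'' = g'' k'

/-- Tsarev's equations at `θ`:
`δw(k)/δθ(k') = (w(k') - w(k)) δ log P'(k) / δθ(k')` for `k' ≠ k`. -/
def IsHydrodynamicSymmetryAt (K : ℝ → ℝ → ℝ) (w : (ℝ → ℝ) → ℝ → ℝ) (θ : ℝ → ℝ) : Prop :=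
  ∀ k, ∃ γ, HasFunctionalDeriv (fun ϑ => Real.log (momentumDeriv K ϑ k)) θ γ ∧
    HasFunctionalDerivOn {k}ᶜ (fun ϑ => w ϑ k) θ (fun k' => (w θ k' - w θ k) * γ k')

/-! ### Flows on fields -/

/-- The right-hand side `-w[θ(x)](k) ∂ₓθ(x,k)` of the evolution equation `∂ₜθ + w[θ] ∂ₓθ = 0`,
for a field `θ(x,k)`. -/
noncomputable def evolution (w : (ℝ → ℝ) → ℝ → ℝ) (θ : ℝ → ℝ → ℝ) (x k : ℝ) : ℝ :=
  -(w (θ x) k * deriv (fun y => θ y k) x)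

/-- Fields with values in `A`, twice continuously differentiable in `x`, which together with
their first two `x`-derivatives decay rapidly in `k`, locally uniformly in `x`. -/
structure IsSmoothField (A : Set (ℝ → ℝ)) (θ : ℝ → ℝ → ℝ) : Prop where
  mem : ∀ x, θ x ∈ A
  contDiff : ∀ k, ContDiff ℝ 2 (fun x => θ x k)
  decay : ∀ j ≤ 2, ∀ n : ℕ, ∀ R : ℝ, ∃ C, ∀ x k, |x| ≤ R →
    (1 + |k|) ^ n * |iteratedDeriv j (fun y => θ y k) x| ≤ C

/-- The flows `∂ₛθ + w[θ] ∂ₓθ = 0` and `∂ₜθ + u[θ] ∂ₓθ = 0` commute: the Lie bracket of the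
two vector fields on the space of fields exists and vanishes. -/
def FlowsCommute (A : Set (ℝ → ℝ)) (w u : (ℝ → ℝ) → ℝ → ℝ) : Prop :=
  ∀ θ, IsSmoothField A θ → ∀ x k, ∃ D : ℝ,
    HasDerivAt (fun ε : ℝ => evolution u (fun y l => θ y l + ε * evolution w θ y l) x k) D 0 ∧
    HasDerivAt (fun ε : ℝ => evolution w (fun y l => θ y l + ε * evolution u θ y l) x k) D 0

/-- Fields with values in `A`, continuously differentiable in `x`, which together with their
`x`-derivative decay rapidly in `k` and quadratically in `x`. -/
structure IsDecayingField (A : Set (ℝ → ℝ)) (θ : ℝ → ℝ → ℝ) : Prop where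
  mem : ∀ x, θ x ∈ A
  contDiff : ∀ k, ContDiff ℝ 1 (fun x => θ x k)
  decay : ∀ n : ℕ, ∃ C, ∀ x k,
    (1 + x ^ 2) * (1 + |k|) ^ n * (|θ x k| + |deriv (fun y => θ y k) x|) ≤ C

/-- Classical solutions `θ(t,x,k)` of `∂ₜθ + w[θ] ∂ₓθ = 0` on the time interval `(a,b)`, with
values in `A`, which together with their `x`-derivative decay rapidly in `k` and quadratically in
`x`, locally uniformly in time. -/
structure IsSolution (A : Set (ℝ → ℝ)) (w : (ℝ → ℝ) → ℝ → ℝ) (a b : ℝ)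
    (θ : ℝ → ℝ → ℝ → ℝ) : Prop where
  mem : ∀ t ∈ Ioo a b, ∀ x, θ t x ∈ A
  contDiffOn : ∀ k, ContDiffOn ℝ 1 (fun p : ℝ × ℝ => θ p.1 p.2 k) (Ioo a b ×ˢ univ)
  decay : ∀ s t : ℝ, a < s → t < b → ∀ n : ℕ, ∃ C, ∀ τ ∈ Icc s t, ∀ x k,
    (1 + x ^ 2) * (1 + |k|) ^ n * (|θ τ x k| + |deriv (fun y => θ τ y k) x|) ≤ C
  equation : ∀ t ∈ Ioo a b, ∀ x k,
    deriv (fun s => θ s x k) t + w (θ t x) k * deriv (fun y => θ t y k) x = 0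

/-- The hydrodynamic functional `∫ h(θ(x)) dx` is a first integral of `∂ₜθ + w[θ] ∂ₓθ = 0`: it
converges, its derivative along the vector field of the evolution is zero at every decaying field,
and it is constant along all solutions. -/
def IsFirstIntegral (A : Set (ℝ → ℝ)) (w : (ℝ → ℝ) → ℝ → ℝ) (h : (ℝ → ℝ) → ℝ) : Prop :=
  (∀ θ, IsDecayingField A θ → Integrable (fun x => h (θ x)) ∧
    HasDerivAt (fun ε : ℝ => ∫ x, h (fun k => θ x k + ε * evolution w θ x k)) 0 0) ∧
  ∀ a b θ, IsSolution A w a b θ → ∀ s ∈ Ioo a b, ∀ t ∈ Ioo a b,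
    ∫ x, h (θ s x) = ∫ x, h (θ t x)

/-! ### The symmetries parameterized by functions of two variables -/

/-- Conditions on `f(ξ,k)` under which the integrals below converge at `θ`, with lower limits
`θ₀`: continuity, and a lower bound `|f(ξ,k)| ≥ C⁻¹ (1 + |k|)⁻ᵐ` for `|ξ| ≤ |θ₀(k)| + |θ(k)| + 1`. -/
def IsAdmissible (f : ℝ → ℝ → ℝ) (θ₀ θ : ℝ → ℝ) : Prop :=
  Continuous (Function.uncurry f) ∧
    ∃ (C : ℝ) (m : ℕ), ∀ k ξ, |ξ| ≤ |θ₀ k| + |θ k| + 1 → 1 ≤ C * (1 + |k|) ^ m * |f ξ k|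

/-- `∫ dk'' ∫^{θ(k'')} dξ [δ(k' - k'') + K(k',k'') ξ] / f(ξ,k'')`, the lower limit of the
`ξ`-integral being `θ₀(k'')`. -/
noncomputable def symmetrySource (K f : ℝ → ℝ → ℝ) (θ₀ θ : ℝ → ℝ) (k' : ℝ) : ℝ :=
  (∫ ξ in θ₀ k'..θ k', 1 / f ξ k') +
    ∫ k'', K k' k'' * ∫ ξ in θ₀ k''..θ k'', ξ / f ξ k''

/-- `w(k) = P'(k)⁻¹ ∫ dk' U(k,k') ∫ dk'' ∫^{θ(k'')} dξ [δ(k' - k'') + K(k',k'') ξ] / f(ξ,k'')`. -/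
noncomputable def symmetryFlow (K f : ℝ → ℝ → ℝ) (θ₀ θ : ℝ → ℝ) (k : ℝ) : ℝ :=
  1 / momentumDeriv K θ k * dress K θ (symmetrySource K f θ₀ θ) k

end BetheBoltzmann

open BetheBoltzmann

open MeasureTheory Set
open scoped BoundedContinuousFunction ContDiff

namespace BetheBoltzmann

open Filter Topology

variable {K : ℝ → ℝ → ℝ} {hK : IsTBAKernel K}

/-! For φ in L¹ let Kφ denote the bounded operator h ↦ ∫ K(·,l) φ(l) h(l) dl on C_b(ℝ); it is linear
and bounded in φ. Dressing at θ inverts 1 + Kθ. A source q enters only through the product θq: U[q]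
= q - (1 + Kθ)⁻¹ K(θq). This makes sense as soon as θq is integrable, so polynomial and even
discontinuous sources are allowed. Write R for the kernel of (1 + Kθ)⁻¹ K (`dressedRow`). Symmetry
of K makes R symmetric, and differentiating the inverse gives the two formulas on which everything
rests: δR(k,k')/δθ(l) = -R(k,l) R(k',l) and δU[q](k)/δθ(l) = -R(k,l) U[q](l).

WNS flows. The numerator and the denominator of w = U[q]/P' vary with the same kernel R(k,l), so the
quotient rule yields Tsarev's equations (`HasMomentDerivAt.hasDerivAt_wnsFlow`). Consequently the
bracket in the semi-Hamiltonian identity is -R(k,k') P'(k')/P'(k) for every flow, and its derivative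
at k'' is symmetric in k', k'' because R is. Tsarev's equations also turn the derivative of one
vector field along another into an expression symmetric in the two flows
(`hasDerivAt_evolution_evolution`). Independence holds because dressed monomials differ from
monomials by bounded functions.

First integrals. The functional ∫ θ kⁿ U[kᵐ] has the derivative U[kᵐ] U[kⁿ], symmetric in m and n
(`HasMomentDerivAt.hasDerivAt_dressedMoment`). Since v P' = U[k], the rate of change of the n-th
density along (BB) is, up to a constant, minus the x-derivative of the flux ∫ θ kⁿ U[k], which
vanishes at infinity. Differentiation under the x-integral needs bounds for the dressing uniform in
x; they follow from compactness, as a decaying field tends to the zero state, which lies in the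
domain.

Symmetries. The source is a + Kb with ∂a/∂θ = 1/f and ∂b/∂θ = θ/f, and its dressing is W = a + (1 +
Kθ)⁻¹ K(b - θa). The terms with 1/f cancel in the variation of b - θa, leaving -a δθ. Hence, off the
diagonal, W varies by -R(k,l) W(l), exactly like a dressed function with fixed source, and Tsarev's
equations follow as before. Changing the zero state at a single point recovers f from the flow. -/

/-- Continuous linear endomorphisms, with the algebraic structure of `E` that comes from its norm. -/
abbrev EndCLM (E : Type) [NormedAddCommGroup E] [NormedSpace ℝ E] : Type := E →L[ℝ] E

/-! ### Integrable functions as elements of `L¹` -/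

/-- The space `L¹(ℝ)`. -/
abbrev LOne : Type := ℝ →₁[volume] ℝ

/-- A representative of an element of `L¹(ℝ)`. -/
noncomputable def LOne.fn (φ : LOne) : ℝ → ℝ := ((φ : LOne) : ℝ → ℝ)

theorem LOne.integrable_fn (φ : LOne) : Integrable φ.fn := L1.integrable_coeFn _

theorem LOne.fn_add (φ ψ : LOne) : (φ + ψ).fn =ᵐ[volume] fun k => φ.fn k + ψ.fn k :=
  Lp.coeFn_add (E := ℝ) (p := 1) (μ := volume) φ ψ

theorem LOne.fn_smul (c : ℝ) (φ : LOne) : (c • φ).fn =ᵐ[volume] fun k => c * φ.fn k :=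
  Lp.coeFn_smul (E := ℝ) (p := 1) (μ := volume) c φ

theorem LOne.norm_eq (φ : LOne) : ‖φ‖ = ∫ k, ‖φ.fn k‖ := L1.norm_eq_integral_norm _

open Classical in
/-- The class of `φ` in `L¹(ℝ)` (zero if `φ` is not integrable). -/
noncomputable def toLOne (φ : ℝ → ℝ) : LOne :=
  if h : Integrable φ then h.toL1 φ else 0

theorem fn_toLOne {φ : ℝ → ℝ} (h : Integrable φ) : (toLOne φ).fn =ᵐ[volume] φ := by
  rw [toLOne, dif_pos h]
  exact h.coeFn_toL1

theorem toLOne_add {φ ψ : ℝ → ℝ} (hφ : Integrable φ) (hψ : Integrable ψ) :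
    toLOne (fun k => φ k + ψ k) = toLOne φ + toLOne ψ := by
  have h : Integrable (fun k => φ k + ψ k) := hφ.add hψ
  rw [toLOne, toLOne, toLOne, dif_pos hφ, dif_pos hψ, dif_pos h]
  exact Integrable.toL1_add φ ψ hφ hψ

theorem toLOne_smul {φ : ℝ → ℝ} (hφ : Integrable φ) (c : ℝ) :
    toLOne (fun k => c * φ k) = c • toLOne φ := by
  have h : Integrable (fun k => c * φ k) := hφ.const_mul c
  rw [toLOne, toLOne, dif_pos hφ, dif_pos h]
  exact Integrable.toL1_smul φ hφ c

theorem toLOne_sub {φ ψ : ℝ → ℝ} (hφ : Integrable φ) (hψ : Integrable ψ) :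
    toLOne (fun k => φ k - ψ k) = toLOne φ - toLOne ψ := by
  have h : Integrable (fun k => φ k - ψ k) := hφ.sub hψ
  rw [toLOne, toLOne, toLOne, dif_pos hφ, dif_pos hψ, dif_pos h]
  exact Integrable.toL1_sub φ ψ hφ hψ

theorem norm_toLOne {φ : ℝ → ℝ} (hφ : Integrable φ) : ‖toLOne φ‖ = ∫ k, |φ k| := by
  rw [LOne.norm_eq]
  exact integral_congr_ae ((fn_toLOne hφ).mono fun k hk => by simp [hk])

theorem integrable_mul_bcf {φ : ℝ → ℝ} (hφ : Integrable φ) (h : ℝ →ᵇ ℝ) :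
    Integrable (fun k => φ k * h k) :=
  hφ.mul_bdd (c := ‖h‖) h.continuous.aestronglyMeasurable (Eventually.of_forall h.norm_coe_le_norm)

/-- The pairing `∫ φ h` of integrable and of bounded continuous functions. -/
noncomputable def pairing : LOne →ₗ[ℝ] (ℝ →ᵇ ℝ) →ₗ[ℝ] ℝ :=
  (LinearMap.mk₂ ℝ (fun (φ : LOne) (h : ℝ →ᵇ ℝ) => ∫ k, φ.fn k * h k)
      (fun φ ψ h => by
        rw [← integral_add (integrable_mul_bcf (LOne.integrable_fn φ) h)
          (integrable_mul_bcf (LOne.integrable_fn ψ) h)]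
        refine integral_congr_ae ((LOne.fn_add φ ψ).mono fun k hk => ?_)
        simp only [hk]
        ring)
      (fun c φ h => by
        rw [smul_eq_mul, ← integral_const_mul]
        refine integral_congr_ae ((LOne.fn_smul c φ).mono fun k hk => ?_)
        simp only [hk]
        ring)
      (fun φ h g => by
        rw [← integral_add (integrable_mul_bcf (LOne.integrable_fn φ) h)
          (integrable_mul_bcf (LOne.integrable_fn φ) g)]
        refine integral_congr_ae (Eventually.of_forall fun k => ?_)
        simp only [BoundedContinuousFunction.coe_add, Pi.add_apply]
        ring)
      (fun c φ h => by
        rw [smul_eq_mul, ← integral_const_mul]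
        refine integral_congr_ae (Eventually.of_forall fun k => ?_)
        simp only [BoundedContinuousFunction.coe_smul, smul_eq_mul]
        ring))

theorem pairing_apply (φ : LOne) (h : ℝ →ᵇ ℝ) : pairing φ h = ∫ k, φ.fn k * h k := rfl

theorem pairing_toLOne {φ : ℝ → ℝ} (hφ : Integrable φ) (h : ℝ →ᵇ ℝ) :
    pairing (toLOne φ) h = ∫ k, φ k * h k := by
  rw [pairing_apply]
  exact integral_congr_ae ((fn_toLOne hφ).mono fun k hk => by simp only [hk])

theorem norm_pairing_le (φ : LOne) (h : ℝ →ᵇ ℝ) : |pairing φ h| ≤ ‖φ‖ * ‖h‖ := by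
  rw [← Real.norm_eq_abs, pairing_apply, LOne.norm_eq, ← integral_mul_const]
  refine (norm_integral_le_integral_norm _).trans ?_
  refine integral_mono (integrable_mul_bcf (LOne.integrable_fn φ) h).norm
    ((LOne.integrable_fn φ).norm.mul_const _) fun k => ?_
  simp only [norm_mul]
  exact mul_le_mul_of_nonneg_left (h.norm_coe_le_norm k) (norm_nonneg _)

theorem isBoundedBilinearMap_pairing :
    IsBoundedBilinearMap ℝ (E := LOne) (F := ℝ →ᵇ ℝ) (G := ℝ) fun p => pairing p.1 p.2 :=
  { add_left := fun φ ψ h => by simp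
    smul_left := fun c φ h => by simp
    add_right := fun φ h g => by simp
    smul_right := fun c φ h => by simp
    bound := ⟨1, one_pos, fun φ h => by simpa using norm_pairing_le φ h⟩ }

theorem pairing_toLOne_mul {φ : ℝ → ℝ} (hφ : Integrable φ) (h g : ℝ →ᵇ ℝ) :
    pairing (toLOne fun k => φ k * h k) g = pairing (toLOne φ) (h * g) := by
  rw [pairing_toLOne (integrable_mul_bcf hφ h), pairing_toLOne hφ]
  simp only [BoundedContinuousFunction.coe_mul, Pi.mul_apply, mul_assoc]

/-! ### The integral operator -/

/-- A bound for the kernel. -/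
noncomputable def kernelBound (hK : IsTBAKernel K) : ℝ := hK.bounded.choose

theorem abs_le_kernelBound (hK : IsTBAKernel K) (k k' : ℝ) : |K k k'| ≤ kernelBound hK :=
  hK.bounded.choose_spec k k'

theorem kernelBound_nonneg (hK : IsTBAKernel K) : 0 ≤ kernelBound hK :=
  (abs_nonneg _).trans (abs_le_kernelBound hK 0 0)

/-- `K(k,·)` as a bounded continuous function. -/
noncomputable def kernelRow (hK : IsTBAKernel K) (k : ℝ) : ℝ →ᵇ ℝ :=
  BoundedContinuousFunction.ofNormedAddCommGroup (K k)
    (hK.continuous.comp (Continuous.prodMk_right k)) (kernelBound hK) (abs_le_kernelBound hK k)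

@[simp]
theorem kernelRow_apply (hK : IsTBAKernel K) (k k' : ℝ) : kernelRow hK k k' = K k k' := rfl

theorem norm_kernelRow_le (hK : IsTBAKernel K) (k : ℝ) : ‖kernelRow hK k‖ ≤ kernelBound hK :=
  BoundedContinuousFunction.norm_ofNormedAddCommGroup_le _ (kernelBound_nonneg hK) _

theorem continuous_pairing_kernelRow (hK : IsTBAKernel K) (φ : LOne) (h : ℝ →ᵇ ℝ) :
    Continuous fun k => pairing φ (kernelRow hK k * h) := by
  simp only [pairing_apply, BoundedContinuousFunction.coe_mul, Pi.mul_apply, kernelRow_apply]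
  refine continuous_of_dominated (bound := fun k' => kernelBound hK * ‖h‖ * |φ.fn k'|)
    (fun k => ?_) (fun k => ?_) ?_ ?_
  · exact (integrable_mul_bcf (LOne.integrable_fn φ) (kernelRow hK k * h)).aestronglyMeasurable
  · refine Eventually.of_forall fun k' => ?_
    rw [norm_mul, norm_mul, mul_comm]
    exact mul_le_mul_of_nonneg_right (mul_le_mul (abs_le_kernelBound hK k k')
      (h.norm_coe_le_norm k') (norm_nonneg _) (kernelBound_nonneg hK)) (norm_nonneg _)
  · exact (LOne.integrable_fn φ).norm.const_mul _
  · refine Eventually.of_forall fun k' => ?_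
    have : Continuous fun k => K k k' := hK.continuous.comp (Continuous.prodMk_left k')
    fun_prop

theorem abs_pairing_kernelRow_le (hK : IsTBAKernel K) (φ : LOne) (h : ℝ →ᵇ ℝ) (k : ℝ) :
    |pairing φ (kernelRow hK k * h)| ≤ kernelBound hK * ‖φ‖ * ‖h‖ := by
  refine (norm_pairing_le _ _).trans ?_
  have h1 : ‖kernelRow hK k * h‖ ≤ kernelBound hK * ‖h‖ :=
    (norm_mul_le _ _).trans (mul_le_mul_of_nonneg_right (norm_kernelRow_le hK k) (norm_nonneg _))
  calc ‖φ‖ * ‖kernelRow hK k * h‖ ≤ ‖φ‖ * (kernelBound hK * ‖h‖) :=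
        mul_le_mul_of_nonneg_left h1 (norm_nonneg _)
    _ = _ := by ring

/-- The operator `h ↦ ∫ K(·,k') φ(k') h(k') dk'`, as a linear function of `φ`. -/
noncomputable def kernelOp (hK : IsTBAKernel K) : LOne →ₗ[ℝ] EndCLM (ℝ →ᵇ ℝ) where
  toFun φ := LinearMap.mkContinuous
    { toFun := fun h => BoundedContinuousFunction.ofNormedAddCommGroup
        (fun k => pairing φ (kernelRow hK k * h))
        (continuous_pairing_kernelRow hK φ h) (kernelBound hK * ‖φ‖ * ‖h‖)
        (abs_pairing_kernelRow_le hK φ h)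
      map_add' := fun h g => by ext k; simp [mul_add]
      map_smul' := fun c h => by ext k; simp [mul_smul_comm] }
    (kernelBound hK * ‖φ‖) fun h => BoundedContinuousFunction.norm_ofNormedAddCommGroup_le _
      (by have := kernelBound_nonneg hK; positivity) (abs_pairing_kernelRow_le hK φ h)
  map_add' φ ψ := by ext h k; simp
  map_smul' c φ := by ext h k; simp

theorem kernelOp_apply (hK : IsTBAKernel K) (φ : LOne) (h : ℝ →ᵇ ℝ) (k : ℝ) :
    kernelOp hK φ h k = pairing φ (kernelRow hK k * h) := rfl

theorem kernelOp_toLOne (hK : IsTBAKernel K) {φ : ℝ → ℝ} (hφ : Integrable φ) (h : ℝ →ᵇ ℝ) (k : ℝ) :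
    kernelOp hK (toLOne φ) h k = ∫ k', K k k' * φ k' * h k' := by
  rw [kernelOp_apply, pairing_toLOne hφ]
  refine integral_congr_ae (Eventually.of_forall fun k' => ?_)
  simp only [BoundedContinuousFunction.coe_mul, Pi.mul_apply, kernelRow_apply]
  ring

theorem kernelOp_toLOne_one (hK : IsTBAKernel K) {φ : ℝ → ℝ} (hφ : Integrable φ) (k : ℝ) :
    kernelOp hK (toLOne φ) 1 k = ∫ k', K k k' * φ k' := by
  simp [kernelOp_toLOne hK hφ]

/-- Bounded factors can be absorbed into the density. All sources thus take the form `kernelOp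
(toLOne φ) 1`, in which φ need only be integrable; this is the form for unbounded charges. -/
theorem kernelOp_mul_one (hK : IsTBAKernel K) {φ : ℝ → ℝ} (hφ : Integrable φ) (h : ℝ →ᵇ ℝ) :
    kernelOp hK (toLOne fun k => φ k * h k) 1 = kernelOp hK (toLOne φ) h := by
  ext k
  rw [kernelOp_apply, kernelOp_apply, pairing_toLOne_mul hφ, mul_one, mul_comm]

theorem norm_kernelOp_le (hK : IsTBAKernel K) (φ : LOne) :
    ‖kernelOp hK φ‖ ≤ kernelBound hK * ‖φ‖ :=
  ContinuousLinearMap.opNorm_le_bound _ (by have := kernelBound_nonneg hK; positivity) fun h =>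
    BoundedContinuousFunction.norm_ofNormedAddCommGroup_le _
      (by have := kernelBound_nonneg hK; positivity) (abs_pairing_kernelRow_le hK φ h)

theorem isBoundedLinearMap_kernelOp (hK : IsTBAKernel K) :
    IsBoundedLinearMap ℝ fun φ : LOne => kernelOp hK φ :=
  (kernelOp hK).isLinear.with_bound (kernelBound hK) (norm_kernelOp_le hK)

theorem norm_kernelOp_one_le (hK : IsTBAKernel K) (φ : LOne) :
    ‖kernelOp hK φ 1‖ ≤ kernelBound hK * ‖φ‖ := by
  refine ((kernelOp hK φ).le_opNorm 1).trans ?_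
  rw [norm_one, mul_one]
  exact norm_kernelOp_le hK φ

/-- Symmetry of the kernel, for a pair of integrable functions. -/
theorem pairing_kernelOp_comm (hK : IsTBAKernel K) {φ ψ : ℝ → ℝ} (hφ : Integrable φ)
    (hψ : Integrable ψ) :
    pairing (toLOne ψ) (kernelOp hK (toLOne φ) 1) =
      pairing (toLOne φ) (kernelOp hK (toLOne ψ) 1) := by
  rw [pairing_toLOne hφ, pairing_toLOne hψ]
  simp only [kernelOp_toLOne_one hK hφ, kernelOp_toLOne_one hK hψ, ← integral_const_mul]
  rw [integral_integral_swap]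
  · refine integral_congr_ae (Eventually.of_forall fun k => ?_)
    refine integral_congr_ae (Eventually.of_forall fun k' => ?_)
    simp only [hK.symm k k']
    ring
  · have h1 : Integrable (fun p : ℝ × ℝ => ψ p.1 * φ p.2) (volume.prod volume) := hψ.mul_prod hφ
    have h2 := h1.mul_bdd (c := kernelBound hK) (g := Function.uncurry K)
      hK.continuous.aestronglyMeasurable
      (Eventually.of_forall fun p => abs_le_kernelBound hK p.1 p.2)
    refine h2.congr (Eventually.of_forall fun p => ?_)
    simp only [Function.uncurry]
    ring

/-! ### The dressing operator -/

/-- The resolvent `(1 + Kφ)⁻¹` on bounded continuous functions (zero if it does not exist). -/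
noncomputable def resolvent (hK : IsTBAKernel K) (φ : LOne) :
    EndCLM (ℝ →ᵇ ℝ) :=
  Ring.inverse (1 + kernelOp hK φ)

/-- Invertibility of `1 + Kφ`. -/
def Resolvable (hK : IsTBAKernel K) (φ : LOne) : Prop := IsUnit (1 + kernelOp hK φ)

theorem Resolvable.add_apply {hK : IsTBAKernel K} {φ : LOne} (h : Resolvable hK φ)
    (g : ℝ →ᵇ ℝ) : resolvent hK φ g + kernelOp hK φ (resolvent hK φ g) = g := by
  have := congrArg (fun L : EndCLM (ℝ →ᵇ ℝ) => L g) (Ring.mul_inverse_cancel _ h)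
  simpa [mul_apply_eq_comp, resolvent] using! this

theorem Resolvable.eq_resolvent {hK : IsTBAKernel K} {φ : LOne} (h : Resolvable hK φ)
    {g f : ℝ →ᵇ ℝ} (hf : f + kernelOp hK φ f = g) : f = resolvent hK φ g := by
  have := congrArg (fun L : EndCLM (ℝ →ᵇ ℝ) => L f) (Ring.inverse_mul_cancel _ h)
  rw [← hf]
  simpa [mul_apply_eq_comp, resolvent] using! this.symm

/-- Unique solvability is bijectivity of 1 + Kθ, and the open mapping theorem makes the inverse
bounded. -/
theorem dressable_iff (hK : IsTBAKernel K) {θ : ℝ → ℝ} (hθ : Integrable θ) :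
    Dressable K θ ↔ Resolvable hK (toLOne θ) := by
  have key : ∀ g h : ℝ →ᵇ ℝ, (∀ k, h k + ∫ k', K k k' * θ k' * h k' = g k) ↔
      (1 + kernelOp hK (toLOne θ)) h = g := fun g h => by
    rw [BoundedContinuousFunction.ext_iff]
    refine forall_congr' fun k => ?_
    rw [← kernelOp_toLOne hK hθ]
    rfl
  rw [Resolvable, ContinuousLinearMap.isUnit_iff_bijective, Function.bijective_iff_existsUnique]
  exact forall_congr' fun g => by simp only [key]

/-- The kernel `K U`, so that `U = 1 - KUθ`. -/
noncomputable def dressedRow (hK : IsTBAKernel K) (φ : LOne) (k : ℝ) : ℝ →ᵇ ℝ :=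
  resolvent hK φ (kernelRow hK k)

theorem integrable_sub_mul_bcf {θ φ : ℝ → ℝ} (hθ : Integrable θ) (hφ : Integrable φ)
    (h : ℝ →ᵇ ℝ) : Integrable fun k => φ k - θ k * h k :=
  hφ.sub (integrable_mul_bcf hθ h)

/-- The equation f + Kθf = Kφ, read as f = K(φ - θf), exhibits the solution as K applied to an
integrable function, so that the symmetry of K can be used on it. -/
theorem Resolvable.fixed {hK : IsTBAKernel K} {θ φ : ℝ → ℝ} (hθ : Integrable θ)
    (hφ : Integrable φ) (h : Resolvable hK (toLOne θ)) :
    resolvent hK (toLOne θ) (kernelOp hK (toLOne φ) 1) = kernelOp hK (toLOne fun k => φ k -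
      θ k * resolvent hK (toLOne θ) (kernelOp hK (toLOne φ) 1) k) 1 := by
  set f := resolvent hK (toLOne θ) (kernelOp hK (toLOne φ) 1) with hf
  rw [toLOne_sub hφ (integrable_mul_bcf hθ f), map_sub, sub_apply,
    kernelOp_mul_one hK hθ, eq_sub_iff_add_eq]
  exact h.add_apply _

/-- Symmetry of `K U`. -/
theorem Resolvable.pairing_comm {hK : IsTBAKernel K} {θ φ ψ : ℝ → ℝ} (hθ : Integrable θ)
    (hφ : Integrable φ) (hψ : Integrable ψ) (h : Resolvable hK (toLOne θ)) :
    pairing (toLOne ψ) (resolvent hK (toLOne θ) (kernelOp hK (toLOne φ) 1)) =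
      pairing (toLOne φ) (resolvent hK (toLOne θ) (kernelOp hK (toLOne ψ) 1)) := by
  have hf := h.fixed hθ hφ
  have hg := h.fixed hθ hψ
  set f := resolvent hK (toLOne θ) (kernelOp hK (toLOne φ) 1)
  set g := resolvent hK (toLOne θ) (kernelOp hK (toLOne ψ) 1)
  -- Symmetry of K for the densities φ - θf and ψ - θg; the cross term ∫ θfg occurs on both sides
  -- and cancels.
  have hc := pairing_kernelOp_comm hK (integrable_sub_mul_bcf hθ hφ f)
    (integrable_sub_mul_bcf hθ hψ g)
  rw [← hf, ← hg, toLOne_sub hφ (integrable_mul_bcf hθ f),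
    toLOne_sub hψ (integrable_mul_bcf hθ g), map_sub, map_sub, LinearMap.sub_apply,
    LinearMap.sub_apply, pairing_toLOne_mul hθ, pairing_toLOne_mul hθ, mul_comm g f] at hc
  linarith

/-- A row of K would correspond to a delta function as density, which is not in L¹. One use of the
resolvent equation replaces it by the integrable density θ K(k,·), to which
`Resolvable.pairing_comm` applies. -/
theorem Resolvable.dressedRow_eq {hK : IsTBAKernel K} {θ : ℝ → ℝ} (hθ : Integrable θ)
    (h : Resolvable hK (toLOne θ)) (k : ℝ) :
    dressedRow hK (toLOne θ) k = kernelRow hK k - resolvent hK (toLOne θ)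
      (kernelOp hK (toLOne fun k' => θ k' * kernelRow hK k k') 1) := by
  have h1 : kernelOp hK (toLOne fun k' => θ k' * kernelRow hK k k') 1 =
      kernelOp hK (toLOne θ) (kernelRow hK k) := kernelOp_mul_one hK hθ _
  rw [h1, ← h.eq_resolvent (f := kernelRow hK k - dressedRow hK (toLOne θ) k), sub_sub_cancel]
  have := h.add_apply (kernelRow hK k)
  rw [map_sub, dressedRow]
  linear_combination (exp := 1) -this

/-- `U K φ` is given by the symmetric kernel `K U`. -/
theorem Resolvable.apply_eq {hK : IsTBAKernel K} {θ φ : ℝ → ℝ} (hθ : Integrable θ)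
    (hφ : Integrable φ) (h : Resolvable hK (toLOne θ)) (k : ℝ) :
    resolvent hK (toLOne θ) (kernelOp hK (toLOne φ) 1) k =
      ∫ k', φ k' * dressedRow hK (toLOne θ) k k' := by
  -- By symmetry the right side becomes (Kφ)(k) - (Kθ f)(k) with f = (1 + Kθ)⁻¹ Kφ, which is f(k) by
  -- the resolvent equation.
  rw [← pairing_toLOne hφ, h.dressedRow_eq hθ, map_sub,
    h.pairing_comm hθ (integrable_mul_bcf hθ _) hφ, pairing_toLOne_mul hθ, ← kernelOp_apply]
  have h3 := congrArg (fun f : ℝ →ᵇ ℝ => f k) (h.add_apply (kernelOp hK (toLOne φ) 1))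
  have h4 : kernelOp hK (toLOne φ) 1 k = pairing (toLOne φ) (kernelRow hK k) := by
    rw [kernelOp_apply, mul_one]
  simp only [BoundedContinuousFunction.coe_add, Pi.add_apply] at h3
  linarith

/-- Both sides equal K(k,k') - ∫ θ(l) K(k,l) R(k',l) dl: one by `dressedRow_eq` and `apply_eq`, the
other by the resolvent equation. -/
theorem Resolvable.dressedRow_comm {hK : IsTBAKernel K} {θ : ℝ → ℝ} (hθ : Integrable θ)
    (h : Resolvable hK (toLOne θ)) (k k' : ℝ) :
    dressedRow hK (toLOne θ) k k' = dressedRow hK (toLOne θ) k' k := by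
  have h1 := congrArg (fun f : ℝ →ᵇ ℝ => f k) (h.add_apply (kernelRow hK k'))
  have h2 := congrArg (fun f : ℝ →ᵇ ℝ => f k') (h.dressedRow_eq hθ k)
  simp only [BoundedContinuousFunction.coe_add, Pi.add_apply, BoundedContinuousFunction.coe_sub,
    Pi.sub_apply] at h1 h2
  rw [h.apply_eq hθ (integrable_mul_bcf hθ _), ← pairing_toLOne (integrable_mul_bcf hθ _),
    pairing_toLOne_mul hθ] at h2
  rw [kernelOp_apply, kernelRow_apply, hK.symm k' k] at h1
  rw [kernelRow_apply] at h2
  change _ = resolvent hK (toLOne θ) (kernelRow hK k') k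
  change _ = _ - pairing (toLOne θ) (_ * resolvent hK (toLOne θ) (kernelRow hK k')) at h2
  linarith

/-! ### Dressed functions -/

/-- With Q = q + r the equation reads r + Kθr = -K(θq), an equation in C_b(ℝ) whose right side is
defined whenever θq is integrable. -/
theorem isDressing_iff {hK : IsTBAKernel K} {θ q Q : ℝ → ℝ} (hθ : Integrable θ)
    (h : Resolvable hK (toLOne θ)) (hq : Integrable fun k => θ k * q k) :
    IsDressing K θ q Q ↔ Q = fun k => q k -
      resolvent hK (toLOne θ) (kernelOp hK (toLOne fun k => θ k * q k) 1) k := by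
  have hint : ∀ (r : ℝ →ᵇ ℝ) k, Integrable fun k' => K k k' * θ k' * (q k' + r k') := fun r k => by
    have := integrable_mul_bcf (hq.add (integrable_mul_bcf hθ r)) (kernelRow hK k)
    refine this.congr (Eventually.of_forall fun k' => ?_)
    simp only [Pi.add_apply, kernelRow_apply]
    ring
  have hval : ∀ (r : ℝ →ᵇ ℝ) k, ∫ k', K k k' * θ k' * (q k' + r k') =
      kernelOp hK (toLOne fun k => θ k * q k) 1 k + kernelOp hK (toLOne θ) r k := fun r k => by
    rw [kernelOp_toLOne_one hK hq, kernelOp_toLOne hK hθ, ← integral_add]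
    · refine integral_congr_ae (Eventually.of_forall fun k' => ?_)
      simp only
      ring
    · refine (integrable_mul_bcf hq (kernelRow hK k)).congr (Eventually.of_forall fun k' => ?_)
      simp only [kernelRow_apply]
      ring
    · refine (integrable_mul_bcf (integrable_mul_bcf hθ r) (kernelRow hK k)).congr
        (Eventually.of_forall fun k' => ?_)
      simp only [kernelRow_apply]
      ring
  constructor
  · rintro ⟨⟨r, hr⟩, hQ⟩
    have hr' : Q = fun k => q k + r k := funext hr
    subst hr'
    have : -r = resolvent hK (toLOne θ) (kernelOp hK (toLOne fun k => θ k * q k) 1) := by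
      refine h.eq_resolvent ?_
      ext k
      have := (hQ k).2
      rw [hval] at this
      simp only [map_neg, BoundedContinuousFunction.coe_add, BoundedContinuousFunction.coe_neg,
        Pi.add_apply, Pi.neg_apply]
      linarith
    rw [← this]
    funext k
    simp
  · rintro rfl
    refine ⟨⟨-resolvent hK (toLOne θ) (kernelOp hK (toLOne fun k => θ k * q k) 1), fun k => ?_⟩,
      fun k => ?_⟩
    · simp [sub_eq_add_neg]
    · set f := resolvent hK (toLOne θ) (kernelOp hK (toLOne fun k => θ k * q k) 1) with hf
      have h1 := hint (-f) k
      have h2 := hval (-f) k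
      have h3 := congrArg (fun f : ℝ →ᵇ ℝ => f k)
        (h.add_apply (kernelOp hK (toLOne fun k => θ k * q k) 1))
      simp only [BoundedContinuousFunction.coe_neg, Pi.neg_apply, ← sub_eq_add_neg, map_neg,
        BoundedContinuousFunction.coe_add, Pi.add_apply, ← hf] at h1 h2 h3
      refine ⟨h1, ?_⟩
      rw [h2]
      linarith

theorem dress_eq {hK : IsTBAKernel K} {θ q : ℝ → ℝ} (hθ : Integrable θ)
    (h : Resolvable hK (toLOne θ)) (hq : Integrable fun k => θ k * q k) :
    dress K θ q = fun k => q k -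
      resolvent hK (toLOne θ) (kernelOp hK (toLOne fun k => θ k * q k) 1) k := by
  have hex : ∃ Q, IsDressing K θ q Q := ⟨_, (isDressing_iff hθ h hq).2 rfl⟩
  rw [dress, dif_pos hex]
  exact (isDressing_iff hθ h hq).1 hex.choose_spec

theorem existsUnique_isDressing {hK : IsTBAKernel K} {θ q : ℝ → ℝ} (hθ : Integrable θ)
    (h : Resolvable hK (toLOne θ)) (hq : Integrable fun k => θ k * q k) :
    ∃! Q, IsDressing K θ q Q :=
  ⟨_, (isDressing_iff hθ h hq).2 rfl, fun _ hQ => (isDressing_iff hθ h hq).1 hQ⟩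

/-! ### Functions with finite moments -/

/-- All moments of `φ` are finite. -/
def HasMoments (φ : ℝ → ℝ) : Prop := ∀ n : ℕ, Integrable fun k => φ k * k ^ n

theorem HasMoments.integrable {φ : ℝ → ℝ} (h : HasMoments φ) : Integrable φ := by
  simpa using h 0

/-- Continuous functions of at most polynomial growth. -/
def PolyGrowth (g : ℝ → ℝ) : Prop := Continuous g ∧ ∃ (C : ℝ) (n : ℕ), ∀ k, |g k| ≤ C * (1 + |k|) ^ n

theorem PolyGrowth.bcf (f : ℝ →ᵇ ℝ) : PolyGrowth f :=
  ⟨f.continuous, ‖f‖, 0, fun k => by simpa using f.norm_coe_le_norm k⟩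

theorem PolyGrowth.pow (n : ℕ) : PolyGrowth fun k => k ^ n :=
  ⟨by fun_prop, 1, n, fun k => by
    rw [abs_pow, one_mul]
    exact pow_le_pow_left₀ (abs_nonneg k) (by linarith) n⟩

theorem PolyGrowth.const (c : ℝ) : PolyGrowth fun _ => c :=
  ⟨continuous_const, |c|, 0, fun k => by simp⟩

theorem PolyGrowth.mul {f g : ℝ → ℝ} (hf : PolyGrowth f) (hg : PolyGrowth g) :
    PolyGrowth fun k => f k * g k := by
  obtain ⟨hf, C, n, hC⟩ := hf
  obtain ⟨hg, D, m, hD⟩ := hg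
  refine ⟨hf.mul hg, C * D, n + m, fun k => ?_⟩
  rw [abs_mul]
  calc |f k| * |g k| ≤ (C * (1 + |k|) ^ n) * (D * (1 + |k|) ^ m) :=
        mul_le_mul (hC k) (hD k) (abs_nonneg _) ((abs_nonneg _).trans (hC k))
    _ = _ := by ring

theorem one_le_weight (k : ℝ) (n : ℕ) : 1 ≤ (1 + |k|) ^ n :=
  one_le_pow₀ (by linarith [abs_nonneg k])

theorem weight_mono (k : ℝ) {n m : ℕ} (h : n ≤ m) : (1 + |k|) ^ n ≤ (1 + |k|) ^ m :=
  pow_le_pow_right₀ (by linarith [abs_nonneg k]) h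

theorem PolyGrowth.add {f g : ℝ → ℝ} (hf : PolyGrowth f) (hg : PolyGrowth g) :
    PolyGrowth fun k => f k + g k := by
  obtain ⟨hf, C, n, hC⟩ := hf
  obtain ⟨hg, D, m, hD⟩ := hg
  refine ⟨hf.add hg, |C| + |D|, n + m, fun k => (abs_add_le _ _).trans ?_⟩
  have h1 : |f k| ≤ |C| * (1 + |k|) ^ (n + m) := (hC k).trans <|
    mul_le_mul (le_abs_self C) (weight_mono k (by omega)) (by positivity) (abs_nonneg C)
  have h2 : |g k| ≤ |D| * (1 + |k|) ^ (n + m) := (hD k).trans <|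
    mul_le_mul (le_abs_self D) (weight_mono k (by omega)) (by positivity) (abs_nonneg D)
  linarith

theorem PolyGrowth.neg {f : ℝ → ℝ} (hf : PolyGrowth f) : PolyGrowth fun k => -f k := by
  simpa using (PolyGrowth.const (-1)).mul hf

theorem PolyGrowth.sub {f g : ℝ → ℝ} (hf : PolyGrowth f) (hg : PolyGrowth g) :
    PolyGrowth fun k => f k - g k := by
  simpa [sub_eq_add_neg] using hf.add hg.neg

theorem HasMoments.integrable_weight {φ : ℝ → ℝ} (h : HasMoments φ) (n : ℕ) :
    Integrable fun k => (1 + |k|) ^ n * |φ k| := by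
  have h1 : Integrable fun k => |φ k * k ^ 0| + |φ k * k ^ n| := (h 0).abs.add (h n).abs
  refine (h1.const_mul (2 ^ n)).mono' ?_ (Eventually.of_forall fun k => ?_)
  · have : AEStronglyMeasurable (fun k : ℝ => (1 + |k|) ^ n) :=
      (by fun_prop : Continuous fun k : ℝ => (1 + |k|) ^ n).aestronglyMeasurable
    exact this.mul h.integrable.abs.aestronglyMeasurable
  · have : (1 + |k|) ^ n ≤ 2 ^ n * (1 + |k| ^ n) := by
      rcases le_total |k| 1 with hk | hk
      · calc (1 + |k|) ^ n ≤ 2 ^ n := pow_le_pow_left₀ (by positivity) (by linarith) n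
          _ ≤ _ := le_mul_of_one_le_right (by positivity) (by
            have : 0 ≤ |k| ^ n := by positivity
            linarith)
      · calc (1 + |k|) ^ n ≤ (2 * |k|) ^ n := pow_le_pow_left₀ (by positivity) (by linarith) n
          _ = 2 ^ n * |k| ^ n := mul_pow _ _ _
          _ ≤ _ := by gcongr; linarith
    rw [Real.norm_eq_abs, abs_of_nonneg (by positivity), abs_mul, abs_mul, pow_zero, abs_one,
      mul_one]
    rw [← abs_pow] at this
    calc (1 + |k|) ^ n * |φ k| ≤ 2 ^ n * (1 + |k ^ n|) * |φ k| := by gcongr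
      _ = _ := by ring

theorem HasMoments.integrable_mul {φ g : ℝ → ℝ} (h : HasMoments φ) (hg : PolyGrowth g) :
    Integrable fun k => φ k * g k := by
  obtain ⟨hg, C, n, hC⟩ := hg
  refine ((h.integrable_weight n).const_mul C).mono'
    (h.integrable.aestronglyMeasurable.mul hg.aestronglyMeasurable)
    (Eventually.of_forall fun k => ?_)
  rw [norm_mul, Real.norm_eq_abs, Real.norm_eq_abs]
  calc |φ k| * |g k| ≤ |φ k| * (C * (1 + |k|) ^ n) := by gcongr; exact hC k
    _ = _ := by ring

theorem HasMoments.mul {φ g : ℝ → ℝ} (h : HasMoments φ) (hg : PolyGrowth g) :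
    HasMoments fun k => φ k * g k := fun n =>
  (h.integrable_mul (hg.mul (PolyGrowth.pow n))).congr
    (Eventually.of_forall fun k => by simp only [mul_assoc])

/-! ### Differentiable curves in `L¹` -/

/-- The curve `s ↦ φ s` in `L¹(ℝ)` has the derivative `φ'` at `s₀`. -/
structure HasLOneDerivAt (φ : ℝ → ℝ → ℝ) (φ' : ℝ → ℝ) (s₀ : ℝ) : Prop where
  eventually_integrable : ∀ᶠ s in 𝓝 s₀, Integrable (φ s)
  integrable_deriv : Integrable φ'
  hasDerivAt : HasDerivAt (fun s => toLOne (φ s)) (toLOne φ') s₀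

theorem HasLOneDerivAt.integrable {φ : ℝ → ℝ → ℝ} {φ' : ℝ → ℝ} {s₀ : ℝ}
    (h : HasLOneDerivAt φ φ' s₀) : Integrable (φ s₀) := h.eventually_integrable.self_of_nhds

theorem HasLOneDerivAt.pencil {φ η : ℝ → ℝ} (hφ : Integrable φ) (hη : Integrable η) (s₀ : ℝ) :
    HasLOneDerivAt (fun s k => φ k + s * η k) η s₀ := by
  refine ⟨Eventually.of_forall fun s => hφ.add (hη.const_mul s), hη, ?_⟩
  have h : (fun s => toLOne fun k => φ k + s * η k) = fun s => toLOne φ + s • toLOne η := by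
    funext s
    rw [toLOne_add hφ (hη.const_mul s), toLOne_smul hη]
  rw [h]
  simpa using ((hasDerivAt_id s₀).smul_const (toLOne η)).const_add (toLOne φ)

/-- Dominated convergence, stated as convergence in L¹. -/
theorem tendsto_toLOne {Z : Type*} {l : Filter Z} [l.IsCountablyGenerated] {φ : Z → ℝ → ℝ}
    {φ₀ g : ℝ → ℝ} (hm : ∀ᶠ z in l, AEStronglyMeasurable (φ z) volume) (hφ₀ : Integrable φ₀)
    (hg : Integrable g) (hb : ∀ᶠ z in l, ∀ k, |φ z k| ≤ g k)
    (hl : ∀ k, Tendsto (fun z => φ z k) l (𝓝 (φ₀ k))) :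
    Tendsto (fun z => toLOne (φ z)) l (𝓝 (toLOne φ₀)) := by
  have hint : ∀ᶠ z in l, Integrable (φ z) := by
    filter_upwards [hm, hb] with z h1 h2
    exact hg.mono' h1 (Eventually.of_forall h2)
  rw [tendsto_iff_norm_sub_tendsto_zero]
  have : (fun z => ∫ k, |φ z k - φ₀ k|) =ᶠ[l] fun z => ‖toLOne (φ z) - toLOne φ₀‖ := by
    filter_upwards [hint] with z hz
    rw [← toLOne_sub hz hφ₀, norm_toLOne (φ := fun k => φ z k - φ₀ k) (hz.sub hφ₀)]
  refine Tendsto.congr' this ?_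
  have h0 : (0 : ℝ) = ∫ _ : ℝ, (0 : ℝ) := by simp
  rw [h0]
  refine tendsto_integral_filter_of_dominated_convergence (fun k => g k + |φ₀ k|) ?_ ?_
    (hg.add hφ₀.abs) ?_
  · filter_upwards [hint] with z hz
    exact (hz.sub hφ₀).abs.aestronglyMeasurable
  · filter_upwards [hb] with z hz
    refine Eventually.of_forall fun k => ?_
    rw [Real.norm_eq_abs, abs_abs]
    exact (abs_sub _ _).trans (by gcongr; exact hz k)
  · refine Eventually.of_forall fun k => ?_
    simpa using ((hl k).sub_const (φ₀ k)).abs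

/-- The mean value inequality bounds the difference quotients by g, so their pointwise convergence
upgrades to convergence in L¹. -/
theorem HasLOneDerivAt.of_dominated {φ φ' : ℝ → ℝ → ℝ} {g : ℝ → ℝ} {s₀ r : ℝ} (hr : 0 < r)
    (hm : ∀ s ∈ Metric.ball s₀ r, AEStronglyMeasurable (φ s) volume) (h₀ : Integrable (φ s₀))
    (hg : Integrable g)
    (hd : ∀ s ∈ Metric.ball s₀ r, ∀ k, HasDerivAt (fun s => φ s k) (φ' s k) s)
    (hb : ∀ s ∈ Metric.ball s₀ r, ∀ k, |φ' s k| ≤ g k) :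
    HasLOneDerivAt φ (φ' s₀) s₀ := by
  have hs₀ : s₀ ∈ Metric.ball s₀ r := Metric.mem_ball_self hr
  have hball : Metric.ball s₀ r ∈ 𝓝 s₀ := Metric.ball_mem_nhds s₀ hr
  have hlip : ∀ s ∈ Metric.ball s₀ r, ∀ k, |φ s k - φ s₀ k| ≤ g k * |s - s₀| := fun s hs k =>
    (convex_ball s₀ r).norm_image_sub_le_of_norm_hasDerivWithin_le
      (fun x hx => (hd x hx k).hasDerivWithinAt) (fun x hx => hb x hx k) hs₀ hs
  have hslope : ∀ k, Tendsto (fun s => (s - s₀)⁻¹ * (φ s k - φ s₀ k)) (𝓝[≠] s₀)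
      (𝓝 (φ' s₀ k)) := fun k => by
    simpa [slope_fun_def] using! hasDerivAt_iff_tendsto_slope.1 (hd s₀ hs₀ k)
  have hint : ∀ s ∈ Metric.ball s₀ r, Integrable (φ s) := fun s hs => by
    refine ((hg.mul_const |s - s₀|).add h₀.abs).mono' (hm s hs) (Eventually.of_forall fun k => ?_)
    have := hlip s hs k
    have h2 := abs_sub_abs_le_abs_sub (φ s k) (φ s₀ k)
    simp only [Pi.add_apply, Real.norm_eq_abs]
    linarith
  have hballp : ∀ᶠ s in 𝓝[≠] s₀, s ∈ Metric.ball s₀ r := nhdsWithin_le_nhds hball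
  -- Measurability of the derivative is not assumed: it is a pointwise limit of difference quotients
  -- along a sequence.
  have hmeas : AEStronglyMeasurable (φ' s₀) volume := by
    obtain ⟨u, hu⟩ := exists_seq_tendsto (𝓝[≠] s₀)
    obtain ⟨N, hN⟩ := eventually_atTop.1 (hu.eventually hballp)
    refine aestronglyMeasurable_of_tendsto_ae atTop
      (f := fun n k => (u (n + N) - s₀)⁻¹ * (φ (u (n + N)) k - φ s₀ k)) (fun n => ?_)
      (Eventually.of_forall fun k => ?_)
    · exact ((hm _ (hN _ (by omega))).sub (hm _ hs₀)).const_mul _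
    · exact (hslope k).comp (hu.comp (tendsto_add_atTop_nat N))
  have hint' : Integrable (φ' s₀) := hg.mono' hmeas (Eventually.of_forall (hb s₀ hs₀))
  refine ⟨eventually_of_mem hball hint, hint', hasDerivAt_iff_tendsto_slope.2 ?_⟩
  have heq : (fun s => toLOne fun k => (s - s₀)⁻¹ * (φ s k - φ s₀ k)) =ᶠ[𝓝[≠] s₀]
      slope (fun s => toLOne (φ s)) s₀ := by
    filter_upwards [hballp] with s hs
    rw [slope_def_module, ← toLOne_sub (hint s hs) h₀, toLOne_smul (φ := fun k => φ s k - φ s₀ k)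
      ((hint s hs).sub h₀)]
  refine Tendsto.congr' heq (tendsto_toLOne ?_ hint' hg ?_ hslope)
  · filter_upwards [hballp] with s hs
    exact ((hint s hs).sub h₀).aestronglyMeasurable.const_mul _
  · filter_upwards [hballp, self_mem_nhdsWithin] with s hs hne k
    have hpos : 0 < |s - s₀| := abs_pos.2 (sub_ne_zero.2 hne)
    rw [abs_mul, abs_inv, inv_mul_le_iff₀ hpos, mul_comm]
    exact hlip s hs k

/-! ### Derivatives of dressed functions -/

theorem hasDerivAt_kernelOp {φ : ℝ → LOne} {φ' : LOne} {s : ℝ} (hφ : HasDerivAt φ φ' s) :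
    HasDerivAt (fun s => kernelOp hK (φ s)) (kernelOp hK φ') s :=
  ((isBoundedLinearMap_kernelOp hK).hasFDerivAt (x := φ s)).comp_hasDerivAt s hφ

/-- The derivative of inversion at a unit u is h ↦ -u⁻¹ h u⁻¹. -/
theorem hasDerivAt_resolvent_comp {φ : ℝ → LOne} {φ' : LOne} {s : ℝ} (hφ : HasDerivAt φ φ' s)
    (h : Resolvable hK (φ s)) :
    HasDerivAt (fun s => resolvent hK (φ s))
      (-(resolvent hK (φ s) * kernelOp hK φ' * resolvent hK (φ s))) s := by
  obtain ⟨u, hu⟩ := h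
  have h1 : HasDerivAt (fun s => 1 + kernelOp hK (φ s)) (kernelOp hK φ') s :=
    (hasDerivAt_kernelOp hφ).const_add 1
  have h2 := hasFDerivAt_ringInverse (𝕜 := ℝ) u
  rw [hu] at h2
  have h3 := h2.comp_hasDerivAt s h1
  have h4 : (↑u⁻¹ : EndCLM (ℝ →ᵇ ℝ)) = resolvent hK (φ s) := by
    rw [resolvent, ← hu, Ring.inverse_unit]
  rw [h4] at h3
  exact h3

theorem continuousAt_resolvent {φ : LOne} (h : Resolvable hK φ) :
    ContinuousAt (resolvent hK) φ := by
  obtain ⟨u, hu⟩ := h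
  have h1 : ContinuousAt (fun φ => 1 + kernelOp hK φ) φ :=
    ((isBoundedLinearMap_kernelOp hK).continuous.const_add 1).continuousAt
  refine ContinuousAt.comp (g := Ring.inverse) ?_ h1
  rw [← hu]
  exact NormedRing.inverse_continuousAt u

theorem eventually_resolvable {φ : LOne} (h : Resolvable hK φ) :
    ∀ᶠ ψ in 𝓝 φ, Resolvable hK ψ := by
  have h1 : ContinuousAt (fun φ => 1 + kernelOp hK φ) φ :=
    ((isBoundedLinearMap_kernelOp hK).continuous.const_add 1).continuousAt
  exact h1.eventually_mem (Units.isOpen.mem_nhds h)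

/-- The product rule gives (1 + Kθ)⁻¹ applied to Kψ' - Kθ'f, with f the current value; both terms
merge into the single density ψ' - θ'f. -/
theorem HasLOneDerivAt.hasDerivAt_resolvent {θ ψ : ℝ → ℝ → ℝ} {θ' ψ' : ℝ → ℝ} {s : ℝ}
    (hθ : HasLOneDerivAt θ θ' s) (hψ : HasLOneDerivAt ψ ψ' s)
    (h : Resolvable hK (toLOne (θ s))) :
    HasDerivAt (fun s => resolvent hK (toLOne (θ s)) (kernelOp hK (toLOne (ψ s)) 1))
      (resolvent hK (toLOne (θ s)) (kernelOp hK (toLOne fun k => ψ' k - θ' k *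
        resolvent hK (toLOne (θ s)) (kernelOp hK (toLOne (ψ s)) 1) k) 1)) s := by
  have h1 := hasDerivAt_resolvent_comp hθ.hasDerivAt h
  have h2 : HasDerivAt (fun s => kernelOp hK (toLOne (ψ s)) 1) (kernelOp hK (toLOne ψ') 1) s := by
    simpa using (hasDerivAt_kernelOp (hK := hK) hψ.hasDerivAt).clm_apply
      (hasDerivAt_const s (1 : ℝ →ᵇ ℝ))
  refine (h1.clm_apply h2).congr_deriv ?_
  rw [toLOne_sub hψ.integrable_deriv (integrable_mul_bcf hθ.integrable_deriv _), map_sub, sub_apply,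
    kernelOp_mul_one hK hθ.integrable_deriv, map_sub]
  simp only [mul_apply_eq_comp, neg_apply]
  abel

/-- The first variational formula. Its symmetry in k, k' and l is the source of the semi-Hamiltonian
identity. -/
theorem HasLOneDerivAt.hasDerivAt_dressedRow {θ : ℝ → ℝ → ℝ} {θ' : ℝ → ℝ} {s : ℝ}
    (hθ : HasLOneDerivAt θ θ' s) (h : Resolvable hK (toLOne (θ s))) (k k' : ℝ) :
    HasDerivAt (fun s => dressedRow hK (toLOne (θ s)) k k')
      (-∫ l, θ' l * (dressedRow hK (toLOne (θ s)) k l * dressedRow hK (toLOne (θ s)) k' l)) s := by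
  have h1 := (hasDerivAt_resolvent_comp hθ.hasDerivAt h).clm_apply
    (hasDerivAt_const s (kernelRow hK k))
  have h2 := (BoundedContinuousFunction.evalCLM ℝ k').hasFDerivAt.comp_hasDerivAt s h1
  refine h2.congr_deriv ?_
  rw [map_zero, add_zero]
  simp only [mul_apply_eq_comp, neg_apply]
  change -(resolvent hK (toLOne (θ s)) (kernelOp hK (toLOne θ')
    (dressedRow hK (toLOne (θ s)) k))) k' = _
  rw [← kernelOp_mul_one hK hθ.integrable_deriv,
    h.apply_eq hθ.integrable (integrable_mul_bcf hθ.integrable_deriv _)]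
  simp only [mul_assoc]

/-- The second variational formula. The density θ'q - θ'(q - U[q]) produced by
`hasDerivAt_resolvent` collapses to θ' U[q]. -/
theorem HasLOneDerivAt.hasDerivAt_dress {θ : ℝ → ℝ → ℝ} {θ' q : ℝ → ℝ} {s : ℝ}
    (hθ : HasLOneDerivAt θ θ' s) (hψ : HasLOneDerivAt (fun s k => θ s k * q k) (fun k => θ' k * q k) s)
    (h : Resolvable hK (toLOne (θ s))) (k : ℝ) :
    HasDerivAt (fun s => dress K (θ s) q k)
      (-∫ l, θ' l * (dress K (θ s) q l * dressedRow hK (toLOne (θ s)) k l)) s := by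
  have h1 := (BoundedContinuousFunction.evalCLM ℝ k).hasFDerivAt.comp_hasDerivAt s
    (hθ.hasDerivAt_resolvent hψ h)
  have h2 : ∀ᶠ t in 𝓝 s, dress K (θ t) q k = q k -
      resolvent hK (toLOne (θ t)) (kernelOp hK (toLOne fun k => θ t k * q k) 1) k := by
    filter_upwards [hθ.hasDerivAt.continuousAt.eventually (eventually_resolvable h),
      hθ.eventually_integrable, hψ.eventually_integrable] with t h1 h2 h3
    rw [dress_eq h2 h1 h3]
  refine ((h1.const_sub (q k)).congr_of_eventuallyEq h2).congr_deriv ?_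
  change -(resolvent hK _ _ k) = _
  rw [h.apply_eq hθ.integrable (integrable_sub_mul_bcf
    hθ.integrable_deriv hψ.integrable_deriv _), dress_eq hθ.integrable h hψ.integrable]
  simp only [mul_sub, sub_mul, mul_assoc]

/-! ### Dressed monomials -/

/-- The dressing of `kⁿ`. -/
noncomputable def monoDress (K : ℝ → ℝ → ℝ) (n : ℕ) (θ : ℝ → ℝ) : ℝ → ℝ :=
  dress K θ fun k => k ^ n

/-- The difference of `kⁿ` and its dressing. -/
noncomputable def dressCorr (hK : IsTBAKernel K) (n : ℕ) (θ : ℝ → ℝ) : ℝ →ᵇ ℝ :=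
  resolvent hK (toLOne θ) (kernelOp hK (toLOne fun k => θ k * k ^ n) 1)

/-- Functions with finite moments at which the dressing operator exists. -/
structure Regular (hK : IsTBAKernel K) (θ : ℝ → ℝ) : Prop where
  moments : HasMoments θ
  resolvable : Resolvable hK (toLOne θ)

theorem Regular.integrable {θ : ℝ → ℝ} (h : Regular hK θ) : Integrable θ := h.moments.integrable

theorem Regular.monoDress_eq {θ : ℝ → ℝ} (h : Regular hK θ) (n : ℕ) :
    monoDress K n θ = fun k => k ^ n - dressCorr hK n θ k :=
  dress_eq h.integrable h.resolvable (h.moments n)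

theorem Regular.polyGrowth_monoDress {θ : ℝ → ℝ} (h : Regular hK θ) (n : ℕ) :
    PolyGrowth (monoDress K n θ) := by
  rw [h.monoDress_eq]
  exact (PolyGrowth.pow n).sub (PolyGrowth.bcf _)

theorem momentumDeriv_eq (K : ℝ → ℝ → ℝ) (θ : ℝ → ℝ) : momentumDeriv K θ = monoDress K 0 θ := by
  simp only [momentumDeriv, monoDress, pow_zero]

theorem deriv_bareCharge_succ (n : ℕ) : deriv (bareCharge (n + 1)) = fun k => k ^ n := by
  funext k
  have : ((n + 1 : ℕ) : ℝ) ≠ 0 := by positivity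
  simp only [bareCharge, deriv_div_const, differentiableAt_fun_id, deriv_fun_pow, deriv_id'']
  field_simp
  simp

theorem wnsFlow_eq (K : ℝ → ℝ → ℝ) (n : ℕ) (θ : ℝ → ℝ) :
    wnsFlow K n θ = fun k => monoDress K n θ k / monoDress K 0 θ k := by
  funext k
  rw [wnsFlow, dressedChargeDeriv, deriv_bareCharge_succ, momentumDeriv_eq]
  rfl

/-- (BB) is itself one of the WNS flows, so commutation with it needs no separate argument. -/
theorem velocity_eq (K : ℝ → ℝ → ℝ) : velocity K = wnsFlow K 1 := by
  funext θ k
  rw [wnsFlow_eq, velocity]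
  simp only [monoDress, pow_zero, pow_one]

/-- The coefficients of the bare charges. -/
noncomputable def chargeCoeff : ℕ → ℝ
  | 0 => 1
  | n + 1 => 1 / ((n + 1 : ℕ) : ℝ)

theorem chargeCoeff_ne_zero (n : ℕ) : chargeCoeff n ≠ 0 := by
  cases n with
  | zero => exact one_ne_zero
  | succ n => exact one_div_ne_zero (by positivity)

theorem bareCharge_eq (n : ℕ) (k : ℝ) : bareCharge n k = chargeCoeff n * k ^ n := by
  cases n with
  | zero => simp [bareCharge, chargeCoeff]
  | succ n => simp only [bareCharge, chargeCoeff]; ring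

/-- `∫ θ kⁿ U[kᵐ] dk`. -/
noncomputable def dressedMoment (K : ℝ → ℝ → ℝ) (m n : ℕ) (θ : ℝ → ℝ) : ℝ :=
  ∫ k, θ k * k ^ n * monoDress K m θ k

theorem chargeDensity_eq (K : ℝ → ℝ → ℝ) (n : ℕ) (θ : ℝ → ℝ) :
    chargeDensity K n θ = chargeCoeff n / (2 * Real.pi) * dressedMoment K 0 n θ := by
  rw [chargeDensity, dressedMoment, ← integral_const_mul]
  refine integral_congr_ae (Eventually.of_forall fun k => ?_)
  simp only [rootDensity, stateDensity, bareCharge_eq, momentumDeriv_eq]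
  ring

/-! ### The domain -/

theorem memLp_two_of_le {f : ℝ → ℝ} (hf : AEStronglyMeasurable f volume)
    (h : ∀ k, f k ^ 2 ≤ (1 + k ^ 2)⁻¹) : MemLp f 2 volume := by
  rw [memLp_two_iff_integrable_sq hf]
  refine integrable_inv_one_add_sq.mono' (hf.pow 2) (Eventually.of_forall fun k => ?_)
  rw [Real.norm_eq_abs, abs_of_nonneg (sq_nonneg _)]
  exact h k

/-- Cauchy–Schwarz: kⁿθ is the product of (1 + k²)⁻¹ and (kⁿ + kⁿ⁺²)θ, both in L². -/
theorem IsState.hasMoments {θ : ℝ → ℝ} (h : IsState θ) : HasMoments θ := fun n => by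
  have h1 : MemLp (fun k : ℝ => (1 + k ^ 2)⁻¹) 2 volume := by
    have hc : Continuous fun k : ℝ => (1 + k ^ 2)⁻¹ :=
      Continuous.inv₀ (by fun_prop) fun k => by positivity
    refine memLp_two_of_le hc.aestronglyMeasurable fun k => ?_
    have : (1 + k ^ 2)⁻¹ ≤ 1 := inv_le_one_of_one_le₀ (by nlinarith [sq_nonneg k])
    have h0 : 0 ≤ (1 + k ^ 2)⁻¹ := by positivity
    nlinarith
  have h2 : MemLp (fun k => k ^ n * θ k + k ^ (n + 2) * θ k) 2 volume := (h n).add (h (n + 2))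
  refine (h1.integrable_mul h2).congr (Eventually.of_forall fun k => ?_)
  have : (1 + k ^ 2) ≠ 0 := by positivity
  simp only [Pi.mul_apply]
  field_simp
  ring

theorem IsState.add_mul {θ η : ℝ → ℝ} (hθ : IsState θ) (hη : IsState η) (ε : ℝ) :
    IsState fun k => θ k + ε * η k := fun n => by
  have := (hθ n).add ((hη n).const_mul ε)
  refine this.congr_norm ?_ (Eventually.of_forall fun k => ?_)
  · have := this.aestronglyMeasurable
    refine this.congr (Eventually.of_forall fun k => ?_)
    simp only [Pi.add_apply]
    ring
  · simp only [Pi.add_apply]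
    ring_nf

theorem isState_of_continuous {η : ℝ → ℝ} (hc : Continuous η) (hs : HasCompactSupport η) :
    IsState η := fun _ =>
  (by fun_prop : Continuous _).memLp_of_hasCompactSupport (hs.mul_left)

theorem mem_domain_iff (hK : IsTBAKernel K) {θ : ℝ → ℝ} : θ ∈ domain K ↔
    IsState θ ∧ Resolvable hK (toLOne θ) ∧ ∃ m > 0, ∀ k, m ≤ monoDress K 0 θ k := by
  rw [domain, mem_ofPred_eq, momentumDeriv_eq]
  refine and_congr_right fun h => ?_
  rw [dressable_iff hK h.hasMoments.integrable]

theorem regular_of_mem (hK : IsTBAKernel K) {θ : ℝ → ℝ} (h : θ ∈ domain K) : Regular hK θ :=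
  have h' := (mem_domain_iff hK).1 h
  ⟨h'.1.hasMoments, h'.2.1⟩

theorem monoDress_zero_pos {θ : ℝ → ℝ} (h : θ ∈ domain K) (k : ℝ) :
    0 < monoDress K 0 θ k := by
  obtain ⟨m, hm, hk⟩ := h.2.2
  rw [momentumDeriv_eq] at hk
  exact hm.trans_le (hk k)

theorem polyGrowth_wnsFlow (hK : IsTBAKernel K) {θ : ℝ → ℝ} (h : θ ∈ domain K) (n : ℕ) :
    PolyGrowth (wnsFlow K n θ) := by
  have hr := regular_of_mem hK h
  obtain ⟨m, hm, hk⟩ := h.2.2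
  rw [momentumDeriv_eq] at hk
  have : PolyGrowth fun k => (monoDress K 0 θ k)⁻¹ := by
    refine ⟨(hr.polyGrowth_monoDress 0).1.inv₀ fun k => (monoDress_zero_pos h k).ne', m⁻¹, 0,
      fun k => ?_⟩
    rw [abs_inv, abs_of_pos (monoDress_zero_pos h k), pow_zero, mul_one]
    exact inv_anti₀ hm (hk k)
  rw [wnsFlow_eq]
  simpa only [div_eq_mul_inv] using (hr.polyGrowth_monoDress n).mul this

/-! ### Derivatives along curves -/

/-- The curve `s ↦ θ s` is differentiable in `L¹(ℝ)` with all polynomial weights. -/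
def HasMomentDerivAt (θ : ℝ → ℝ → ℝ) (θ' : ℝ → ℝ) (s : ℝ) : Prop :=
  ∀ n : ℕ, HasLOneDerivAt (fun s k => θ s k * k ^ n) (fun k => θ' k * k ^ n) s

theorem HasMomentDerivAt.hasLOneDerivAt {θ : ℝ → ℝ → ℝ} {θ' : ℝ → ℝ} {s : ℝ}
    (h : HasMomentDerivAt θ θ' s) : HasLOneDerivAt θ θ' s := by
  simpa using h 0

theorem HasMomentDerivAt.hasMoments {θ : ℝ → ℝ → ℝ} {θ' : ℝ → ℝ} {s : ℝ}
    (h : HasMomentDerivAt θ θ' s) : HasMoments θ' := fun n => (h n).integrable_deriv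

theorem HasMomentDerivAt.pencil {θ η : ℝ → ℝ} (hθ : HasMoments θ) (hη : HasMoments η) (s : ℝ) :
    HasMomentDerivAt (fun s k => θ k + s * η k) η s := fun n => by
  simpa only [add_mul, mul_assoc] using HasLOneDerivAt.pencil (hθ n) (hη n) s

theorem HasMomentDerivAt.eventually_resolvable {θ : ℝ → ℝ → ℝ} {θ' : ℝ → ℝ} {s : ℝ}
    (h : HasMomentDerivAt θ θ' s) (hr : Regular hK (θ s)) :
    ∀ᶠ t in 𝓝 s, Resolvable hK (toLOne (θ t)) :=
  h.hasLOneDerivAt.hasDerivAt.continuousAt.eventually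
    (BetheBoltzmann.eventually_resolvable hr.resolvable)

theorem HasMomentDerivAt.hasDerivAt_dressCorr {θ : ℝ → ℝ → ℝ} {θ' : ℝ → ℝ} {s : ℝ}
    (h : HasMomentDerivAt θ θ' s) (hr : Regular hK (θ s)) (n : ℕ) :
    HasDerivAt (fun s => dressCorr hK n (θ s)) (resolvent hK (toLOne (θ s))
      (kernelOp hK (toLOne fun k => θ' k * monoDress K n (θ s) k) 1)) s := by
  refine (h.hasLOneDerivAt.hasDerivAt_resolvent (h n) hr.resolvable).congr_deriv ?_
  rw [hr.monoDress_eq]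
  simp only [mul_sub]
  rfl

theorem HasMomentDerivAt.hasDerivAt_monoDress {θ : ℝ → ℝ → ℝ} {θ' : ℝ → ℝ} {s : ℝ}
    (h : HasMomentDerivAt θ θ' s) (hr : Regular hK (θ s)) (n : ℕ) (k : ℝ) :
    HasDerivAt (fun s => monoDress K n (θ s) k)
      (-∫ l, θ' l * (monoDress K n (θ s) l * dressedRow hK (toLOne (θ s)) k l)) s :=
  h.hasLOneDerivAt.hasDerivAt_dress (h n) hr.resolvable k

/-- `(δ/δθ(k')) log P'(k)`. -/
noncomputable def logDeriv (hK : IsTBAKernel K) (θ : ℝ → ℝ) (k k' : ℝ) : ℝ :=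
  -(dressedRow hK (toLOne θ) k k' * monoDress K 0 θ k' / monoDress K 0 θ k)

theorem polyGrowth_logDeriv {θ : ℝ → ℝ} (hr : Regular hK θ) (k : ℝ) :
    PolyGrowth (logDeriv hK θ k) := by
  have := (((PolyGrowth.bcf (dressedRow hK (toLOne θ) k)).mul (hr.polyGrowth_monoDress 0)).mul
    (PolyGrowth.const (monoDress K 0 θ k)⁻¹)).neg
  simp only [← div_eq_mul_inv] at this
  exact this

theorem HasMomentDerivAt.hasDerivAt_log {θ : ℝ → ℝ → ℝ} {θ' : ℝ → ℝ} {s : ℝ}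
    (h : HasMomentDerivAt θ θ' s) (hd : θ s ∈ domain K) (k : ℝ) :
    HasDerivAt (fun s => Real.log (momentumDeriv K (θ s) k))
      (∫ l, θ' l * logDeriv hK (θ s) k l) s := by
  have hr := regular_of_mem hK hd
  simp only [momentumDeriv_eq]
  refine ((h.hasDerivAt_monoDress hr 0 k).log (monoDress_zero_pos hd k).ne').congr_deriv ?_
  rw [neg_div, ← integral_div, ← integral_neg]
  refine integral_congr_ae (Eventually.of_forall fun l => ?_)
  simp only [logDeriv]
  ring

/-- U[kⁿ](k) and P'(k) vary with the same kernel R(k,l), so the quotient rule produces the factor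
w(l) - w(k). -/
theorem HasMomentDerivAt.hasDerivAt_wnsFlow {θ : ℝ → ℝ → ℝ} {θ' : ℝ → ℝ} {s : ℝ}
    (h : HasMomentDerivAt θ θ' s) (hd : θ s ∈ domain K) (n : ℕ) (k : ℝ) :
    HasDerivAt (fun s => wnsFlow K n (θ s) k)
      (∫ l, θ' l * (logDeriv hK (θ s) k l * (wnsFlow K n (θ s) l - wnsFlow K n (θ s) k))) s := by
  have hr := regular_of_mem hK hd
  have hk := (monoDress_zero_pos hd k).ne'
  simp only [wnsFlow_eq]
  refine ((h.hasDerivAt_monoDress hr n k).div (h.hasDerivAt_monoDress hr 0 k) hk).congr_deriv ?_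
  have hR := PolyGrowth.bcf (dressedRow hK (toLOne (θ s)) k)
  have hi : ∀ n, Integrable fun l => θ' l *
      (monoDress K n (θ s) l * dressedRow hK (toLOne (θ s)) k l) := fun n =>
    h.hasMoments.integrable_mul ((hr.polyGrowth_monoDress n).mul hR)
  have e : ∀ l, θ' l * (logDeriv hK (θ s) k l * (monoDress K n (θ s) l / monoDress K 0 (θ s) l -
      monoDress K n (θ s) k / monoDress K 0 (θ s) k)) =
      (monoDress K n (θ s) k / monoDress K 0 (θ s) k ^ 2) *
        (θ' l * (monoDress K 0 (θ s) l * dressedRow hK (toLOne (θ s)) k l)) -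
      (1 / monoDress K 0 (θ s) k) *
        (θ' l * (monoDress K n (θ s) l * dressedRow hK (toLOne (θ s)) k l)) := fun l => by
    have hl := (monoDress_zero_pos hd l).ne'
    rw [logDeriv]
    field_simp
    ring
  simp only [e]
  rw [integral_sub ((hi 0).const_mul _) ((hi n).const_mul _), integral_const_mul,
    integral_const_mul]
  field_simp
  ring

/-- The derivative is symmetric in m and n, so it serves both as the variation of a density (m = 0)
and as that of a flux (m = 1). -/
theorem HasMomentDerivAt.hasDerivAt_dressedMoment {θ : ℝ → ℝ → ℝ} {θ' : ℝ → ℝ} {s : ℝ}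
    (h : HasMomentDerivAt θ θ' s) (hr : Regular hK (θ s)) (m n : ℕ) :
    HasDerivAt (fun s => dressedMoment K m n (θ s))
      (∫ k, θ' k * (monoDress K m (θ s) k * monoDress K n (θ s) k)) s := by
  have hp : ∀ {a : ℝ → LOne} {b : ℝ → ℝ →ᵇ ℝ} {a' b'}, HasDerivAt a a' s → HasDerivAt b b' s →
      HasDerivAt (fun t => pairing (a t) (b t)) (pairing (a s) b' + pairing a' (b s)) s :=
    fun {a b _ _} ha hb => (isBoundedBilinearMap_pairing.hasFDerivAt (a s, b s)).comp_hasDerivAt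
      (f := fun t => (a t, b t)) s (ha.prodMk hb)
  have h1 := (hp (h (n + m)).hasDerivAt (hasDerivAt_const s (1 : ℝ →ᵇ ℝ))).sub
    (hp (h n).hasDerivAt (h.hasDerivAt_dressCorr hr m))
  have heq : (fun s => dressedMoment K m n (θ s)) =ᶠ[𝓝 s]
      (fun t => pairing (toLOne fun k => θ t k * k ^ (n + m)) 1 -
        pairing (toLOne fun k => θ t k * k ^ n) (dressCorr hK m (θ t))) := by
    filter_upwards [h.hasLOneDerivAt.eventually_integrable, (h n).eventually_integrable,
      (h m).eventually_integrable, (h (n + m)).eventually_integrable,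
      h.eventually_resolvable hr] with t i0 in_ im inm ht
    have e := dress_eq i0 ht im
    rw [dressedMoment, monoDress, e, pairing_toLOne inm, pairing_toLOne in_,
      ← integral_sub (integrable_mul_bcf inm _) (integrable_mul_bcf in_ _)]
    refine integral_congr_ae (Eventually.of_forall fun k => ?_)
    simp only [BoundedContinuousFunction.coe_one, Pi.one_apply, dressCorr]
    ring
  refine (h1.congr_of_eventuallyEq heq).congr_deriv ?_
  -- Varying the resolvent contributes -∫ θkⁿ · (1 + Kθ)⁻¹K(θ' U[kᵐ]). Symmetry moves the operator
  -- onto θkⁿ, where it yields kⁿ - U[kⁿ]; together with ∫ θ' kⁿ U[kᵐ] this completes U[kⁿ].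
  have hm' := h.hasMoments.mul (hr.polyGrowth_monoDress m)
  rw [map_zero, zero_add, hr.resolvable.pairing_comm hr.integrable hm'.integrable (hr.moments n),
    pairing_toLOne (h.hasMoments _), pairing_toLOne (h.hasMoments _),
    pairing_toLOne hm'.integrable, ← integral_add, ← integral_sub]
  · refine integral_congr_ae (Eventually.of_forall fun k => ?_)
    simp only [hr.monoDress_eq, BoundedContinuousFunction.coe_one, Pi.one_apply]
    simp only [dressCorr]
    ring
  · exact integrable_mul_bcf (h.hasMoments _) _
  · exact (integrable_mul_bcf hm'.integrable _).add (integrable_mul_bcf (h.hasMoments _) _)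
  · exact integrable_mul_bcf hm'.integrable _
  · exact integrable_mul_bcf (h.hasMoments _) _

/-- Invertibility is an open condition, and P' depends continuously on ε in the sup norm, so half of
its lower bound survives. -/
theorem eventually_mem_domain (hK : IsTBAKernel K) {θ η : ℝ → ℝ} (hθ : θ ∈ domain K)
    (hη : IsState η) : ∀ᶠ ε in 𝓝 (0 : ℝ), (fun k => θ k + ε * η k) ∈ domain K := by
  have hr := regular_of_mem hK hθ
  have h := HasMomentDerivAt.pencil hr.moments hη.hasMoments 0
  have h0 : (fun k => θ k + 0 * η k) = θ := by simp
  have hr' : Regular hK fun k => θ k + 0 * η k := by rwa [h0]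
  obtain ⟨m, hm, hk⟩ := hθ.2.2
  rw [momentumDeriv_eq] at hk
  have hc := (h.hasDerivAt_dressCorr hr' 0).continuousAt
  have hball := hc.eventually (Metric.ball_mem_nhds _ (half_pos hm))
  filter_upwards [h.eventually_resolvable hr', hball] with ε h1 h2
  have hs := hθ.1.add_mul hη ε
  have hrε : Regular hK fun k => θ k + ε * η k := ⟨hs.hasMoments, h1⟩
  refine (mem_domain_iff hK).2 ⟨hs, h1, m / 2, half_pos hm, fun k => ?_⟩
  have h3 := (BoundedContinuousFunction.dist_coe_le_dist k).trans h2.le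
  have h4 := hk k
  simp only [h0] at h3
  rw [hr.monoDress_eq] at h4
  rw [hrε.monoDress_eq]
  rw [Real.dist_eq] at h3
  have := abs_le.1 h3
  simp only at h4 ⊢
  linarith [this.1, this.2]

/-! ### Functional derivatives -/

/-- Test functions are states, so derivatives along lines in the directions of states suffice. -/
theorem HasFunctionalDeriv.of_pencil {F : (ℝ → ℝ) → ℝ} {θ g : ℝ → ℝ} (hg : Continuous g)
    (h : ∀ η : ℝ → ℝ, IsState η → HasDerivAt (fun ε : ℝ => F fun k => θ k + ε * η k)
      (∫ k, η k * g k) 0) : HasFunctionalDeriv F θ g := by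
  refine ⟨hg, hg.locallyIntegrable.locallyIntegrableOn _, fun η hη hs _ => ?_⟩
  simpa only [mul_comm] using h η (isState_of_continuous hη.continuous hs)

/-- The fundamental lemma of the calculus of variations gives equality almost everywhere, and
continuity gives it everywhere. -/
theorem HasFunctionalDeriv.unique {F : (ℝ → ℝ) → ℝ} {θ g₁ g₂ : ℝ → ℝ}
    (h₁ : HasFunctionalDeriv F θ g₁) (h₂ : HasFunctionalDeriv F θ g₂) : g₁ = g₂ := by
  refine (Continuous.ae_eq_iff_eq volume h₁.1 h₂.1).1 ?_
  refine ae_eq_of_integral_contDiff_smul_eq h₁.1.locallyIntegrable h₂.1.locallyIntegrable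
    fun η hη hs => ?_
  simpa only [smul_eq_mul, mul_comm] using
    (h₁.2.2 η hη hs (subset_univ _)).unique (h₂.2.2 η hη hs (subset_univ _))

theorem HasFunctionalDeriv.functionalDeriv_eq {F : (ℝ → ℝ) → ℝ} {θ g : ℝ → ℝ}
    (h : HasFunctionalDeriv F θ g) : functionalDeriv F θ = g := by
  have hex : ∃ g, HasFunctionalDeriv F θ g := ⟨g, h⟩
  rw [functionalDeriv, dif_pos hex]
  exact hex.choose_spec.unique h

theorem hasFunctionalDeriv_log (hK : IsTBAKernel K) {θ : ℝ → ℝ} (hθ : θ ∈ domain K) (k : ℝ) :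
    HasFunctionalDeriv (fun ϑ => Real.log (momentumDeriv K ϑ k)) θ (logDeriv hK θ k) := by
  have hr := regular_of_mem hK hθ
  refine .of_pencil (polyGrowth_logDeriv hr k).1 fun η hη => ?_
  have h := HasMomentDerivAt.pencil hr.moments hη.hasMoments 0
  simpa using h.hasDerivAt_log (hK := hK) (by simpa using hθ) k

theorem hasFunctionalDeriv_wnsFlow (hK : IsTBAKernel K) {θ : ℝ → ℝ} (hθ : θ ∈ domain K) (n : ℕ)
    (k : ℝ) : HasFunctionalDeriv (fun ϑ => wnsFlow K n ϑ k) θ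
      fun l => logDeriv hK θ k l * (wnsFlow K n θ l - wnsFlow K n θ k) := by
  have hr := regular_of_mem hK hθ
  refine .of_pencil ((polyGrowth_logDeriv hr k).1.mul
    ((polyGrowth_wnsFlow hK hθ n).1.sub continuous_const)) fun η hη => ?_
  have h := HasMomentDerivAt.pencil hr.moments hη.hasMoments 0
  simpa using h.hasDerivAt_wnsFlow (hK := hK) (by simpa using hθ) n k

theorem hasFunctionalDeriv_chargeDensity (hK : IsTBAKernel K) {θ : ℝ → ℝ} (hθ : θ ∈ domain K)
    (n : ℕ) : HasFunctionalDeriv (chargeDensity K n) θ fun k =>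
      chargeCoeff n / (2 * Real.pi) * (monoDress K 0 θ k * monoDress K n θ k) := by
  have hr := regular_of_mem hK hθ
  refine .of_pencil ((((hr.polyGrowth_monoDress 0).mul
    (hr.polyGrowth_monoDress n)).1).const_mul _) fun η hη => ?_
  have h := HasMomentDerivAt.pencil hr.moments hη.hasMoments 0
  have h1 := (h.hasDerivAt_dressedMoment (hK := hK) (by simpa using hr) 0 n).const_mul
    (chargeCoeff n / (2 * Real.pi))
  simp only [chargeDensity_eq]
  refine h1.congr_deriv ?_
  rw [← integral_const_mul]
  refine integral_congr_ae (Eventually.of_forall fun k => ?_)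
  simp only [zero_mul, add_zero]
  ring

theorem isHydrodynamicSymmetryAt_wnsFlow (hK : IsTBAKernel K) (n : ℕ) {θ : ℝ → ℝ}
    (hθ : θ ∈ domain K) : IsHydrodynamicSymmetryAt K (wnsFlow K n) θ := fun k => by
  refine ⟨_, hasFunctionalDeriv_log hK hθ k, ?_⟩
  have h := hasFunctionalDeriv_wnsFlow hK hθ n k
  simp only [mul_comm (logDeriv hK θ k _)] at h
  exact ⟨h.1.locallyIntegrable.locallyIntegrableOn _,
    fun η hη hs _ => h.2.2 η hη hs (subset_univ _)⟩

/-! ### The continuum WNS property -/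

theorem connection_wnsFlow (hK : IsTBAKernel K) {θ : ℝ → ℝ} (hθ : θ ∈ domain K) (n : ℕ)
    {k k' : ℝ} (hne : wnsFlow K n θ k' ≠ wnsFlow K n θ k) :
    connection (wnsFlow K n) k k' θ = logDeriv hK θ k k' := by
  rw [connection, (hasFunctionalDeriv_wnsFlow hK hθ n k).functionalDeriv_eq]
  have := sub_ne_zero.2 hne
  field_simp

/-- The inequality of the two speeds persists for small ε, where the connection is therefore
-R(k,k') P'(k')/P'(k). This is differentiated by the two variational formulas. -/
theorem hasFunctionalDeriv_connection (hK : IsTBAKernel K) {θ : ℝ → ℝ} (hθ : θ ∈ domain K)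
    (n : ℕ) {k k' : ℝ} (hne : wnsFlow K n θ k' ≠ wnsFlow K n θ k) :
    HasFunctionalDeriv (connection (wnsFlow K n) k k') θ fun l =>
      (dressedRow hK (toLOne θ) k l * dressedRow hK (toLOne θ) k' l * monoDress K 0 θ k' +
        dressedRow hK (toLOne θ) k k' * dressedRow hK (toLOne θ) k' l * monoDress K 0 θ l) /
          monoDress K 0 θ k -
        dressedRow hK (toLOne θ) k k' * monoDress K 0 θ k' * dressedRow hK (toLOne θ) k l *
          monoDress K 0 θ l / monoDress K 0 θ k ^ 2 := by
  have hr := regular_of_mem hK hθ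
  have hk := (monoDress_zero_pos hθ k).ne'
  have hc := (hr.polyGrowth_monoDress 0).1
  refine .of_pencil (by fun_prop) fun η hη => ?_
  have h := HasMomentDerivAt.pencil hr.moments hη.hasMoments 0
  have h0 : (fun k => θ k + 0 * η k) = θ := by simp
  have hr' : Regular hK fun k => θ k + 0 * η k := by rwa [h0]
  have hθ' : (fun k => θ k + 0 * η k) ∈ domain K := by rwa [h0]
  have hw : ∀ l, ContinuousAt (fun ε => wnsFlow K n (fun k => θ k + ε * η k) l) 0 := fun l =>
    (h.hasDerivAt_wnsFlow (hK := hK) hθ' n l).continuousAt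
  have hev : ∀ᶠ ε in 𝓝 (0 : ℝ), wnsFlow K n (fun k => θ k + ε * η k) k' ≠
      wnsFlow K n (fun k => θ k + ε * η k) k :=
    (((hw k').sub (hw k)).eventually_ne (sub_ne_zero.2 (by simpa only [h0] using hne))).mono
      fun ε => sub_ne_zero.1
  have heq : (fun ε => connection (wnsFlow K n) k k' fun k => θ k + ε * η k) =ᶠ[𝓝 0]
      fun ε => logDeriv hK (fun k => θ k + ε * η k) k k' := by
    filter_upwards [hev, eventually_mem_domain hK hθ hη] with ε h1 h2
    exact connection_wnsFlow hK h2 n h1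
  have h1 := h.hasLOneDerivAt.hasDerivAt_dressedRow hr'.resolvable k k'
  have h2 := h.hasDerivAt_monoDress hr' 0
  have h3 := ((h1.mul (h2 k')).div (h2 k) (by rwa [h0])).neg
  refine (h3.congr_of_eventuallyEq heq).congr_deriv ?_
  simp only [h0, Pi.mul_apply]
  have hi1 : Integrable fun l => η l * (dressedRow hK (toLOne θ) k l * dressedRow hK (toLOne θ) k' l) :=
    hη.hasMoments.integrable_mul ((PolyGrowth.bcf _).mul (PolyGrowth.bcf _))
  have hi2 : ∀ k, Integrable fun l => η l * (monoDress K 0 θ l * dressedRow hK (toLOne θ) k l) :=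
    fun k => hη.hasMoments.integrable_mul ((hr.polyGrowth_monoDress 0).mul (PolyGrowth.bcf _))
  have e : ∀ l, η l * ((dressedRow hK (toLOne θ) k l * dressedRow hK (toLOne θ) k' l *
        monoDress K 0 θ k' + dressedRow hK (toLOne θ) k k' * dressedRow hK (toLOne θ) k' l *
          monoDress K 0 θ l) / monoDress K 0 θ k -
        dressedRow hK (toLOne θ) k k' * monoDress K 0 θ k' * dressedRow hK (toLOne θ) k l *
          monoDress K 0 θ l / monoDress K 0 θ k ^ 2) =
      (monoDress K 0 θ k' / monoDress K 0 θ k *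
        (η l * (dressedRow hK (toLOne θ) k l * dressedRow hK (toLOne θ) k' l)) +
      dressedRow hK (toLOne θ) k k' / monoDress K 0 θ k *
        (η l * (monoDress K 0 θ l * dressedRow hK (toLOne θ) k' l))) -
      dressedRow hK (toLOne θ) k k' * monoDress K 0 θ k' / monoDress K 0 θ k ^ 2 *
        (η l * (monoDress K 0 θ l * dressedRow hK (toLOne θ) k l)) := fun l => by ring
  simp only [e]
  rw [integral_sub, integral_add (hi1.const_mul _) ((hi2 k').const_mul _), integral_const_mul,
    integral_const_mul, integral_const_mul]
  rotate_left
  · exact (hi1.const_mul _).add ((hi2 k').const_mul _)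
  · exact (hi2 k).const_mul _
  field_simp
  ring

theorem hasContinuumWNS_wnsFlow (hK : IsTBAKernel K) (n : ℕ) :
    HasContinuumWNS (domain K) (wnsFlow K n) := fun θ hθ => by
  refine ⟨fun k => ⟨_, hasFunctionalDeriv_wnsFlow hK hθ n k, by simp⟩,
    fun k k' k'' _ _ _ h1 h2 => ⟨_, _, hasFunctionalDeriv_connection hK hθ n h1,
      hasFunctionalDeriv_connection hK hθ n h2, ?_⟩⟩
  have hr := regular_of_mem hK hθ
  -- With R(k'',k') = R(k',k'') the formula of `hasFunctionalDeriv_connection` is symmetric in k'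
  -- and k''.
  rw [hr.resolvable.dressedRow_comm hr.integrable k'' k']
  ring

/-! ### States of small norm -/

theorem exists_integral_sq_kernel_le (hK : IsTBAKernel K) :
    ∃ S ≥ 0, ∀ k, Integrable (fun k' => K k k' ^ 2) ∧ ∫ k', K k k' ^ 2 ≤ S := by
  obtain ⟨M, hM⟩ := hK.integral_bounded
  have hi : ∀ k, Integrable (fun k' => K k k' ^ 2) := fun k => by
    refine ((hK.integrable k).mul_bdd (c := kernelBound hK) (kernelRow hK k).continuous.aestronglyMeasurable
      (Eventually.of_forall (abs_le_kernelBound hK k))).congr (Eventually.of_forall fun k' => ?_)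
    simp only [kernelRow_apply, sq]
  have h0 := kernelBound_nonneg hK
  have hM0 : 0 ≤ M := (integral_nonneg fun _ => abs_nonneg _).trans (hM 0)
  refine ⟨kernelBound hK * M, mul_nonneg h0 hM0, fun k => ⟨hi k, ?_⟩⟩
  calc ∫ k', K k k' ^ 2 ≤ ∫ k', kernelBound hK * |K k k'| := by
        refine integral_mono (hi k) ((hK.integrable k).abs.const_mul _) fun k' => ?_
        simp only
        rw [← sq_abs, sq]
        exact mul_le_mul_of_nonneg_right (abs_le_kernelBound hK k k') (abs_nonneg _)
    _ = kernelBound hK * ∫ k', |K k k'| := integral_const_mul _ _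
    _ ≤ _ := mul_le_mul_of_nonneg_left (hM k) h0

theorem integral_sq_le_of_eLpNorm_lt {θ : ℝ → ℝ} (hθ : MemLp θ 2 volume) {δ : ℝ} (hδ : 0 < δ)
    (h : eLpNorm θ 2 volume < ENNReal.ofReal δ) : ∫ k, θ k ^ 2 ≤ δ ^ 2 := by
  rw [hθ.eLpNorm_eq_integral_rpow_norm two_ne_zero ENNReal.ofNat_ne_top,
    ENNReal.ofReal_lt_ofReal_iff hδ] at h
  have h0 : 0 ≤ ∫ k, θ k ^ 2 := integral_nonneg fun _ => sq_nonneg _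
  simp only [ENNReal.toReal_ofNat, Real.norm_eq_abs, Real.rpow_ofNat, sq_abs] at h
  have h1 := pow_lt_pow_left₀ h (by positivity) two_ne_zero
  rw [← Real.rpow_natCast, ← Real.rpow_mul h0] at h1
  norm_num at h1
  exact h1.le

/-- The L² norm of θ controls the operator because the rows of K are uniformly bounded in L². A
weighted form of 2|Kθ| ≤ tK² + θ²/t takes the place of Cauchy–Schwarz. -/
theorem exists_norm_kernelOp_le (hK : IsTBAKernel K) : ∃ δ > 0, ∀ θ : ℝ → ℝ, IsState θ →
    eLpNorm θ 2 volume < ENNReal.ofReal δ → ‖kernelOp hK (toLOne θ)‖ ≤ 1 / 4 := by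
  obtain ⟨S, hS, hKS⟩ := exists_integral_sq_kernel_le hK
  -- This t makes t ∫ K² at most 1/4; with ‖θ‖ < t/2 in L², also (∫ θ²)/t ≤ t/4 ≤ 1/4.
  set t : ℝ := 1 / (4 * (S + 1)) with ht
  have htpos : 0 < t := by positivity
  refine ⟨t / 2, half_pos htpos, fun θ hθ hlt => ?_⟩
  have hθ2 : MemLp θ 2 volume := by simpa using hθ 0
  have hsq := integral_sq_le_of_eLpNorm_lt hθ2 (half_pos htpos) hlt
  have hi := hθ.hasMoments.integrable
  refine ContinuousLinearMap.opNorm_le_bound _ (by norm_num) fun h => ?_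
  refine (BoundedContinuousFunction.norm_le (by positivity)).2 fun k => ?_
  rw [kernelOp_toLOne hK hi]
  have hint : Integrable fun k' => ‖h‖ * ((t * K k k' ^ 2 + θ k' ^ 2 / t) / 2) :=
    ((((hKS k).1.const_mul t).add (hθ2.integrable_sq.div_const t)).div_const 2).const_mul _
  calc ‖∫ k', K k k' * θ k' * h k'‖ ≤ ∫ k', ‖h‖ * ((t * K k k' ^ 2 + θ k' ^ 2 / t) / 2) := by
        refine norm_integral_le_of_norm_le hint (Eventually.of_forall fun k' => ?_)
        rw [norm_mul, mul_comm]
        refine mul_le_mul (h.norm_coe_le_norm k') ?_ (norm_nonneg _) (norm_nonneg _)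
        rw [norm_mul, Real.norm_eq_abs, Real.norm_eq_abs]
        have h2 : t * K k k' ^ 2 + θ k' ^ 2 / t - 2 * (|K k k'| * |θ k'|) =
            (t * |K k k'| - |θ k'|) ^ 2 / t := by
          rw [← sq_abs (K k k'), ← sq_abs (θ k')]
          field_simp
          ring
        have h3 : 0 ≤ (t * |K k k'| - |θ k'|) ^ 2 / t := by positivity
        linarith
    _ = ‖h‖ * ((t * (∫ k', K k k' ^ 2) + (∫ k', θ k' ^ 2) / t) / 2) := by
        rw [integral_const_mul, integral_div, integral_add ((hKS k).1.const_mul t)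
          (hθ2.integrable_sq.div_const t), integral_const_mul, integral_div]
    _ ≤ ‖h‖ * (1 / 4) := by
        refine mul_le_mul_of_nonneg_left ?_ (norm_nonneg _)
        have h4 : t * (∫ k', K k k' ^ 2) ≤ 1 / 4 := by
          calc t * (∫ k', K k k' ^ 2) ≤ t * (S + 1) :=
                mul_le_mul_of_nonneg_left ((hKS k).2.trans (by linarith)) htpos.le
            _ = 1 / 4 := by rw [ht]; field_simp
        have h5 : (∫ k', θ k' ^ 2) / t ≤ 1 / 4 := by
          rw [div_le_iff₀ htpos]
          have : t ≤ 1 / 4 := by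
            rw [ht]
            exact one_div_le_one_div_of_le (by norm_num) (by linarith)
          nlinarith
        linarith
    _ = 1 / 4 * ‖h‖ := by ring

/-- A Neumann series inverts 1 + Kθ. The correction V = 1 - P' satisfies ‖V‖ ≤ 1/4 + ‖V‖/4, which
leaves P' ≥ 1/2. -/
theorem exists_mem_domain_of_eLpNorm_lt (hK : IsTBAKernel K) : ∃ δ > 0, ∀ θ : ℝ → ℝ, IsState θ →
    eLpNorm θ 2 volume < ENNReal.ofReal δ → θ ∈ domain K := by
  obtain ⟨δ, hδ, h⟩ := exists_norm_kernelOp_le hK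
  refine ⟨δ, hδ, fun θ hθ hlt => ?_⟩
  have hT := h θ hθ hlt
  have hr : Resolvable hK (toLOne θ) := by
    have : IsUnit (1 - -kernelOp hK (toLOne θ)) :=
      isUnit_one_sub_of_norm_lt_one (by rw [norm_neg]; linarith)
    rwa [sub_neg_eq_add] at this
  have hreg : Regular hK θ := ⟨hθ.hasMoments, hr⟩
  refine (mem_domain_iff hK).2 ⟨hθ, hr, 1 / 2, by norm_num, fun k => ?_⟩
  have h1 := hr.add_apply (kernelOp hK (toLOne θ) 1)
  have h2 : dressCorr hK 0 θ = resolvent hK (toLOne θ) (kernelOp hK (toLOne θ) 1) := by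
    simp [dressCorr]
  rw [← h2] at h1
  have h3 : ‖dressCorr hK 0 θ‖ ≤ 1 / 2 := by
    have h4 : ‖dressCorr hK 0 θ‖ ≤ ‖kernelOp hK (toLOne θ) 1‖ +
        ‖kernelOp hK (toLOne θ) (dressCorr hK 0 θ)‖ := by
      have := norm_sub_le (kernelOp hK (toLOne θ) 1) (kernelOp hK (toLOne θ) (dressCorr hK 0 θ))
      rwa [← eq_sub_iff_add_eq.2 h1] at this
    have h5 := (kernelOp hK (toLOne θ)).le_opNorm 1
    have h6 := (kernelOp hK (toLOne θ)).le_opNorm (dressCorr hK 0 θ)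
    rw [norm_one] at h5
    nlinarith [norm_nonneg (dressCorr hK 0 θ)]
  have h7 := (dressCorr hK 0 θ).norm_coe_le_norm k
  rw [hreg.monoDress_eq]
  have := le_abs_self (dressCorr hK 0 θ k)
  rw [Real.norm_eq_abs] at h7
  simp only [pow_zero]
  linarith

theorem zero_mem_domain (hK : IsTBAKernel K) : (fun _ => 0 : ℝ → ℝ) ∈ domain K := by
  obtain ⟨δ, hδ, h⟩ := exists_mem_domain_of_eLpNorm_lt hK
  refine h _ (fun n => by simp) ?_
  simpa using hδ

/-! ### Linear independence -/

/-- A vanishing combination of dressed monomials makes the polynomial with the same coefficients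
bounded, hence constant. The remaining relation c₀ P' = 0 forces c₀ = 0, as P' > 0. -/
theorem monoDress_independent (hK : IsTBAKernel K) {θ : ℝ → ℝ} (hθ : θ ∈ domain K)
    (s : Finset ℕ) (c : ℕ → ℝ) (h : ∀ k, ∑ i ∈ s, c i * monoDress K i θ k = 0) :
    ∀ i ∈ s, c i = 0 := by
  have hr := regular_of_mem hK hθ
  let P : Polynomial ℝ := ∑ i ∈ s, Polynomial.monomial i (c i)
  let V : ℝ →ᵇ ℝ := ∑ i ∈ s, c i • dressCorr hK i θ
  have hcoeff : ∀ i ∈ s, P.coeff i = c i := fun i hi => by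
    simp [P, Polynomial.finsetSum_coeff, Polynomial.coeff_monomial, hi]
  have hPV : ∀ k, P.eval k = V k := fun k => by
    have := h k
    simp only [hr.monoDress_eq, mul_sub, Finset.sum_sub_distrib, sub_eq_zero] at this
    simpa [P, V, Polynomial.eval_finsetSum] using this
  have hdeg : P.degree ≤ 0 := by
    by_contra hlt
    have ht := P.abs_tendsto_atTop (not_le.1 hlt)
    obtain ⟨k, hk⟩ := (ht.eventually (eventually_gt_atTop ‖V‖)).exists
    rw [hPV] at hk
    exact hk.not_ge (V.norm_coe_le_norm k)
  have hpos : ∀ i ∈ s, i ≠ 0 → c i = 0 := fun i hi hne => by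
    rw [← hcoeff i hi]
    refine Polynomial.coeff_eq_zero_of_degree_lt (hdeg.trans_lt ?_)
    exact_mod_cast Nat.pos_of_ne_zero hne
  intro i hi
  rcases eq_or_ne i 0 with rfl | hne
  · have h0 := h 0
    rw [Finset.sum_eq_single_of_mem 0 hi fun j hj hne => by rw [hpos j hj hne, zero_mul]] at h0
    exact (mul_eq_zero.1 h0).resolve_right (monoDress_zero_pos hθ 0).ne'
  · exact hpos i hi hne

theorem linearIndependent_wnsFlow (hK : IsTBAKernel K) {θ : ℝ → ℝ} (hθ : θ ∈ domain K) :
    LinearIndependent ℝ fun n : ℕ => wnsFlow K n θ := by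
  refine linearIndependent_iff'.2 fun s c h => monoDress_independent hK hθ s c fun k => ?_
  have hk := congrFun h k
  have h0 := (monoDress_zero_pos hθ k).ne'
  simp only [Finset.sum_apply, Pi.smul_apply, smul_eq_mul, wnsFlow_eq, Pi.zero_apply,
    mul_div_assoc', ← Finset.sum_div] at hk
  exact (div_eq_zero_iff.1 hk).resolve_right h0

theorem linearIndependent_chargeDensity (hK : IsTBAKernel K) {θ : ℝ → ℝ} (hθ : θ ∈ domain K) :
    LinearIndependent ℝ fun (n : ℕ) (k : ℝ) =>
      chargeCoeff n / (2 * Real.pi) * (monoDress K 0 θ k * monoDress K n θ k) := by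
  refine linearIndependent_iff'.2 fun s c h i hi => ?_
  have := monoDress_independent hK hθ s (fun i => c i * (chargeCoeff i / (2 * Real.pi)))
    (fun k => ?_) i hi
  · exact (mul_eq_zero.1 this).resolve_right
      (div_ne_zero (chargeCoeff_ne_zero i) (by positivity))
  · have hk := congrFun h k
    simp only [Finset.sum_apply, Pi.smul_apply, smul_eq_mul, Pi.zero_apply] at hk
    refine (mul_eq_zero.1 ?_).resolve_left (monoDress_zero_pos hθ k).ne'
    rw [Finset.mul_sum, ← hk]
    exact Finset.sum_congr rfl fun j _ => by ring

/-! ### Commuting flows -/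

/-- Two extra powers of the weight pay for the integrable majorant (1 + k²)⁻¹. -/
theorem mul_pow_le_of_weight {a C k : ℝ} {n : ℕ} (ha : 0 ≤ a) (h : (1 + |k|) ^ (n + 2) * a ≤ C) :
    a * |k| ^ n ≤ C * (1 + k ^ 2)⁻¹ := by
  rw [← div_eq_mul_inv, le_div_iff₀ (by positivity)]
  have h1 : |k| ^ n ≤ (1 + |k|) ^ n := pow_le_pow_left₀ (abs_nonneg k) (by linarith) n
  have h2 : 1 + k ^ 2 ≤ (1 + |k|) ^ 2 := by
    rw [← sq_abs]
    nlinarith [abs_nonneg k]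
  calc a * |k| ^ n * (1 + k ^ 2) ≤ a * (1 + |k|) ^ n * (1 + |k|) ^ 2 := by gcongr
    _ = (1 + |k|) ^ (n + 2) * a := by ring
    _ ≤ C := h

theorem HasMomentDerivAt.of_decay {θ θ' : ℝ → ℝ → ℝ} {x r : ℝ} (hr : 0 < r)
    (hm : ∀ s ∈ Metric.ball x r, HasMoments (θ s))
    (hd : ∀ s ∈ Metric.ball x r, ∀ k, HasDerivAt (fun s => θ s k) (θ' s k) s)
    (hb : ∀ n : ℕ, ∃ C, ∀ s ∈ Metric.ball x r, ∀ k, (1 + |k|) ^ n * |θ' s k| ≤ C) :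
    HasMomentDerivAt θ (θ' x) x := fun n => by
  obtain ⟨C, hC⟩ := hb (n + 2)
  refine HasLOneDerivAt.of_dominated (φ' := fun s k => θ' s k * k ^ n) hr
    (fun s hs => (hm s hs n).aestronglyMeasurable) (hm x (Metric.mem_ball_self hr) n)
    (integrable_inv_one_add_sq.const_mul C) (fun s hs k => (hd s hs k).mul_const _)
    fun s hs k => ?_
  rw [abs_mul, abs_pow]
  exact mul_pow_le_of_weight (abs_nonneg _) (hC s hs k)

theorem IsSmoothField.hasMomentDerivAt (hK : IsTBAKernel K) {θ : ℝ → ℝ → ℝ}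
    (h : IsSmoothField (domain K) θ) (x : ℝ) :
    HasMomentDerivAt θ (fun k => deriv (fun y => θ y k) x) x := by
  refine .of_decay (θ' := fun x k => deriv (fun y => θ y k) x) one_pos
    (fun s _ => (regular_of_mem hK (h.mem s)).moments)
    (fun s _ k => ((h.contDiff k).differentiable two_ne_zero s).hasDerivAt) fun n => ?_
  obtain ⟨C, hC⟩ := h.decay 1 one_le_two n (|x| + 1)
  refine ⟨C, fun s hs k => ?_⟩
  have := hC s k (by
    rw [Metric.mem_ball, Real.dist_eq] at hs
    have := abs_sub_abs_le_abs_sub s x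
    linarith)
  rwa [iteratedDeriv_one] at this

/-- The value is arranged so that its symmetry under exchange of m and n is visible; this symmetry
is the vanishing of the Lie bracket. -/
theorem hasDerivAt_evolution_evolution (hK : IsTBAKernel K) {θ : ℝ → ℝ → ℝ}
    (h : IsSmoothField (domain K) θ) (m n : ℕ) (x k : ℝ) :
    HasDerivAt (fun ε : ℝ => evolution (wnsFlow K n)
      (fun y l => θ y l + ε * evolution (wnsFlow K m) θ y l) x k)
      (deriv (fun y => θ y k) x * ((∫ l, deriv (fun y => θ y l) x * (logDeriv hK (θ x) k l *
          ((wnsFlow K n (θ x) l - wnsFlow K n (θ x) k) *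
            (wnsFlow K m (θ x) l - wnsFlow K m (θ x) k)))) +
        wnsFlow K m (θ x) k * (∫ l, deriv (fun y => θ y l) x * (logDeriv hK (θ x) k l *
          (wnsFlow K n (θ x) l - wnsFlow K n (θ x) k))) +
        wnsFlow K n (θ x) k * (∫ l, deriv (fun y => θ y l) x * (logDeriv hK (θ x) k l *
          (wnsFlow K m (θ x) l - wnsFlow K m (θ x) k)))) +
        wnsFlow K n (θ x) k * wnsFlow K m (θ x) k * deriv (deriv fun y => θ y k) x) 0 := by
  have hd := h.mem x
  have hr := regular_of_mem hK hd
  have hM := h.hasMomentDerivAt hK x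
  have hη := hM.hasMoments
  have hw := fun n => polyGrowth_wnsFlow hK hd n
  have hL := polyGrowth_logDeriv hr k
  have hξe : ∀ l, evolution (wnsFlow K m) θ x l =
      deriv (fun y => θ y l) x * -wnsFlow K m (θ x) l := fun l => by rw [evolution]; ring
  have hξ : HasMoments (evolution (wnsFlow K m) θ x) := by
    rw [funext hξe]
    exact hη.mul (hw m).neg
  have h0 : (fun l => θ x l + 0 * evolution (wnsFlow K m) θ x l) = θ x := by simp
  have h1 := (HasMomentDerivAt.pencil hr.moments hξ 0).hasDerivAt_wnsFlow (hK := hK)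
    (by rwa [h0]) n k
  have h2 : HasDerivAt (fun y => deriv (fun y => θ y k) y) (deriv (deriv fun y => θ y k) x) x :=
    ((((contDiff_succ_iff_deriv (n := 1)).1 (h.contDiff k)).2.2).differentiable
      one_ne_zero x).hasDerivAt
  have h3 : HasDerivAt (fun y => evolution (wnsFlow K m) θ y k)
      (-((∫ l, deriv (fun y => θ y l) x * (logDeriv hK (θ x) k l *
        (wnsFlow K m (θ x) l - wnsFlow K m (θ x) k))) * deriv (fun y => θ y k) x +
        wnsFlow K m (θ x) k * deriv (deriv fun y => θ y k) x)) x :=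
    ((hM.hasDerivAt_wnsFlow (hK := hK) hd m k).fun_mul h2).fun_neg
  -- The perturbed field is differentiated in x. The x-derivative of the perturbation contains the
  -- variation of w⁽ᵐ⁾ along ∂ₓθ, supplied by `h3`.
  have h4 : ∀ ε, deriv (fun y => θ y k + ε * evolution (wnsFlow K m) θ y k) x =
      deriv (fun y => θ y k) x + ε * _ := fun ε =>
    (((h.contDiff k).differentiable two_ne_zero x).hasDerivAt.fun_add (h3.const_mul ε)).deriv
  have h5 : (fun ε : ℝ => evolution (wnsFlow K n)
      (fun y l => θ y l + ε * evolution (wnsFlow K m) θ y l) x k) = fun ε : ℝ =>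
      -(wnsFlow K n (fun l => θ x l + ε * evolution (wnsFlow K m) θ x l) k *
        (deriv (fun y => θ y k) x + ε * _)) :=
    funext fun ε => congrArg (fun z => -(wnsFlow K n _ k * z)) (h4 ε)
  rw [h5]
  refine ((h1.mul (((hasDerivAt_id (0 : ℝ)).mul_const _).const_add _)).neg).congr_deriv ?_
  have i1 : Integrable fun l => deriv (fun y => θ y l) x * (logDeriv hK (θ x) k l *
      ((wnsFlow K n (θ x) l - wnsFlow K n (θ x) k) *
        (wnsFlow K m (θ x) l - wnsFlow K m (θ x) k))) :=
    hη.integrable_mul (hL.mul (((hw n).sub (.const _)).mul ((hw m).sub (.const _))))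
  have i2 : Integrable fun l => deriv (fun y => θ y l) x * (logDeriv hK (θ x) k l *
      (wnsFlow K n (θ x) l - wnsFlow K n (θ x) k)) :=
    hη.integrable_mul (hL.mul ((hw n).sub (.const _)))
  -- Splitting w⁽ᵐ⁾(l) as (w⁽ᵐ⁾(l) - w⁽ᵐ⁾(k)) + w⁽ᵐ⁾(k) isolates the symmetric double difference.
  have h6 : ∫ l, evolution (wnsFlow K m) θ x l * (logDeriv hK (θ x) k l *
      (wnsFlow K n (θ x) l - wnsFlow K n (θ x) k)) =
      -((∫ l, deriv (fun y => θ y l) x * (logDeriv hK (θ x) k l *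
        ((wnsFlow K n (θ x) l - wnsFlow K n (θ x) k) *
          (wnsFlow K m (θ x) l - wnsFlow K m (θ x) k)))) +
      wnsFlow K m (θ x) k * ∫ l, deriv (fun y => θ y l) x * (logDeriv hK (θ x) k l *
        (wnsFlow K n (θ x) l - wnsFlow K n (θ x) k))) := by
    rw [← integral_const_mul, ← integral_add i1 (i2.const_mul _), ← integral_neg]
    refine integral_congr_ae (Eventually.of_forall fun l => ?_)
    simp only [hξe]
    ring
  simp only [h6, zero_mul, add_zero, id, one_mul]
  ring

theorem flowsCommute_wnsFlow (hK : IsTBAKernel K) (m n : ℕ) :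
    FlowsCommute (domain K) (wnsFlow K m) (wnsFlow K n) := fun θ h x k => by
  refine ⟨_, hasDerivAt_evolution_evolution hK h m n x k,
    (hasDerivAt_evolution_evolution hK h n m x k).congr_deriv ?_⟩
  simp only [mul_comm (wnsFlow K m (θ x) _ - wnsFlow K m (θ x) k)]
  ring

/-! ### Uniform bounds for the dressing operator -/

/-- Finitely many local bounds cover a compact set, and one more bound covers its complement. -/
theorem exists_uniform_bound {Z : Type*} [TopologicalSpace Z] {P : Z → ℝ → Prop}
    (mono : ∀ z b c, b ≤ c → P z b → P z c) (loc : ∀ z, ∃ B, ∀ᶠ y in 𝓝 z, P y B)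
    (inf : ∃ B, ∀ᶠ y in cocompact Z, P y B) : ∃ B, ∀ z, P z B := by
  obtain ⟨B₀, h₀⟩ := inf
  obtain ⟨S, hS, hSB⟩ := mem_cocompact.1 h₀
  have h1 : ∃ B, ∀ z ∈ S, P z B := by
    refine hS.induction_on (p := fun s => ∃ B, ∀ z ∈ s, P z B) ⟨0, by simp⟩ ?_ ?_ ?_
    · rintro s t hst ⟨B, hB⟩
      exact ⟨B, fun z hz => hB z (hst hz)⟩
    · rintro s t ⟨B, hB⟩ ⟨C, hC⟩
      refine ⟨max B C, fun z hz => ?_⟩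
      rcases hz with hz | hz
      · exact mono _ _ _ (le_max_left _ _) (hB z hz)
      · exact mono _ _ _ (le_max_right _ _) (hC z hz)
    · intro z _
      obtain ⟨B, hB⟩ := loc z
      exact ⟨{y | P y B}, mem_nhdsWithin_of_mem_nhds hB, B, fun y hy => hy⟩
  obtain ⟨B₁, h₁⟩ := h1
  refine ⟨max B₀ B₁, fun z => ?_⟩
  by_cases hz : z ∈ S
  · exact mono _ _ _ (le_max_right _ _) (h₁ z hz)
  · exact mono _ _ _ (le_max_left _ _) (hSB hz)

/-- `B` bounds the dressing operator and `1/P'`. -/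
def DressingBound (hK : IsTBAKernel K) (φ : LOne) (B : ℝ) : Prop :=
  0 < B ∧ ‖resolvent hK φ‖ ≤ B ∧ ∀ k, 1 ≤ B * (1 - resolvent hK φ (kernelOp hK φ 1) k)

theorem DressingBound.mono {φ : LOne} {b c : ℝ} (hbc : b ≤ c) (h : DressingBound hK φ b) :
    DressingBound hK φ c := by
  obtain ⟨h1, h2, h3⟩ := h
  refine ⟨h1.trans_le hbc, h2.trans hbc, fun k => (h3 k).trans ?_⟩
  refine mul_le_mul_of_nonneg_right hbc ?_
  -- The bound 1 ≤ b p with b > 0 excludes p < 0.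
  by_contra hlt
  nlinarith [h3 k]

theorem dressCorr_zero_eq (θ : ℝ → ℝ) :
    dressCorr hK 0 θ = resolvent hK (toLOne θ) (kernelOp hK (toLOne θ) 1) := by
  simp [dressCorr]

theorem eventually_dressingBound (hK : IsTBAKernel K) {θ : ℝ → ℝ} (hθ : θ ∈ domain K) :
    ∃ B, ∀ᶠ φ in 𝓝 (toLOne θ), DressingBound hK φ B := by
  have hr := regular_of_mem hK hθ
  obtain ⟨m, hm, hk⟩ := hθ.2.2
  have hc := continuousAt_resolvent hr.resolvable
  have hc' : ContinuousAt (fun φ => resolvent hK φ (kernelOp hK φ 1)) (toLOne θ) :=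
    hc.clm_apply (((isBoundedLinearMap_kernelOp hK).continuous.clm_apply
      continuous_const).continuousAt)
  refine ⟨max (‖resolvent hK (toLOne θ)‖ + 1) (2 / m), ?_⟩
  filter_upwards [hc.norm.eventually (gt_mem_nhds (lt_add_one _)),
    hc'.eventually (Metric.ball_mem_nhds _ (half_pos hm))] with φ h1 h2
  refine ⟨by positivity, h1.le.trans (le_max_left _ _), fun k => ?_⟩
  have h3 := (BoundedContinuousFunction.dist_coe_le_dist k).trans h2.le
  have h4 := hk k
  rw [momentumDeriv_eq, hr.monoDress_eq, dressCorr_zero_eq] at h4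
  rw [Real.dist_eq] at h3
  have h5 : m / 2 ≤ 1 - resolvent hK φ (kernelOp hK φ 1) k := by
    have := abs_le.1 h3
    simp only [pow_zero] at h4
    linarith [this.2]
  calc (1 : ℝ) = 2 / m * (m / 2) := by field_simp
    _ ≤ _ := mul_le_mul (le_max_right _ _) h5 (half_pos hm).le (by positivity)

/-- Near each point the bound is inherited from that state, and near infinity from the zero state,
which lies in the domain. -/
theorem exists_dressingBound (hK : IsTBAKernel K) {Z : Type*} [TopologicalSpace Z]
    {θ : Z → ℝ → ℝ} (hd : ∀ z, θ z ∈ domain K) (hc : Continuous fun z => toLOne (θ z))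
    (ht : Tendsto (fun z => toLOne (θ z)) (cocompact Z) (𝓝 0)) :
    ∃ B, ∀ z, DressingBound hK (toLOne (θ z)) B := by
  refine exists_uniform_bound (P := fun z B => DressingBound hK (toLOne (θ z)) B)
    (fun z b c hbc => DressingBound.mono hbc) (fun z => ?_) ?_
  · obtain ⟨B, hB⟩ := eventually_dressingBound hK (hd z)
    exact ⟨B, hc.continuousAt.eventually hB⟩
  · obtain ⟨B, hB⟩ := eventually_dressingBound hK (zero_mem_domain hK)
    have h0 : toLOne (fun _ => 0) = 0 := by
      simpa using toLOne_smul (integrable_zero ℝ ℝ volume) 0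
    rw [h0] at hB
    exact ⟨B, ht.eventually hB⟩

/-- A quantitative Neumann series: the admissible size of the perturbation depends only on B, which
gives an ε-interval uniform in x. -/
theorem Resolvable.add_small {φ ψ : LOne} (h : Resolvable hK φ) {B : ℝ} (hB₀ : 0 < B)
    (hB : ‖resolvent hK φ‖ ≤ B) (hψ : ‖kernelOp hK ψ‖ ≤ 1 / (2 * B)) :
    Resolvable hK (φ + ψ) ∧ ‖resolvent hK (φ + ψ)‖ ≤ 2 * B := by
  have hsmall : ‖resolvent hK φ * kernelOp hK ψ‖ ≤ 1 / 2 := by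
    calc ‖resolvent hK φ * kernelOp hK ψ‖ ≤ ‖resolvent hK φ‖ * ‖kernelOp hK ψ‖ := norm_mul_le _ _
      _ ≤ B * (1 / (2 * B)) := mul_le_mul hB hψ (norm_nonneg _) hB₀.le
      _ = 1 / 2 := by field_simp
  have hinv : resolvent hK φ * (1 + kernelOp hK φ) = 1 := Ring.inverse_mul_cancel _ h
  have hinv' : (1 + kernelOp hK φ) * resolvent hK φ = 1 := Ring.mul_inverse_cancel _ h
  have hfac : 1 + kernelOp hK (φ + ψ) =
      (1 + kernelOp hK φ) * (1 - -(resolvent hK φ * kernelOp hK ψ)) := by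
    rw [sub_neg_eq_add, mul_add, ← mul_assoc, hinv', map_add, mul_one, one_mul, add_assoc]
  have hu : Resolvable hK (φ + ψ) := by
    rw [Resolvable, hfac]
    exact h.mul (isUnit_one_sub_of_norm_lt_one (by rw [norm_neg]; linarith))
  refine ⟨hu, ?_⟩
  set y := resolvent hK (φ + ψ) with hy
  have h1 : (1 + kernelOp hK (φ + ψ)) * y = 1 := Ring.mul_inverse_cancel _ hu
  have h2 : y = resolvent hK φ - resolvent hK φ * kernelOp hK ψ * y := by
    have := congrArg (fun z => resolvent hK φ * z) h1
    simp only [map_add, ← mul_assoc, ← add_assoc] at this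
    rw [mul_add, hinv, mul_one, add_mul, one_mul] at this
    exact eq_sub_of_add_eq this
  have h3 : ‖y‖ ≤ B + 1 / 2 * ‖y‖ := by
    calc ‖y‖ = ‖resolvent hK φ - resolvent hK φ * kernelOp hK ψ * y‖ := by rw [← h2]
      _ ≤ ‖resolvent hK φ‖ + ‖resolvent hK φ * kernelOp hK ψ * y‖ := norm_sub_le _ _
      _ ≤ B + 1 / 2 * ‖y‖ := add_le_add hB ((norm_mul_le _ _).trans
        (mul_le_mul_of_nonneg_right hsmall (norm_nonneg _)))
  linarith

/-! ### Families with uniform decay -/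

/-- Continuous families `φ(z,k)` that decay rapidly in `k` and quadratically in `x(z)`. -/
structure DecayFamily {Z : Type*} [TopologicalSpace Z] (x : Z → ℝ) (φ : Z → ℝ → ℝ) : Prop where
  cont : ∀ k, Continuous fun z => φ z k
  meas : ∀ z, AEStronglyMeasurable (φ z) volume
  decay : ∀ n : ℕ, ∃ C, ∀ z k, (1 + x z ^ 2) * (1 + |k|) ^ n * |φ z k| ≤ C

namespace DecayFamily

variable {Z : Type*} [TopologicalSpace Z] {x : Z → ℝ} {φ : Z → ℝ → ℝ}

theorem mul (h : DecayFamily x φ) {g : Z → ℝ → ℝ} (hc : ∀ k, Continuous fun z => g z k)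
    (hm : ∀ z, AEStronglyMeasurable (g z) volume) {C : ℝ} {n : ℕ}
    (hb : ∀ z k, |g z k| ≤ C * (1 + |k|) ^ n) : DecayFamily x fun z k => φ z k * g z k := by
  refine ⟨fun k => (h.cont k).mul (hc k), fun z => (h.meas z).mul (hm z), fun m => ?_⟩
  obtain ⟨D, hD⟩ := h.decay (m + n)
  have hC : ∀ z : Z, 0 ≤ C := fun z => by simpa using (abs_nonneg _).trans (hb z 0)
  refine ⟨D * C, fun z k => ?_⟩
  rw [abs_mul]
  calc (1 + x z ^ 2) * (1 + |k|) ^ m * (|φ z k| * |g z k|)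
      ≤ (1 + x z ^ 2) * (1 + |k|) ^ m * (|φ z k| * (C * (1 + |k|) ^ n)) := by
        gcongr
        exact hb z k
    _ = (1 + x z ^ 2) * (1 + |k|) ^ (m + n) * |φ z k| * C := by ring
    _ ≤ D * C := mul_le_mul_of_nonneg_right (hD z k) (hC z)

theorem mul_pow (h : DecayFamily x φ) (n : ℕ) : DecayFamily x fun z k => φ z k * k ^ n :=
  h.mul (g := fun _ k => k ^ n) (C := 1) (n := n) (fun _ => continuous_const)
    (fun _ => (by fun_prop : Continuous fun k : ℝ => k ^ n).aestronglyMeasurable) fun _ k => by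
      rw [abs_pow, one_mul]
      exact pow_le_pow_left₀ (abs_nonneg k) (by linarith) n

theorem exists_le (h : DecayFamily x φ) :
    ∃ C, ∀ z k, |φ z k| ≤ C * (1 + x z ^ 2)⁻¹ * (1 + k ^ 2)⁻¹ := by
  obtain ⟨C, hC⟩ := h.decay 2
  refine ⟨C, fun z k => ?_⟩
  have := mul_pow_le_of_weight (n := 0) (k := k) (C := C)
    (mul_nonneg (by positivity : 0 ≤ 1 + x z ^ 2) (abs_nonneg (φ z k)))
    (le_of_eq_of_le (by ring) (hC z k))
  rw [pow_zero, mul_one, ← le_div_iff₀' (by positivity)] at this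
  refine this.trans (le_of_eq ?_)
  ring

theorem exists_le' (h : DecayFamily x φ) : ∃ C, ∀ z k, |φ z k| ≤ C * (1 + k ^ 2)⁻¹ := by
  obtain ⟨C, hC⟩ := h.exists_le
  refine ⟨|C|, fun z k => (hC z k).trans ?_⟩
  refine mul_le_mul_of_nonneg_right ?_ (by positivity)
  have : (1 + x z ^ 2)⁻¹ ≤ 1 := inv_le_one_of_one_le₀ (by nlinarith [sq_nonneg (x z)])
  calc C * (1 + x z ^ 2)⁻¹ ≤ |C| * (1 + x z ^ 2)⁻¹ := by
        gcongr
        exact le_abs_self C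
    _ ≤ |C| := mul_le_of_le_one_right (abs_nonneg C) this

theorem hasMoments (h : DecayFamily x φ) (z : Z) : HasMoments (φ z) := fun n => by
  obtain ⟨C, hC⟩ := (h.mul_pow n).exists_le'
  exact (integrable_inv_one_add_sq.const_mul C).mono' ((h.mul_pow n).meas z)
    (Eventually.of_forall (hC z))

theorem exists_norm_le (h : DecayFamily x φ) :
    ∃ C, ∀ z, ‖toLOne (φ z)‖ ≤ C * (1 + x z ^ 2)⁻¹ := by
  obtain ⟨C, hC⟩ := h.exists_le
  refine ⟨C * ∫ k : ℝ, (1 + k ^ 2)⁻¹, fun z => ?_⟩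
  rw [norm_toLOne (h.hasMoments z).integrable]
  calc ∫ k, |φ z k| ≤ ∫ k : ℝ, C * (1 + x z ^ 2)⁻¹ * (1 + k ^ 2)⁻¹ :=
        integral_mono (h.hasMoments z).integrable.abs
          (integrable_inv_one_add_sq.const_mul _) (hC z)
    _ = _ := by rw [integral_const_mul]; ring

theorem exists_integral_le (h : DecayFamily x φ) :
    ∃ C, ∀ z, |∫ k, φ z k| ≤ C * (1 + x z ^ 2)⁻¹ := by
  obtain ⟨C, hC⟩ := h.exists_norm_le
  refine ⟨C, fun z => le_trans ?_ (hC z)⟩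
  rw [norm_toLOne (h.hasMoments z).integrable, ← Real.norm_eq_abs]
  exact norm_integral_le_integral_norm _

theorem continuous_toLOne [FirstCountableTopology Z] (h : DecayFamily x φ) :
    Continuous fun z => toLOne (φ z) := by
  obtain ⟨C, hC⟩ := h.exists_le'
  exact continuous_iff_continuousAt.2 fun z => tendsto_toLOne (Eventually.of_forall h.meas)
    (h.hasMoments z).integrable (integrable_inv_one_add_sq.const_mul C) (Eventually.of_forall hC)
    fun k => (h.cont k).continuousAt

theorem continuous_integral [FirstCountableTopology Z] (h : DecayFamily x φ) :
    Continuous fun z => ∫ k, φ z k := by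
  have : (fun z => ∫ k, φ z k) = fun z => pairing (toLOne (φ z)) 1 := by
    funext z
    simp [pairing_toLOne (h.hasMoments z).integrable]
  rw [this]
  exact isBoundedBilinearMap_pairing.continuous.comp (h.continuous_toLOne.prodMk continuous_const)

theorem tendsto_toLOne_zero (h : DecayFamily x φ) {l : Filter Z} (hx : Tendsto x l (cocompact ℝ)) :
    Tendsto (fun z => toLOne (φ z)) l (𝓝 0) := by
  obtain ⟨C, hC⟩ := h.exists_norm_le
  refine squeeze_zero_norm hC ?_
  have h1 : Tendsto (fun y : ℝ => (1 + y ^ 2)⁻¹) (cocompact ℝ) (𝓝 0) := by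
    refine tendsto_inv_atTop_zero.comp (tendsto_atTop_mono (fun y => ?_)
      (tendsto_norm_cocompact_atTop (E := ℝ)))
    rw [Real.norm_eq_abs, ← sq_abs]
    nlinarith [sq_nonneg (|y| - 1), abs_nonneg y]
  simpa using (h1.comp hx).const_mul C

theorem continuous_dressCorr [FirstCountableTopology Z] (h : DecayFamily x φ)
    (hr : ∀ z, Resolvable hK (toLOne (φ z))) (n : ℕ) :
    Continuous fun z => dressCorr hK n (φ z) := by
  have h1 : Continuous fun z => resolvent hK (toLOne (φ z)) := continuous_iff_continuousAt.2
    fun z => ContinuousAt.comp (g := resolvent hK) (f := fun z => toLOne (φ z))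
      (continuousAt_resolvent (hr z)) h.continuous_toLOne.continuousAt
  have h2 : Continuous fun z => kernelOp hK (toLOne fun k => φ z k * k ^ n) 1 :=
    ((isBoundedLinearMap_kernelOp hK).continuous.comp (h.mul_pow n).continuous_toLOne).clm_apply
      continuous_const
  exact h1.clm_apply h2

theorem continuous_monoDress [FirstCountableTopology Z] (h : DecayFamily x φ)
    (hr : ∀ z, Resolvable hK (toLOne (φ z))) (n : ℕ) (k : ℝ) :
    Continuous fun z => monoDress K n (φ z) k := by
  simp only [fun z => (Regular.mk (h.hasMoments z) (hr z)).monoDress_eq n]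
  exact continuous_const.sub ((BoundedContinuousFunction.evalCLM ℝ k).continuous.comp
    (h.continuous_dressCorr hr n))

theorem exists_monoDress_le (h : DecayFamily x φ) (hr : ∀ z, Resolvable hK (toLOne (φ z))) {B : ℝ}
    (hB : ∀ z, ‖resolvent hK (toLOne (φ z))‖ ≤ B) (n : ℕ) :
    ∃ C, ∀ z k, |monoDress K n (φ z) k| ≤ C * (1 + |k|) ^ n := by
  obtain ⟨C, hC⟩ := (h.mul_pow n).exists_norm_le
  refine ⟨1 + |B| * (kernelBound hK * |C|), fun z k => ?_⟩
  have h0 := kernelBound_nonneg hK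
  have h1 : ‖dressCorr hK n (φ z)‖ ≤ |B| * (kernelBound hK * |C|) := by
    refine (ContinuousLinearMap.le_opNorm _ _).trans (mul_le_mul ((hB z).trans (le_abs_self B))
      ((norm_kernelOp_one_le hK _).trans (mul_le_mul_of_nonneg_left ((hC z).trans ?_) h0))
      (norm_nonneg _) (abs_nonneg _))
    have : (1 + x z ^ 2)⁻¹ ≤ 1 := inv_le_one_of_one_le₀ (by nlinarith [sq_nonneg (x z)])
    calc C * (1 + x z ^ 2)⁻¹ ≤ |C| * (1 + x z ^ 2)⁻¹ := by
          gcongr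
          exact le_abs_self C
      _ ≤ |C| := mul_le_of_le_one_right (abs_nonneg C) this
  have h2 := (dressCorr hK n (φ z)).norm_coe_le_norm k
  have h3 : |k| ^ n ≤ (1 + |k|) ^ n := pow_le_pow_left₀ (abs_nonneg k) (by linarith) n
  rw [(Regular.mk (h.hasMoments z) (hr z)).monoDress_eq]
  calc |k ^ n - dressCorr hK n (φ z) k| ≤ |k ^ n| + |dressCorr hK n (φ z) k| := abs_sub _ _
    _ ≤ (1 + |k|) ^ n + |B| * (kernelBound hK * |C|) * (1 + |k|) ^ n := by
        rw [abs_pow]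
        refine add_le_add h3 ((h2.trans h1).trans ?_)
        exact le_mul_of_one_le_right (by positivity) (one_le_weight k n)
    _ = _ := by ring

theorem mul_monoDress [FirstCountableTopology Z] {θ : Z → ℝ → ℝ} (hφ : DecayFamily x φ)
    (h : DecayFamily x θ) (hr : ∀ z, Resolvable hK (toLOne (θ z))) {B : ℝ}
    (hB : ∀ z, ‖resolvent hK (toLOne (θ z))‖ ≤ B) (n : ℕ) :
    DecayFamily x fun z k => φ z k * monoDress K n (θ z) k := by
  obtain ⟨C, hC⟩ := h.exists_monoDress_le hr hB n
  exact hφ.mul (h.continuous_monoDress hr n) (fun z => ((Regular.mk (h.hasMoments z)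
    (hr z)).polyGrowth_monoDress n).1.aestronglyMeasurable) hC

/-- Since v = U[k]/P', linear growth of U[k] and the bound 1/P' ≤ B preserve rapid decay. -/
theorem mul_velocity [FirstCountableTopology Z] {θ : Z → ℝ → ℝ} (hφ : DecayFamily x φ)
    (h : DecayFamily x θ) (hd : ∀ z, θ z ∈ domain K) {B : ℝ}
    (hB : ∀ z, DressingBound hK (toLOne (θ z)) B) :
    DecayFamily x fun z k => -(velocity K (θ z) k * φ z k) := by
  have hr := fun z => (regular_of_mem hK (hd z)).resolvable
  have h1 := hφ.mul_monoDress h hr (fun z => (hB z).2.1) 1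
  have h2 := h1.mul (g := fun z k => -(monoDress K 0 (θ z) k)⁻¹) (C := B) (n := 0)
    (fun k => ((h.continuous_monoDress hr 0 k).inv₀
      fun z => (monoDress_zero_pos (hd z) k).ne').neg)
    (fun z => (((regular_of_mem hK (hd z)).polyGrowth_monoDress
      0).1.aestronglyMeasurable.inv₀).neg) fun z k => ?_
  · convert h2 using 3 with z k
    rw [velocity_eq, wnsFlow_eq]
    ring
  · have h3 := (hB z).2.2 k
    have hpos := monoDress_zero_pos (hd z) k
    have h4 : monoDress K 0 (θ z) k =
        1 - resolvent hK (toLOne (θ z)) (kernelOp hK (toLOne (θ z)) 1) k := by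
      rw [(regular_of_mem hK (hd z)).monoDress_eq, dressCorr_zero_eq]
      simp only [pow_zero]
    rw [← h4] at h3
    rw [abs_neg, abs_inv, abs_of_pos hpos, pow_zero, mul_one]
    exact inv_le_of_inv_le₀ (hB z).1 ((inv_le_iff_one_le_mul₀' (hB z).1).2 h3)

theorem comp {Y : Type*} [TopologicalSpace Y] (h : DecayFamily x φ) {f : Y → Z}
    (hf : Continuous f) : DecayFamily (x ∘ f) fun y => φ (f y) :=
  ⟨fun k => (h.cont k).comp hf, fun y => h.meas (f y), fun n => (h.decay n).imp fun _ hC y => hC (f y)⟩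

end DecayFamily

/-! ### First integrals -/

theorem dressedMoment_family {Z : Type*} [TopologicalSpace Z] [FirstCountableTopology Z] {x : Z → ℝ}
    {θ : Z → ℝ → ℝ} (h : DecayFamily x θ) (hr : ∀ z, Resolvable hK (toLOne (θ z))) {B : ℝ}
    (hB : ∀ z, ‖resolvent hK (toLOne (θ z))‖ ≤ B) (m n : ℕ) :
    (Continuous fun z => dressedMoment K m n (θ z)) ∧
      ∃ C, ∀ z, |dressedMoment K m n (θ z)| ≤ C * (1 + x z ^ 2)⁻¹ := by
  have h1 := (h.mul_pow n).mul_monoDress h hr hB m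
  exact ⟨h1.continuous_integral, h1.exists_integral_le⟩

/-- Differentiation of `∫ dx ∫ dk θ kⁿ U[kᵐ]` along a curve of fields. -/
theorem hasDerivAt_integral_dressedMoment {T : Set ℝ} {τ₀ : ℝ} (hT : T ∈ 𝓝 τ₀)
    {θ ξ : ℝ → ℝ → ℝ → ℝ}
    (hθ : DecayFamily (Z := T × ℝ) (fun z => z.2) fun z => θ z.1 z.2)
    (hξ : DecayFamily (Z := T × ℝ) (fun z => z.2) fun z => ξ z.1 z.2)
    (hr : ∀ z : T × ℝ, Resolvable hK (toLOne (θ z.1 z.2))) {B : ℝ}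
    (hB : ∀ z : T × ℝ, ‖resolvent hK (toLOne (θ z.1 z.2))‖ ≤ B)
    (hd : ∀ τ ∈ T, ∀ x, HasMomentDerivAt (fun τ => θ τ x) (ξ τ x) τ) (m n : ℕ) :
    HasDerivAt (fun τ => ∫ x, dressedMoment K m n (θ τ x))
      (∫ x, ∫ k, ξ τ₀ x k * (monoDress K m (θ τ₀ x) k * monoDress K n (θ τ₀ x) k)) τ₀ := by
  obtain ⟨hcont, C, hC⟩ := dressedMoment_family hθ hr hB m n
  have h1 : DecayFamily (Z := T × ℝ) (fun z => z.2) fun z k =>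
      ξ z.1 z.2 k * (monoDress K m (θ z.1 z.2) k * monoDress K n (θ z.1 z.2) k) := by
    simpa only [mul_assoc] using (hξ.mul_monoDress hθ hr hB m).mul_monoDress hθ hr hB n
  obtain ⟨D, hD⟩ := h1.exists_integral_le
  have hτ₀ : τ₀ ∈ T := mem_of_mem_nhds hT
  have hsec : ∀ τ (hτ : τ ∈ T), Continuous fun x : ℝ => ((⟨τ, hτ⟩, x) : T × ℝ) := fun τ hτ => by
    fun_prop
  have hm : ∀ τ ∈ T, AEStronglyMeasurable (fun x => dressedMoment K m n (θ τ x)) volume :=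
    fun τ hτ => (hcont.comp (hsec τ hτ)).aestronglyMeasurable
  refine (hasDerivAt_integral_of_dominated_loc_of_deriv_le (bound := fun x => D * (1 + x ^ 2)⁻¹)
    (F := fun τ x => dressedMoment K m n (θ τ x))
    (F' := fun τ x => ∫ k, ξ τ x k * (monoDress K m (θ τ x) k * monoDress K n (θ τ x) k)) hT
    (eventually_of_mem hT hm) ?_ ?_ ?_ (integrable_inv_one_add_sq.const_mul D) ?_).2
  · exact (integrable_inv_one_add_sq.const_mul C).mono' (hm τ₀ hτ₀)
      (Eventually.of_forall fun x => hC (⟨τ₀, hτ₀⟩, x))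
  · exact (h1.continuous_integral.comp (hsec τ₀ hτ₀)).aestronglyMeasurable
  · exact Eventually.of_forall fun x τ hτ => hD (⟨τ, hτ⟩, x)
  · exact Eventually.of_forall fun x τ hτ => (hd τ hτ x).hasDerivAt_dressedMoment
      ⟨hθ.hasMoments (⟨τ, hτ⟩, x), hr (⟨τ, hτ⟩, x)⟩ m n

/-- The flux of the charges integrates to zero. -/
theorem integral_flux_eq_zero {θ θ' : ℝ → ℝ → ℝ} (hθ : DecayFamily id θ) (hθ' : DecayFamily id θ')
    (hd : ∀ x, θ x ∈ domain K) {B : ℝ} (hB : ∀ x, ‖resolvent hK (toLOne (θ x))‖ ≤ B)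
    (hM : ∀ x, HasMomentDerivAt θ (θ' x) x) (n : ℕ) :
    ∫ x, ∫ k, -(velocity K (θ x) k * θ' x k) *
      (monoDress K 0 (θ x) k * monoDress K n (θ x) k) = 0 := by
  have hr := fun x => (regular_of_mem hK (hd x))
  have hres := fun x => (hr x).resolvable
  -- Here v P' = U[k] turns the integrand into -θ' U[k] U[kⁿ], whose k-integral is minus the
  -- x-derivative of `dressedMoment K 1 n`. That flux is O((1 + x²)⁻¹), so there are no boundary
  -- terms.
  have h1 : ∀ x k, -(velocity K (θ x) k * θ' x k) *
      (monoDress K 0 (θ x) k * monoDress K n (θ x) k) =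
      -(θ' x k * (monoDress K 1 (θ x) k * monoDress K n (θ x) k)) := fun x k => by
    have := (monoDress_zero_pos (hd x) k).ne'
    rw [velocity_eq, wnsFlow_eq]
    field_simp
  simp only [h1, integral_neg]
  have h2 : DecayFamily id fun x k =>
      θ' x k * (monoDress K 1 (θ x) k * monoDress K n (θ x) k) := by
    simpa only [mul_assoc] using (hθ'.mul_monoDress hθ hres hB 1).mul_monoDress hθ hres hB n
  obtain ⟨D, hD⟩ := h2.exists_integral_le
  obtain ⟨-, C, hC⟩ := dressedMoment_family hθ hres hB 1 n
  have hlim : Tendsto (fun x => dressedMoment K 1 n (θ x)) (cocompact ℝ) (𝓝 0) := by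
    refine squeeze_zero_norm hC ?_
    have h1 : Tendsto (fun y : ℝ => (1 + y ^ 2)⁻¹) (cocompact ℝ) (𝓝 0) := by
      refine tendsto_inv_atTop_zero.comp (tendsto_atTop_mono (fun y => ?_)
        (tendsto_norm_cocompact_atTop (E := ℝ)))
      rw [Real.norm_eq_abs, ← sq_abs]
      nlinarith [sq_nonneg (|y| - 1), abs_nonneg y]
    simpa using h1.const_mul C
  rw [cocompact_eq_atBot_atTop] at hlim
  rw [integral_of_hasDerivAt_of_tendsto
    (fun x => (hM x).hasDerivAt_dressedMoment (hr x) 1 n)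
    ((integrable_inv_one_add_sq.const_mul D).mono'
      h2.continuous_integral.aestronglyMeasurable (Eventually.of_forall hD))
    (hlim.mono_left le_sup_left) (hlim.mono_left le_sup_right)]
  simp

namespace IsDecayingField

variable {θ : ℝ → ℝ → ℝ}

theorem hasDerivAt (h : IsDecayingField (domain K) θ) (x k : ℝ) :
    HasDerivAt (fun y => θ y k) (deriv (fun y => θ y k) x) x :=
  ((h.contDiff k).differentiable one_ne_zero x).hasDerivAt

theorem hasMomentDerivAt (hK : IsTBAKernel K) (h : IsDecayingField (domain K) θ) (x : ℝ) :
    HasMomentDerivAt θ (fun k => deriv (fun y => θ y k) x) x := by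
  refine .of_decay (θ' := fun x k => deriv (fun y => θ y k) x) one_pos
    (fun s _ => (regular_of_mem hK (h.mem s)).moments) (fun s _ k => h.hasDerivAt s k) fun n => ?_
  obtain ⟨C, hC⟩ := h.decay n
  refine ⟨C, fun s _ k => le_trans ?_ (hC s k)⟩
  rw [mul_assoc]
  refine (mul_le_mul_of_nonneg_left (le_add_of_nonneg_left (abs_nonneg _)) (by positivity)).trans
    (le_mul_of_one_le_left (by positivity) (by nlinarith [sq_nonneg s]))

theorem decayFamily (hK : IsTBAKernel K) (h : IsDecayingField (domain K) θ) : DecayFamily id θ := by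
  refine ⟨fun k => (h.contDiff k).continuous,
    fun x => (regular_of_mem hK (h.mem x)).integrable.aestronglyMeasurable, fun n => ?_⟩
  obtain ⟨C, hC⟩ := h.decay n
  exact ⟨C, fun x k => le_trans (mul_le_mul_of_nonneg_left
    (le_add_of_nonneg_right (abs_nonneg _)) (by positivity)) (hC x k)⟩

theorem decayFamily_deriv (hK : IsTBAKernel K) (h : IsDecayingField (domain K) θ) :
    DecayFamily id fun x k => deriv (fun y => θ y k) x := by
  refine ⟨fun k => (h.contDiff k).continuous_deriv le_rfl,
    fun x => (h.hasMomentDerivAt hK x).hasMoments.integrable.aestronglyMeasurable, fun n => ?_⟩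
  obtain ⟨C, hC⟩ := h.decay n
  exact ⟨C, fun x k => le_trans (mul_le_mul_of_nonneg_left
    (le_add_of_nonneg_left (abs_nonneg _)) (by positivity)) (hC x k)⟩

theorem exists_dressingBound (hK : IsTBAKernel K) (h : IsDecayingField (domain K) θ) :
    ∃ B, ∀ x, DressingBound hK (toLOne (θ x)) B :=
  BetheBoltzmann.exists_dressingBound hK h.mem (h.decayFamily hK).continuous_toLOne
    ((h.decayFamily hK).tendsto_toLOne_zero tendsto_id)

theorem integrable_chargeDensity (hK : IsTBAKernel K) (h : IsDecayingField (domain K) θ) (n : ℕ) :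
    Integrable fun x => chargeDensity K n (θ x) := by
  obtain ⟨B, hB⟩ := h.exists_dressingBound hK
  obtain ⟨hc, C, hC⟩ := dressedMoment_family (h.decayFamily hK)
    (fun x => (regular_of_mem hK (h.mem x)).resolvable) (fun x => (hB x).2.1) 0 n
  simp only [chargeDensity_eq]
  exact ((integrable_inv_one_add_sq.const_mul C).mono' hc.aestronglyMeasurable
    (Eventually.of_forall hC)).const_mul _

theorem hasDerivAt_integral_chargeDensity (hK : IsTBAKernel K) (h : IsDecayingField (domain K) θ)
    (n : ℕ) : HasDerivAt (fun ε : ℝ => ∫ x, chargeDensity K n fun k =>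
      θ x k + ε * evolution (velocity K) θ x k) 0 0 := by
  obtain ⟨B, hB⟩ := h.exists_dressingBound hK
  have hθ := h.decayFamily hK
  have hξ : DecayFamily id (evolution (velocity K) θ) :=
    (h.decayFamily_deriv hK).mul_velocity hθ h.mem hB
  obtain ⟨C, hC⟩ := hξ.exists_norm_le
  have hB₀ : 0 < B := (hB 0).1
  have hk₀ := kernelBound_nonneg hK
  -- For |ε| < r the perturbation has operator norm at most 1/(2B), as `Resolvable.add_small`
  -- requires. Only invertibility is needed along the curve, not positivity of P'.
  set r : ℝ := 1 / (2 * B * (kernelBound hK * |C| + 1)) with hr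
  have hrpos : 0 < r := by positivity
  let T := Metric.ball (0 : ℝ) r
  have hsmall : ∀ ε ∈ T, ∀ x, Resolvable hK (toLOne fun k => θ x k + ε * evolution (velocity K) θ x k) ∧
      ‖resolvent hK (toLOne fun k => θ x k + ε * evolution (velocity K) θ x k)‖ ≤ 2 * B := by
    intro ε hε x
    have hε' : |ε| < r := by simpa [T] using hε
    have hi := (hξ.hasMoments x).integrable
    rw [toLOne_add (h.decayFamily hK |>.hasMoments x).integrable (hi.const_mul ε), toLOne_smul hi]
    refine (regular_of_mem hK (h.mem x)).resolvable.add_small hB₀ (hB x).2.1 ?_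
    rw [map_smul, norm_smul, Real.norm_eq_abs]
    have h1 : ‖kernelOp hK (toLOne (evolution (velocity K) θ x))‖ ≤ kernelBound hK * |C| := by
      refine (norm_kernelOp_le hK _).trans (mul_le_mul_of_nonneg_left ((hC x).trans ?_) hk₀)
      have : (1 + id x ^ 2)⁻¹ ≤ 1 := inv_le_one_of_one_le₀ (by nlinarith [sq_nonneg (id x)])
      calc C * (1 + id x ^ 2)⁻¹ ≤ |C| * (1 + id x ^ 2)⁻¹ := by
            gcongr
            exact le_abs_self C
        _ ≤ |C| := mul_le_of_le_one_right (abs_nonneg C) this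
    calc |ε| * ‖kernelOp hK (toLOne (evolution (velocity K) θ x))‖
        ≤ r * (kernelBound hK * |C| + 1) :=
          mul_le_mul hε'.le (h1.trans (by linarith)) (norm_nonneg _) hrpos.le
      _ = 1 / (2 * B) := by rw [hr]; field_simp
  have hθ' : DecayFamily (Z := T × ℝ) (fun z => z.2) fun z k =>
      θ z.2 k + z.1 * evolution (velocity K) θ z.2 k := by
    refine ⟨fun k => ?_, fun z => ?_, fun m => ?_⟩
    · exact ((hθ.cont k).comp continuous_snd).add
        ((continuous_subtype_val.comp continuous_fst).mul ((hξ.cont k).comp continuous_snd))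
    · exact (hθ.meas z.2).add ((hξ.meas z.2).const_mul _)
    · obtain ⟨C₁, h₁⟩ := hθ.decay m
      obtain ⟨C₂, h₂⟩ := hξ.decay m
      refine ⟨C₁ + r * C₂, fun z k => ?_⟩
      have hz : |(z.1 : ℝ)| ≤ r := by
        have := z.1.2
        simp only [T, mem_ball_zero_iff, Real.norm_eq_abs] at this
        exact this.le
      calc (1 + z.2 ^ 2) * (1 + |k|) ^ m * |θ z.2 k + z.1 * evolution (velocity K) θ z.2 k|
          ≤ (1 + z.2 ^ 2) * (1 + |k|) ^ m * (|θ z.2 k| + r * |evolution (velocity K) θ z.2 k|) := by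
            refine mul_le_mul_of_nonneg_left ((abs_add_le _ _).trans ?_) (by positivity)
            rw [abs_mul]
            gcongr
        _ = (1 + z.2 ^ 2) * (1 + |k|) ^ m * |θ z.2 k| +
            r * ((1 + z.2 ^ 2) * (1 + |k|) ^ m * |evolution (velocity K) θ z.2 k|) := by ring
        _ ≤ C₁ + r * C₂ := add_le_add (h₁ z.2 k) (mul_le_mul_of_nonneg_left (h₂ z.2 k) hrpos.le)
  have key := hasDerivAt_integral_dressedMoment (hK := hK) (T := T) (τ₀ := 0)
    (θ := fun ε x k => θ x k + ε * evolution (velocity K) θ x k)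
    (ξ := fun _ x k => evolution (velocity K) θ x k) (Metric.ball_mem_nhds 0 hrpos) hθ'
    (hξ.comp continuous_snd) (fun z => (hsmall z.1 z.1.2 z.2).1)
    (fun z => (hsmall z.1 z.1.2 z.2).2)
    (fun τ _ x => HasMomentDerivAt.pencil (hθ.hasMoments x) (hξ.hasMoments x) τ) 0 n
  have hzero := integral_flux_eq_zero hθ (h.decayFamily_deriv hK) h.mem (fun x => (hB x).2.1)
    (h.hasMomentDerivAt hK) n
  simp only [chargeDensity_eq, integral_const_mul]
  refine (key.const_mul _).congr_deriv ?_
  simp only [zero_mul, add_zero]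
  exact mul_eq_zero_of_right _ hzero

end IsDecayingField

/-! ### Conservation along solutions -/

namespace IsSolution

variable {a b : ℝ} {θ : ℝ → ℝ → ℝ → ℝ}

theorem isDecayingField (h : IsSolution (domain K) (velocity K) a b θ) {τ : ℝ}
    (hτ : τ ∈ Ioo a b) : IsDecayingField (domain K) (θ τ) where
  mem := h.mem τ hτ
  contDiff k := (h.contDiffOn k).comp_contDiff (f := fun x : ℝ => (τ, x))
    (by fun_prop) fun x => ⟨hτ, mem_univ _⟩
  decay n := by
    obtain ⟨C, hC⟩ := h.decay τ τ hτ.1 hτ.2 n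
    exact ⟨C, fun x k => hC τ (by simp) x k⟩

theorem differentiableAt (h : IsSolution (domain K) (velocity K) a b θ) {p : ℝ × ℝ}
    (hp : p.1 ∈ Ioo a b) (k : ℝ) : DifferentiableAt ℝ (fun p : ℝ × ℝ => θ p.1 p.2 k) p :=
  ((h.contDiffOn k).differentiableOn one_ne_zero).differentiableAt
    ((isOpen_Ioo.prod isOpen_univ).mem_nhds ⟨hp, mem_univ _⟩)

theorem hasDerivAt_time (h : IsSolution (domain K) (velocity K) a b θ) {τ : ℝ}
    (hτ : τ ∈ Ioo a b) (x k : ℝ) :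
    HasDerivAt (fun s => θ s x k) (evolution (velocity K) (θ τ) x k) τ := by
  have h1 : DifferentiableAt ℝ (fun s => θ s x k) τ :=
    DifferentiableAt.comp (f := fun s : ℝ => (s, x)) (g := fun p : ℝ × ℝ => θ p.1 p.2 k) τ
      (h.differentiableAt (p := (τ, x)) hτ k) (by fun_prop)
  rw [evolution, ← eq_neg_of_add_eq_zero_left (h.equation τ hτ x k)]
  exact h1.hasDerivAt

theorem continuousOn_deriv (h : IsSolution (domain K) (velocity K) a b θ) (k : ℝ) :
    ContinuousOn (fun p : ℝ × ℝ => deriv (fun y => θ p.1 y k) p.2) (Ioo a b ×ˢ univ) := by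
  have h1 := (h.contDiffOn k).continuousOn_fderiv_of_isOpen (isOpen_Ioo.prod isOpen_univ) le_rfl
  refine (h1.clm_apply (continuousOn_const (c := ((0, 1) : ℝ × ℝ)))).congr fun p hp => ?_
  have h2 := (h.differentiableAt hp.1 k).hasFDerivAt
  have h3 : HasDerivAt (fun y : ℝ => (p.1, y)) ((0, 1) : ℝ × ℝ) p.2 :=
    (hasDerivAt_const _ _).prodMk (hasDerivAt_id _)
  exact (h2.comp_hasDerivAt p.2 h3).deriv

variable {c d : ℝ}

theorem decayFamily (hK : IsTBAKernel K) (h : IsSolution (domain K) (velocity K) a b θ)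
    (hc : a < c) (hd : d < b) :
    DecayFamily (Z := Icc c d × ℝ) (fun z => z.2) fun z => θ z.1 z.2 := by
  have hm : ∀ z : Icc c d × ℝ, (z.1 : ℝ) ∈ Ioo a b := fun z =>
    ⟨hc.trans_le z.1.2.1, z.1.2.2.trans_lt hd⟩
  refine ⟨fun k => (h.contDiffOn k).continuousOn.comp_continuous
    (f := fun z : Icc c d × ℝ => ((z.1 : ℝ), z.2)) (by fun_prop) fun z => ⟨hm z, mem_univ _⟩,
    fun z => (regular_of_mem hK (h.mem _ (hm z) z.2)).integrable.aestronglyMeasurable,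
    fun n => ?_⟩
  obtain ⟨C, hC⟩ := h.decay c d hc hd n
  exact ⟨C, fun z k => le_trans (mul_le_mul_of_nonneg_left
    (le_add_of_nonneg_right (abs_nonneg _)) (by positivity)) (hC z.1 z.1.2 z.2 k)⟩

theorem decayFamily_deriv (hK : IsTBAKernel K) (h : IsSolution (domain K) (velocity K) a b θ)
    (hc : a < c) (hd : d < b) : DecayFamily (Z := Icc c d × ℝ) (fun z => z.2)
      fun z k => deriv (fun y => θ z.1 y k) z.2 := by
  have hm : ∀ z : Icc c d × ℝ, (z.1 : ℝ) ∈ Ioo a b := fun z =>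
    ⟨hc.trans_le z.1.2.1, z.1.2.2.trans_lt hd⟩
  refine ⟨fun k => (h.continuousOn_deriv k).comp_continuous
    (f := fun z : Icc c d × ℝ => ((z.1 : ℝ), z.2)) (by fun_prop) fun z => ⟨hm z, mem_univ _⟩,
    fun z => ((h.isDecayingField (hm z)).decayFamily_deriv hK).meas z.2, fun n => ?_⟩
  obtain ⟨C, hC⟩ := h.decay c d hc hd n
  exact ⟨C, fun z k => le_trans (mul_le_mul_of_nonneg_left
    (le_add_of_nonneg_left (abs_nonneg _)) (by positivity)) (hC z.1 z.1.2 z.2 k)⟩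

theorem hasDerivAt_integral_chargeDensity (hK : IsTBAKernel K)
    (h : IsSolution (domain K) (velocity K) a b θ) (n : ℕ) {τ : ℝ} (hτ : τ ∈ Ioo a b) :
    HasDerivAt (fun t => ∫ x, chargeDensity K n (θ t x)) 0 τ := by
  obtain ⟨c, hac, hcτ⟩ := exists_between hτ.1
  obtain ⟨d, hτd, hdb⟩ := exists_between hτ.2
  have hm : ∀ z : Icc c d × ℝ, (z.1 : ℝ) ∈ Ioo a b := fun z =>
    ⟨hac.trans_le z.1.2.1, z.1.2.2.trans_lt hdb⟩
  have hθ := h.decayFamily hK hac hdb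
  -- On a compact time interval the projection to x is proper, so leaving compact sets means |x| →
  -- ∞, where the field tends to zero in L¹.
  obtain ⟨B, hB⟩ := exists_dressingBound hK (Z := Icc c d × ℝ) (fun z => h.mem _ (hm z) z.2)
    hθ.continuous_toLOne (hθ.tendsto_toLOne_zero
      (isProperMap_iff_tendsto_cocompact.1 isProperMap_snd_of_compactSpace).2)
  have hξ : DecayFamily (Z := Icc c d × ℝ) (fun z => z.2)
      fun z => evolution (velocity K) (θ z.1) z.2 :=
    (h.decayFamily_deriv hK hac hdb).mul_velocity hθ (fun z => h.mem _ (hm z) z.2) hB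
  -- The bounds come from the compact interval; differentiation in time takes place on its interior.
  let ι : Ioo c d × ℝ → Icc c d × ℝ := Prod.map (inclusion Ioo_subset_Icc_self) id
  have hι : Continuous ι := (continuous_inclusion _).prodMap continuous_id
  have hM : ∀ t ∈ Ioo c d, ∀ x, HasMomentDerivAt (fun t => θ t x)
      (evolution (velocity K) (θ t) x) t := fun t ht x => by
    obtain ⟨r, hr, hrs⟩ := Metric.isOpen_iff.1 isOpen_Ioo t ht
    have hI : ∀ s ∈ Metric.ball t r, s ∈ Icc c d := fun s hs => Ioo_subset_Icc_self (hrs hs)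
    refine .of_decay (θ' := fun s k => evolution (velocity K) (θ s) x k) hr
      (fun s hs => hθ.hasMoments (⟨s, hI s hs⟩, x))
      (fun s hs k => h.hasDerivAt_time (hm (⟨s, hI s hs⟩, x)) x k) fun m => ?_
    obtain ⟨C, hC⟩ := hξ.decay m
    refine ⟨C, fun s hs k => le_trans ?_ (hC (⟨s, hI s hs⟩, x) k)⟩
    rw [mul_assoc]
    exact le_mul_of_one_le_left (by positivity) (by nlinarith [sq_nonneg x])
  have key := hasDerivAt_integral_dressedMoment (hK := hK) (T := Ioo c d) (τ₀ := τ)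
    (θ := θ) (ξ := fun t => evolution (velocity K) (θ t)) (isOpen_Ioo.mem_nhds ⟨hcτ, hτd⟩)
    (hθ.comp hι) (hξ.comp hι) (fun z => (regular_of_mem hK (h.mem _ (hm (ι z)) _)).resolvable)
    (fun z => (hB (ι z)).2.1) hM 0 n
  have hf := h.isDecayingField hτ
  have hzero := integral_flux_eq_zero (hf.decayFamily hK) (hf.decayFamily_deriv hK) hf.mem
    (fun x => (hB (⟨τ, hcτ.le, hτd.le⟩, x)).2.1) (hf.hasMomentDerivAt hK) n
  simp only [chargeDensity_eq, integral_const_mul]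
  exact (key.const_mul _).congr_deriv (mul_eq_zero_of_right _ hzero)

end IsSolution

theorem isFirstIntegral_chargeDensity (hK : IsTBAKernel K) (n : ℕ) :
    IsFirstIntegral (domain K) (velocity K) (chargeDensity K n) := by
  refine ⟨fun θ h => ⟨h.integrable_chargeDensity hK n,
    h.hasDerivAt_integral_chargeDensity hK n⟩, fun a b θ h s hs t ht => ?_⟩
  exact isOpen_Ioo.is_const_of_deriv_eq_zero isPreconnected_Ioo
    (fun τ hτ => (h.hasDerivAt_integral_chargeDensity hK n
      hτ).differentiableAt.differentiableWithinAt)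
    (fun τ hτ => (h.hasDerivAt_integral_chargeDensity hK n hτ).deriv) hs ht

/-! ### The source of a symmetry -/

theorem IsState.hasMoments_mul {θ η : ℝ → ℝ} (hθ : IsState θ) (hη : IsState η) :
    HasMoments fun k => θ k * η k := fun n => by
  have h0 : MemLp η 2 volume := by simpa using hη 0
  refine ((hθ n).integrable_mul h0).congr (Eventually.of_forall fun k => ?_)
  simp only [Pi.mul_apply]
  ring

theorem IsState.abs {θ : ℝ → ℝ} (hθ : IsState θ) : IsState fun k => |θ k| := fun n => by
  have h0 : AEStronglyMeasurable θ volume := hθ.hasMoments.integrable.aestronglyMeasurable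
  refine (hθ n).congr_norm ?_ (Eventually.of_forall fun k => by simp)
  exact (by fun_prop : Continuous fun k : ℝ => k ^ n).aestronglyMeasurable.mul
    (continuous_abs.comp_aestronglyMeasurable h0)

theorem IsState.abs_add_abs {θ η : ℝ → ℝ} (hθ : IsState θ) (hη : IsState η) :
    IsState fun k => |θ k| + |η k| := by
  simpa using hθ.abs.add_mul hη.abs 1

theorem HasMoments.of_le {φ ψ : ℝ → ℝ} (hψ : HasMoments ψ) (hm : AEStronglyMeasurable φ volume)
    {C : ℝ} {m : ℕ} (hb : ∀ k, |φ k| ≤ C * (1 + |k|) ^ m * |ψ k|) : HasMoments φ := fun n => by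
  refine ((hψ.integrable_weight (m + n)).const_mul C).mono' (hm.mul
    (by fun_prop : Continuous fun k : ℝ => k ^ n).aestronglyMeasurable)
    (Eventually.of_forall fun k => ?_)
  rw [norm_mul, Real.norm_eq_abs, norm_pow, Real.norm_eq_abs]
  have h3 : |k| ^ n ≤ (1 + |k|) ^ n := pow_le_pow_left₀ (abs_nonneg k) (by linarith) n
  calc |φ k| * |k| ^ n ≤ C * (1 + |k|) ^ m * |ψ k| * (1 + |k|) ^ n :=
        mul_le_mul (hb k) h3 (by positivity) ((abs_nonneg _).trans (hb k))
    _ = _ := by ring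

/-- The integral is a difference of two integrals over the sections of regions between graphs, which
are measurable in k by the product theory after passing to measurable versions of the limits. -/
theorem aestronglyMeasurable_intervalIntegral {g : ℝ → ℝ → ℝ} (hg : Measurable (Function.uncurry g))
    {a b : ℝ → ℝ} (ha : AEMeasurable a) (hb : AEMeasurable b) :
    AEStronglyMeasurable (fun k => ∫ ξ in a k..b k, g ξ k) volume := by
  have key : ∀ {a b : ℝ → ℝ}, Measurable a → Measurable b →
      StronglyMeasurable fun k => ∫ ξ in Ioc (a k) (b k), g ξ k := fun {a b} ha hb => by
    have hS : MeasurableSet {p : ℝ × ℝ | a p.1 < p.2 ∧ p.2 ≤ b p.1} :=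
      (measurableSet_lt (ha.comp measurable_fst) measurable_snd).inter
        (measurableSet_le measurable_snd (hb.comp measurable_fst))
    have hF : StronglyMeasurable (indicator {p : ℝ × ℝ | a p.1 < p.2 ∧ p.2 ≤ b p.1}
        fun p => g p.2 p.1) :=
      ((hg.comp measurable_swap).indicator hS).stronglyMeasurable
    have := hF.integral_prod_right' (ν := volume)
    convert this using 2 with k
    rw [← integral_indicator measurableSet_Ioc]
    rfl
  have h1 := ((key ha.measurable_mk hb.measurable_mk).sub
    (key hb.measurable_mk ha.measurable_mk)).aestronglyMeasurable (μ := volume)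
  refine h1.congr ?_
  filter_upwards [ha.ae_eq_mk, hb.ae_eq_mk] with k h1 h2
  rw [h1, h2]
  rfl

/-- The lower bound on `|f|` at the values of `ξ` between the limits of the integrals. -/
def SourceBound (f : ℝ → ℝ → ℝ) (θ₀ θ : ℝ → ℝ) (C : ℝ) (m : ℕ) : Prop :=
  ∀ k ξ, |ξ| ≤ |θ₀ k| + |θ k| → 1 ≤ C * (1 + |k|) ^ m * |f ξ k|

/-- `∫ dξ / f(ξ,k)`. -/
noncomputable def localSource (f : ℝ → ℝ → ℝ) (θ₀ θ : ℝ → ℝ) (k : ℝ) : ℝ :=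
  ∫ ξ in θ₀ k..θ k, 1 / f ξ k

/-- `∫ ξ dξ / f(ξ,k)`. -/
noncomputable def nonlocalSource (f : ℝ → ℝ → ℝ) (θ₀ θ : ℝ → ℝ) (k : ℝ) : ℝ :=
  ∫ ξ in θ₀ k..θ k, ξ / f ξ k

namespace SourceBound

variable {f : ℝ → ℝ → ℝ} {θ₀ θ : ℝ → ℝ} {C : ℝ} {m : ℕ}

theorem ne_zero (h : SourceBound f θ₀ θ C m) {k ξ : ℝ} (hξ : |ξ| ≤ |θ₀ k| + |θ k|) : f ξ k ≠ 0 := by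
  intro h0
  have := h k ξ hξ
  rw [h0, abs_zero, mul_zero] at this
  linarith

theorem abs_inv_le (h : SourceBound f θ₀ θ C m) {k ξ : ℝ} (hξ : |ξ| ≤ |θ₀ k| + |θ k|) :
    |1 / f ξ k| ≤ C * (1 + |k|) ^ m := by
  rw [abs_div, abs_one, div_le_iff₀ (abs_pos.2 (h.ne_zero hξ))]
  exact h k ξ hξ

theorem nonneg (h : SourceBound f θ₀ θ C m) : 0 ≤ C := by
  have := (abs_nonneg _).trans (h.abs_inv_le (k := 0) (ξ := 0) (by simp; positivity))
  simpa using this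

theorem abs_le_of_mem {k ξ : ℝ} (hξ : ξ ∈ uIcc (θ₀ k) (θ k)) : |ξ| ≤ |θ₀ k| + |θ k| := by
  rcases le_total (θ₀ k) (θ k) with h | h
  · rw [uIcc_of_le h] at hξ
    rw [abs_le]
    constructor <;> cases abs_cases (θ₀ k) <;> cases abs_cases (θ k) <;> linarith [hξ.1, hξ.2]
  · rw [uIcc_of_ge h] at hξ
    rw [abs_le]
    constructor <;> cases abs_cases (θ₀ k) <;> cases abs_cases (θ k) <;> linarith [hξ.1, hξ.2]

theorem intervalIntegrable (h : SourceBound f θ₀ θ C m) (hf : Continuous (Function.uncurry f))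
    (k : ℝ) : IntervalIntegrable (fun ξ => 1 / f ξ k) volume (θ₀ k) (θ k) := by
  have hc : Continuous fun ξ => f ξ k := hf.comp (Continuous.prodMk_left k)
  exact (continuousOn_const.div hc.continuousOn
    fun ξ hξ => h.ne_zero (abs_le_of_mem hξ)).intervalIntegrable

theorem intervalIntegrable' (h : SourceBound f θ₀ θ C m) (hf : Continuous (Function.uncurry f))
    (k : ℝ) : IntervalIntegrable (fun ξ => ξ / f ξ k) volume (θ₀ k) (θ k) := by
  have hc : Continuous fun ξ => f ξ k := hf.comp (Continuous.prodMk_left k)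
  exact (continuousOn_id.div hc.continuousOn
    fun ξ hξ => h.ne_zero (abs_le_of_mem hξ)).intervalIntegrable

theorem abs_localSource_le (h : SourceBound f θ₀ θ C m) (k : ℝ) :
    |localSource f θ₀ θ k| ≤ C * (1 + |k|) ^ m * (|θ₀ k| + |θ k|) := by
  rw [localSource, ← Real.norm_eq_abs]
  refine (intervalIntegral.norm_integral_le_of_norm_le_const (C := C * (1 + |k|) ^ m)
    fun ξ hξ => h.abs_inv_le (abs_le_of_mem (uIoc_subset_uIcc hξ))).trans ?_
  have := h.nonneg
  refine mul_le_mul_of_nonneg_left ?_ (by positivity)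
  rw [add_comm]
  exact abs_sub _ _

theorem abs_nonlocalSource_le (h : SourceBound f θ₀ θ C m) (k : ℝ) :
    |nonlocalSource f θ₀ θ k| ≤ C * (1 + |k|) ^ m * (|θ₀ k| + |θ k|) ^ 2 := by
  have hC := h.nonneg
  rw [nonlocalSource, ← Real.norm_eq_abs]
  refine (intervalIntegral.norm_integral_le_of_norm_le_const
    (C := C * (1 + |k|) ^ m * (|θ₀ k| + |θ k|)) fun ξ hξ => ?_).trans ?_
  · have hξ' := abs_le_of_mem (uIoc_subset_uIcc hξ)
    rw [div_eq_mul_one_div, norm_mul, mul_comm]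
    exact mul_le_mul (h.abs_inv_le hξ') hξ' (abs_nonneg _) (by positivity)
  · rw [sq, ← mul_assoc]
    refine mul_le_mul_of_nonneg_left ?_ (by positivity)
    rw [add_comm]
    exact abs_sub _ _

theorem hasMoments_localSource (h : SourceBound f θ₀ θ C m) (hf : Continuous (Function.uncurry f))
    (hθ₀ : IsState θ₀) (hθ : IsState θ) : HasMoments (localSource f θ₀ θ) := by
  refine (hθ₀.abs_add_abs hθ).hasMoments.of_le (aestronglyMeasurable_intervalIntegral
    (g := fun ξ k => 1 / f ξ k) (hf.measurable.const_div 1) hθ₀.hasMoments.integrable.aemeasurable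
    hθ.hasMoments.integrable.aemeasurable) (C := C) (m := m) fun k => ?_
  rw [abs_of_nonneg (by positivity : 0 ≤ |θ₀ k| + |θ k|)]
  exact h.abs_localSource_le k

theorem hasMoments_mul_localSource (h : SourceBound f θ₀ θ C m)
    (hf : Continuous (Function.uncurry f)) (hθ₀ : IsState θ₀) (hθ : IsState θ) {η : ℝ → ℝ}
    (hη : IsState η) : HasMoments fun k => η k * localSource f θ₀ θ k := by
  refine (hη.hasMoments_mul (hθ₀.abs_add_abs hθ)).of_le
    (hη.hasMoments.integrable.aestronglyMeasurable.mul
      (h.hasMoments_localSource hf hθ₀ hθ).integrable.aestronglyMeasurable) (C := C) (m := m)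
    fun k => ?_
  rw [abs_mul, abs_mul, abs_of_nonneg (by positivity : 0 ≤ |θ₀ k| + |θ k|)]
  calc |η k| * |localSource f θ₀ θ k| ≤ |η k| * (C * (1 + |k|) ^ m * (|θ₀ k| + |θ k|)) := by
        gcongr
        exact h.abs_localSource_le k
    _ = _ := by ring

theorem hasMoments_nonlocalSource (h : SourceBound f θ₀ θ C m)
    (hf : Continuous (Function.uncurry f)) (hθ₀ : IsState θ₀) (hθ : IsState θ) :
    HasMoments (nonlocalSource f θ₀ θ) := by
  have hω := hθ₀.abs_add_abs hθ
  refine (hω.hasMoments_mul hω).of_le (aestronglyMeasurable_intervalIntegral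
    (g := fun ξ k => ξ / f ξ k) (measurable_fst.div hf.measurable) hθ₀.hasMoments.integrable.aemeasurable
    hθ.hasMoments.integrable.aemeasurable) (C := C) (m := m) fun k => ?_
  rw [abs_of_nonneg (by positivity : 0 ≤ (|θ₀ k| + |θ k|) * (|θ₀ k| + |θ k|)), ← sq]
  exact h.abs_nonlocalSource_le k

theorem symmetrySource_eq (hK : IsTBAKernel K) (h : SourceBound f θ₀ θ C m)
    (hf : Continuous (Function.uncurry f)) (hθ₀ : IsState θ₀) (hθ : IsState θ) :
    symmetrySource K f θ₀ θ = fun k => localSource f θ₀ θ k +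
      kernelOp hK (toLOne (nonlocalSource f θ₀ θ)) 1 k := by
  funext k
  rw [kernelOp_toLOne_one hK (h.hasMoments_nonlocalSource hf hθ₀ hθ).integrable]
  rfl

theorem integrable_mul_symmetrySource (hK : IsTBAKernel K) (h : SourceBound f θ₀ θ C m)
    (hf : Continuous (Function.uncurry f)) (hθ₀ : IsState θ₀) (hθ : IsState θ) :
    Integrable fun k => θ k * symmetrySource K f θ₀ θ k := by
  simp only [h.symmetrySource_eq hK hf hθ₀ hθ, mul_add]
  exact (h.hasMoments_mul_localSource hf hθ₀ hθ hθ).integrable.add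
    (integrable_mul_bcf hθ.hasMoments.integrable _)

theorem existsUnique_dressing (hK : IsTBAKernel K) (h : SourceBound f θ₀ θ C m)
    (hf : Continuous (Function.uncurry f)) (hθ₀ : IsState θ₀) (hθ : IsState θ)
    (hr : Resolvable hK (toLOne θ)) : ∃! Q, IsDressing K θ (symmetrySource K f θ₀ θ) Q :=
  existsUnique_isDressing hθ.hasMoments.integrable hr
    (h.integrable_mul_symmetrySource hK hf hθ₀ hθ)

/-- With source a + Kb, the parts -(1 + Kθ)⁻¹K(θa) and (1 + Kθ)⁻¹Kb combine. Only a, which inherits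
the irregularity of θ, stays outside the continuous term. -/
theorem dress_symmetrySource (h : SourceBound f θ₀ θ C m)
    (hf : Continuous (Function.uncurry f)) (hθ₀ : IsState θ₀) (hθ : IsState θ)
    (hr : Resolvable hK (toLOne θ)) :
    dress K θ (symmetrySource K f θ₀ θ) = fun k => localSource f θ₀ θ k +
      resolvent hK (toLOne θ) (kernelOp hK (toLOne fun k => nonlocalSource f θ₀ θ k -
        θ k * localSource f θ₀ θ k) 1) k := by
  have hi := hθ.hasMoments.integrable
  have i1 := (h.hasMoments_mul_localSource hf hθ₀ hθ hθ).integrable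
  have i2 := (h.hasMoments_nonlocalSource hf hθ₀ hθ).integrable
  rw [dress_eq hi hr (h.integrable_mul_symmetrySource hK hf hθ₀ hθ)]
  set g := kernelOp hK (toLOne (nonlocalSource f θ₀ θ)) 1 with hg
  have h1 : (fun k => θ k * symmetrySource K f θ₀ θ k) =
      fun k => θ k * localSource f θ₀ θ k + θ k * g k := by
    simp only [h.symmetrySource_eq hK hf hθ₀ hθ, mul_add]
    rfl
  have h2 : g = resolvent hK (toLOne θ) (g + kernelOp hK (toLOne θ) g) := hr.eq_resolvent rfl
  funext k
  rw [h1, toLOne_add i1 (integrable_mul_bcf hi g), toLOne_sub i2 i1, map_add, map_sub, add_apply,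
    sub_apply, kernelOp_mul_one hK hi, h.symmetrySource_eq hK hf hθ₀ hθ]
  simp only [map_add, map_sub, ← hg] at h2 ⊢
  have h3 := congrArg (fun F : ℝ →ᵇ ℝ => F k) h2
  simp only [BoundedContinuousFunction.coe_add, BoundedContinuousFunction.coe_sub, Pi.add_apply,
    Pi.sub_apply] at h3 ⊢
  linarith

end SourceBound

/-! ### Tsarev's equations -/

/-- The slack 1 in the definition of admissibility gives constants common to all perturbations of
size at most 1. -/
theorem IsAdmissible.sourceBound {f : ℝ → ℝ → ℝ} {θ₀ θ : ℝ → ℝ} (h : IsAdmissible f θ₀ θ) :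
    ∃ C m, ∀ ϑ : ℝ → ℝ, (∀ k, |ϑ k| ≤ |θ k| + 1) → SourceBound f θ₀ ϑ C m := by
  obtain ⟨-, C, m, hC⟩ := h
  exact ⟨C, m, fun ϑ hϑ k ξ hξ => hC k ξ (by linarith [hϑ k])⟩

/-- The cancellation behind the symmetries: the variation of b is ηθ/f, that of θa is ηa + θη/f, and
the difference is -ηa, with 1/f gone. -/
theorem hasLOneDerivAt_source {f : ℝ → ℝ → ℝ} {θ₀ θ : ℝ → ℝ} (hf : Continuous (Function.uncurry f))
    (hθ₀ : IsState θ₀) (hθ : IsState θ) {C : ℝ} {m : ℕ}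
    (h : ∀ ϑ : ℝ → ℝ, (∀ k, |ϑ k| ≤ |θ k| + 1) → SourceBound f θ₀ ϑ C m) {η : ℝ → ℝ}
    (hc : Continuous η) (hs : HasCompactSupport η) :
    HasLOneDerivAt (fun ε k => nonlocalSource f θ₀ (fun k => θ k + ε * η k) k -
      (θ k + ε * η k) * localSource f θ₀ (fun k => θ k + ε * η k) k)
      (fun k => -(η k * localSource f θ₀ θ k)) 0 := by
  have hη := isState_of_continuous hc hs
  obtain ⟨N, hN⟩ := hs.exists_bound_of_continuous hc
  have hN₀ : 0 ≤ N := (norm_nonneg _).trans (hN 0)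
  have hsmall : ∀ ε ∈ Metric.ball (0 : ℝ) (N + 1)⁻¹, ∀ k, |θ k + ε * η k| ≤ |θ k| + 1 := by
    intro ε hε k
    rw [mem_ball_zero_iff, Real.norm_eq_abs] at hε
    refine (abs_add_le _ _).trans (add_le_add_right ?_ _)
    rw [abs_mul]
    calc |ε| * |η k| ≤ (N + 1)⁻¹ * (N + 1) := mul_le_mul hε.le
          ((hN k).trans (by linarith)) (abs_nonneg _) (by positivity)
      _ = 1 := inv_mul_cancel₀ (by positivity)
  have hb := fun ε hε => h _ (hsmall ε hε)
  have hst := fun ε => hθ.add_mul hη ε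
  have hint : ∀ ε ∈ Metric.ball (0 : ℝ) (N + 1)⁻¹, Integrable fun k =>
      nonlocalSource f θ₀ (fun k => θ k + ε * η k) k -
        (θ k + ε * η k) * localSource f θ₀ (fun k => θ k + ε * η k) k := fun ε hε =>
    ((hb ε hε).hasMoments_nonlocalSource hf hθ₀ (hst ε)).integrable.sub
      ((hb ε hε).hasMoments_mul_localSource hf hθ₀ (hst ε) (hst ε)).integrable
  have hpos : 0 < (N + 1)⁻¹ := by positivity
  have hω := hθ₀.abs_add_abs hθ
  have hg : Integrable fun k => C * ((1 + |k|) ^ m * |η k * (|θ₀ k| + |θ k|)|) +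
      C * ((1 + |k|) ^ m * |η k|) :=
    (((hη.hasMoments_mul hω).integrable_weight m).const_mul C).add
      ((hη.hasMoments.integrable_weight m).const_mul C)
  have := HasLOneDerivAt.of_dominated (s₀ := 0)
    (φ' := fun ε k => -(η k * localSource f θ₀ (fun k => θ k + ε * η k) k)) hpos
    (fun ε hε => (hint ε hε).aestronglyMeasurable) (hint 0 (Metric.mem_ball_self hpos)) hg
    (fun ε hε k => ?_) fun ε hε k => ?_
  · simpa using this
  · have hcf : Continuous fun ξ => f ξ k := hf.comp (Continuous.prodMk_left k)
    have hne : f (θ k + ε * η k) k ≠ 0 :=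
      (hb ε hε).ne_zero (k := k) (le_add_of_nonneg_left (abs_nonneg _))
    have hd : HasDerivAt (fun ε => θ k + ε * η k) (η k) ε := by
      simpa using ((hasDerivAt_id ε).mul_const (η k)).const_add (θ k)
    have h1 : HasDerivAt (fun b => ∫ ξ in θ₀ k..b, 1 / f ξ k) (1 / f (θ k + ε * η k) k)
        (θ k + ε * η k) :=
      intervalIntegral.integral_hasDerivAt_right ((hb ε hε).intervalIntegrable hf k)
        (hcf.measurable.const_div 1).stronglyMeasurable.stronglyMeasurableAtFilter
        (continuousAt_const.div hcf.continuousAt hne)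
    have h2 : HasDerivAt (fun b => ∫ ξ in θ₀ k..b, ξ / f ξ k)
        ((θ k + ε * η k) / f (θ k + ε * η k) k) (θ k + ε * η k) :=
      intervalIntegral.integral_hasDerivAt_right ((hb ε hε).intervalIntegrable' hf k)
        (measurable_id.div hcf.measurable).stronglyMeasurable.stronglyMeasurableAtFilter
        (continuousAt_id.div hcf.continuousAt hne)
    refine ((h2.comp ε hd).fun_sub (hd.fun_mul (h1.comp ε hd))).congr_deriv ?_
    simp only [localSource, Function.comp]
    field_simp
    ring
  · rw [abs_neg, abs_mul, abs_mul, abs_of_nonneg (by positivity : 0 ≤ |θ₀ k| + |θ k|)]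
    have h0 := (hb ε hε).nonneg
    calc |η k| * |localSource f θ₀ (fun k => θ k + ε * η k) k|
        ≤ |η k| * (C * (1 + |k|) ^ m * (|θ₀ k| + (|θ k| + 1))) := by
          refine mul_le_mul_of_nonneg_left (((hb ε hε).abs_localSource_le k).trans ?_)
            (abs_nonneg _)
          exact mul_le_mul_of_nonneg_left (add_le_add_right (hsmall ε hε k) _) (by positivity)
      _ = _ := by ring

/-- As η(k) = 0, the local term a(k) does not move; this removes the delta function on the diagonal.
The rest has variation density -ηa - ηV = -ηW, V being the continuous part of the dressed source W =
a + V. -/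
theorem hasDerivAt_dress_symmetrySource {f : ℝ → ℝ → ℝ} {θ₀ θ : ℝ → ℝ}
    (hf : IsAdmissible f θ₀ θ) (hθ₀ : IsState θ₀) (hθ : θ ∈ domain K) {η : ℝ → ℝ}
    (hc : Continuous η) (hs : HasCompactSupport η) {k : ℝ} (hk : η k = 0) :
    HasDerivAt (fun ε : ℝ => dress K (fun k => θ k + ε * η k)
        (symmetrySource K f θ₀ fun k => θ k + ε * η k) k)
      (-∫ l, η l * (dress K θ (symmetrySource K f θ₀ θ) l * dressedRow hK (toLOne θ) k l)) 0 := by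
  obtain ⟨C, m, hb⟩ := hf.sourceBound
  have hη := isState_of_continuous hc hs
  have hr := regular_of_mem hK hθ
  have h0 : (fun k => θ k + 0 * η k) = θ := by simp
  have hbθ : SourceBound f θ₀ θ C m := hb θ fun k => by linarith
  have hM := (HasMomentDerivAt.pencil hr.moments hη.hasMoments 0).hasLOneDerivAt
  have hS := hasLOneDerivAt_source hf.1 hθ₀ hθ.1 hb hc hs
  have h1 := (BoundedContinuousFunction.evalCLM ℝ k).hasFDerivAt.comp_hasDerivAt 0
    (hM.hasDerivAt_resolvent hS (hK := hK) (by simpa only [h0] using hr.resolvable))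
  obtain ⟨N, hN⟩ := hs.exists_bound_of_continuous hc
  have hN₀ : 0 ≤ N := (norm_nonneg _).trans (hN 0)
  have hpos : 0 < (N + 1)⁻¹ := by positivity
  have heq : (fun ε : ℝ => dress K (fun k => θ k + ε * η k)
      (symmetrySource K f θ₀ fun k => θ k + ε * η k) k) =ᶠ[𝓝 0] fun ε : ℝ =>
      localSource f θ₀ θ k + resolvent hK (toLOne fun k => θ k + ε * η k) (kernelOp hK
        (toLOne fun k => nonlocalSource f θ₀ (fun k => θ k + ε * η k) k -
          (θ k + ε * η k) * localSource f θ₀ (fun k => θ k + ε * η k) k) 1) k := by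
    filter_upwards [eventually_mem_domain hK hθ hη, Metric.ball_mem_nhds 0 hpos] with ε h1 h2
    have hbε := hb (fun k => θ k + ε * η k) fun l => by
      rw [mem_ball_zero_iff, Real.norm_eq_abs] at h2
      refine (abs_add_le _ _).trans (add_le_add_right ?_ _)
      rw [abs_mul]
      calc |ε| * |η l| ≤ (N + 1)⁻¹ * (N + 1) := mul_le_mul h2.le
            ((hN l).trans (by linarith)) (abs_nonneg _) (by positivity)
        _ = 1 := inv_mul_cancel₀ (by positivity)
    rw [hbε.dress_symmetrySource hf.1 hθ₀ h1.1 (regular_of_mem hK h1).resolvable]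
    simp only [localSource, hk, mul_zero, add_zero]
  refine ((h1.const_add (localSource f θ₀ θ k)).congr_of_eventuallyEq heq).congr_deriv ?_
  have i1 := (hbθ.hasMoments_mul_localSource hf.1 hθ₀ hθ.1 hη).integrable
  have i2 : Integrable fun l => -(η l * localSource f θ₀ θ l) := i1.neg
  change resolvent hK _ _ k = _
  simp only [zero_mul, add_zero]
  rw [hr.resolvable.apply_eq hr.integrable (integrable_sub_mul_bcf hη.hasMoments.integrable
    i2 _), hbθ.dress_symmetrySource hf.1 hθ₀ hθ.1 hr.resolvable, ← integral_neg]
  refine integral_congr_ae (Eventually.of_forall fun l => ?_)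
  ring

theorem isHydrodynamicSymmetryAt_symmetryFlow (hK : IsTBAKernel K) {f : ℝ → ℝ → ℝ} {θ₀ θ : ℝ → ℝ}
    (hf : IsAdmissible f θ₀ θ) (hθ₀ : IsState θ₀) (hθ : θ ∈ domain K) :
    IsHydrodynamicSymmetryAt K (symmetryFlow K f θ₀) θ := fun k => by
  refine ⟨_, hasFunctionalDeriv_log hK hθ k, ?_⟩
  obtain ⟨C, m, hb⟩ := hf.sourceBound
  have hr := regular_of_mem hK hθ
  have hbθ : SourceBound f θ₀ θ C m := hb θ fun k => by linarith
  have hW := hbθ.dress_symmetrySource hf.1 hθ₀ hθ.1 hr.resolvable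
  set V := resolvent hK (toLOne θ) (kernelOp hK (toLOne fun k => nonlocalSource f θ₀ θ k -
        θ k * localSource f θ₀ θ k) 1) with hV
  set P := monoDress K 0 θ with hP
  have hPpos : ∀ l, P l ≠ 0 := fun l => (monoDress_zero_pos hθ l).ne'
  have hcP : Continuous P := (hr.polyGrowth_monoDress 0).1
  set R := dressedRow hK (toLOne θ) k with hR
  set w := symmetryFlow K f θ₀ θ with hw
  have hwe : ∀ l, w l = (localSource f θ₀ θ l + V l) / P l := fun l => by
    rw [hw, symmetryFlow, hW, momentumDeriv_eq]
    ring
  -- Separates the merely integrable local source from a continuous remainder; each is locally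
  -- integrable for its own reason.
  have hlin : ∀ l, (w l - w k) * logDeriv hK θ k l =
      localSource f θ₀ θ l * (-(R l) / P k) + (-(V l - w k * P l) * R l / P k) := fun l => by
    have := hPpos l
    have := hPpos k
    rw [hwe l, logDeriv, ← hR, ← hP]
    field_simp
    ring
  refine ⟨?_, fun η hη hs hsupp => ?_⟩
  · simp only [hlin]
    refine LocallyIntegrable.locallyIntegrableOn (LocallyIntegrable.add ?_ ?_) _
    · refine ((hbθ.hasMoments_localSource hf.1 hθ₀ hθ.1).integrable_mul
        (g := fun l => -(R l) / P k) ?_).locallyIntegrable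
      simpa only [div_eq_mul_inv] using (PolyGrowth.bcf R).neg.mul (.const (P k)⁻¹)
    · exact Continuous.locallyIntegrable (by fun_prop)
  · have hηs := isState_of_continuous hη.continuous hs
    have hk : η k = 0 := image_eq_zero_of_notMem_tsupport fun h => hsupp h rfl
    have h0 : (fun k => θ k + 0 * η k) = θ := by simp
    have h1 := hasDerivAt_dress_symmetrySource (hK := hK) hf hθ₀ hθ hη.continuous hs hk
    have h2 := (HasMomentDerivAt.pencil hr.moments hηs.hasMoments 0).hasDerivAt_monoDress
      (hK := hK) (by rwa [h0]) 0 k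
    have h3 := h1.fun_div h2 (by rw [h0]; exact hPpos k)
    have heq : (fun ε : ℝ => symmetryFlow K f θ₀ (fun k => θ k + ε * η k) k) = fun ε : ℝ =>
        dress K (fun k => θ k + ε * η k) (symmetrySource K f θ₀ fun k => θ k + ε * η k) k /
          monoDress K 0 (fun k => θ k + ε * η k) k := by
      funext ε
      rw [symmetryFlow, momentumDeriv_eq]
      ring
    rw [heq]
    refine h3.congr_deriv ?_
    simp only [h0, hW, ← hP, ← hR]
    have hPk := hPpos k
    have i1 : Integrable fun l => η l * ((localSource f θ₀ θ l + V l) * R l) := by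
      have := ((hbθ.hasMoments_mul_localSource hf.1 hθ₀ hθ.1 hηs).integrable_mul
        (PolyGrowth.bcf R)).add (hηs.hasMoments.integrable_mul
          ((PolyGrowth.bcf V).mul (PolyGrowth.bcf R)))
      refine this.congr (Eventually.of_forall fun l => ?_)
      simp only [Pi.add_apply]
      ring
    have i2 : Integrable fun l => η l * (P l * R l) :=
      hηs.hasMoments.integrable_mul ((hr.polyGrowth_monoDress 0).mul (PolyGrowth.bcf R))
    have e : ∀ l, (w l - w k) * logDeriv hK θ k l * η l =
        w k / P k * (η l * (P l * R l)) -
          1 / P k * (η l * ((localSource f θ₀ θ l + V l) * R l)) := fun l => by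
      rw [hlin]
      field_simp
      ring
    simp only [e]
    rw [integral_sub (i2.const_mul _) (i1.const_mul _), integral_const_mul, integral_const_mul,
      hwe k]
    field_simp
    ring

/-! ### Counting the symmetries -/

/-- States are functions, not classes, so modifications of zero on null sets are available as test
states. -/
theorem mem_domain_of_ae_zero (hK : IsTBAKernel K) {θ : ℝ → ℝ} (h : θ =ᵐ[volume] fun _ => 0) :
    θ ∈ domain K := by
  obtain ⟨δ, hδ, hd⟩ := exists_mem_domain_of_eLpNorm_lt hK
  refine hd θ (fun n => ?_) ?_
  · refine (memLp_congr_ae (g := fun _ => 0) ?_).2 (by simp)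
    filter_upwards [h] with k hk
    rw [hk, mul_zero]
  · rw [eLpNorm_congr_ae h]
    simpa using hδ

theorem update_zero_ae (k c : ℝ) : Function.update (fun _ : ℝ => (0 : ℝ)) k c =ᵐ[volume] fun _ => 0 := by
  have : ∀ᵐ l : ℝ, l ≠ k := by simp [ae_iff]
  filter_upwards [this] with l hl
  rw [Function.update_of_ne hl]

/-- Multiplying the flow by P' gives the dressed source, and the dressing equation returns the
source itself. -/
theorem symmetrySource_congr (hK : IsTBAKernel K) {f₁ f₂ : ℝ → ℝ → ℝ} {θ₀ θ : ℝ → ℝ}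
    (hθ₀ : IsState θ₀) (hθ : θ ∈ domain K) (h₁ : IsAdmissible f₁ θ₀ θ) (h₂ : IsAdmissible f₂ θ₀ θ)
    (h : symmetryFlow K f₁ θ₀ θ = symmetryFlow K f₂ θ₀ θ) :
    symmetrySource K f₁ θ₀ θ = symmetrySource K f₂ θ₀ θ := by
  have hr := regular_of_mem hK hθ
  have hd : ∀ {f}, IsAdmissible f θ₀ θ →
      IsDressing K θ (symmetrySource K f θ₀ θ) (dress K θ (symmetrySource K f θ₀ θ)) := by
    intro f hf
    obtain ⟨C, m, hb⟩ := hf.sourceBound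
    have hbθ : SourceBound f θ₀ θ C m := hb θ fun k => by linarith
    have hi := hbθ.integrable_mul_symmetrySource hK hf.1 hθ₀ hθ.1
    exact (isDressing_iff (hK := hK) hr.integrable hr.resolvable hi).2
      (dress_eq hr.integrable hr.resolvable hi)
  have hQ : dress K θ (symmetrySource K f₁ θ₀ θ) = dress K θ (symmetrySource K f₂ θ₀ θ) := by
    funext k
    have hk := congrFun h k
    rw [symmetryFlow, symmetryFlow, momentumDeriv_eq] at hk
    exact mul_left_cancel₀ (one_div_ne_zero (monoDress_zero_pos hθ k).ne') hk
  funext k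
  rw [← ((hd h₁).2 k).2, ← ((hd h₂).2 k).2, hQ]

/-- At the state equal to b at k and zero elsewhere the nonlocal term does not depend on b, while
the local one is the integral of 1/f(·,k) up to b. Differentiating in b recovers f. -/
theorem symmetryFlow_injective (hK : IsTBAKernel K) {f₁ f₂ : ℝ → ℝ → ℝ} {θ₀ : ℝ → ℝ}
    (hθ₀ : IsState θ₀) (h₁ : ∀ θ ∈ domain K, IsAdmissible f₁ θ₀ θ)
    (h₂ : ∀ θ ∈ domain K, IsAdmissible f₂ θ₀ θ)
    (h : ∀ θ ∈ domain K, symmetryFlow K f₁ θ₀ θ = symmetryFlow K f₂ θ₀ θ) : f₁ = f₂ := by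
  funext c k
  have hmem : ∀ b, Function.update (fun _ : ℝ => (0 : ℝ)) k b ∈ domain K := fun b =>
    mem_domain_of_ae_zero hK (update_zero_ae k b)
  have hsrc : ∀ b (f : ℝ → ℝ → ℝ), symmetrySource K f θ₀ (Function.update (fun _ => 0) k b) k =
      (∫ ξ in θ₀ k..b, 1 / f ξ k) + ∫ l, K k l * ∫ ξ in θ₀ l..0, ξ / f ξ l := fun b f => by
    rw [symmetrySource, Function.update_self]
    congr 1
    refine integral_congr_ae ?_
    filter_upwards [update_zero_ae k b] with l hl
    rw [hl]
  have hint : ∀ b, (∫ ξ in θ₀ k..b, 1 / f₁ ξ k) = ∫ ξ in θ₀ k..b, 1 / f₂ ξ k := fun b => by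
    have e := fun b => congrFun (symmetrySource_congr hK hθ₀ (hmem b) (h₁ _ (hmem b))
      (h₂ _ (hmem b)) (h _ (hmem b))) k
    have e1 := e b
    -- At b = θ₀(k) the local integral is zero; subtracting this case removes the nonlocal terms.
    have e2 := e (θ₀ k)
    simp only [hsrc, intervalIntegral.integral_same] at e1 e2
    linarith
  -- Admissibility at the state with value ξ at k bounds f(ξ,k) away from zero, for every ξ.
  have hne : ∀ {f : ℝ → ℝ → ℝ}, (∀ θ ∈ domain K, IsAdmissible f θ₀ θ) → ∀ ξ, f ξ k ≠ 0 := by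
    intro f hf ξ
    obtain ⟨C, m, hb⟩ := (hf _ (hmem ξ)).sourceBound
    exact (hb (Function.update (fun _ => 0) k ξ) fun l => by linarith).ne_zero
      (by rw [Function.update_self]; linarith [abs_nonneg (θ₀ k)])
  have hderiv : ∀ {f : ℝ → ℝ → ℝ}, (∀ θ ∈ domain K, IsAdmissible f θ₀ θ) →
      deriv (fun b => ∫ ξ in θ₀ k..b, 1 / f ξ k) c = 1 / f c k := by
    intro f hf
    have hc : Continuous fun ξ => f ξ k := (hf _ (hmem 0)).1.comp (Continuous.prodMk_left k)
    exact (continuous_const.div hc (hne hf)).deriv_integral _ _ _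
  have := hderiv h₁
  simp only [hint, hderiv h₂] at this
  simpa using this.symm

theorem not_countable_symmetryFlow (hK : IsTBAKernel K) {θ₀ : ℝ → ℝ} (hθ₀ : IsState θ₀) :
    ¬ {w : domain K → ℝ → ℝ | ∃ f : ℝ → ℝ → ℝ, (∀ θ ∈ domain K, IsAdmissible f θ₀ θ) ∧
      ∀ θ : domain K, w θ = symmetryFlow K f θ₀ θ}.Countable := by
  intro hcount
  -- The positive constants f = eᶜ already give uncountably many flows, by injectivity.
  have hadm : ∀ c : ℝ, ∀ θ ∈ domain K, IsAdmissible (fun _ _ => Real.exp c) θ₀ θ := fun c θ _ => by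
    refine ⟨by simpa [Function.uncurry_def] using continuous_const, Real.exp (-c), 0,
      fun k ξ _ => ?_⟩
    rw [pow_zero, mul_one, abs_of_pos (Real.exp_pos c), ← Real.exp_add]
    simp
  let Φ : ℝ → domain K → ℝ → ℝ := fun c θ => symmetryFlow K (fun _ _ => Real.exp c) θ₀ θ
  have hinj : Function.Injective Φ := fun c d hcd => by
    have := symmetryFlow_injective hK hθ₀ (hadm c) (hadm d) fun θ hθ => congrFun hcd ⟨θ, hθ⟩
    exact Real.exp_injective (congrFun (congrFun this 0) 0)
  have h1 := hcount.preimage hinj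
  have h2 : Φ ⁻¹' {w : domain K → ℝ → ℝ | ∃ f : ℝ → ℝ → ℝ,
      (∀ θ ∈ domain K, IsAdmissible f θ₀ θ) ∧ ∀ θ : domain K, w θ = symmetryFlow K f θ₀ θ} = univ :=
    eq_univ_of_forall fun c => ⟨_, hadm c, fun _ => rfl⟩
  rw [h2] at h1
  exact not_countable_univ h1

end BetheBoltzmann

theorem mainTheorem11 (K : ℝ → ℝ → ℝ) (hK : IsTBAKernel K) :
    -- the domain is a neighbourhood of zero for the norm of `L²(ℝ)`
    (∃ δ > 0, ∀ θ : ℝ → ℝ, IsState θ → eLpNorm θ 2 volume < ENNReal.ofReal δ → θ ∈ domain K) ∧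
    -- the dressed charges and the charge densities are well defined
    (∀ θ ∈ domain K, ∀ n : ℕ,
      (∃! Q, IsDressing K θ (deriv (bareCharge (n + 1))) Q) ∧
      Integrable (fun k => rootDensity K θ k * bareCharge n k)) ∧
    -- countably many independent commuting flows with the continuum WNS property
    ((∀ n, HasContinuumWNS (domain K) (wnsFlow K n)) ∧
      (∀ n, ∀ θ ∈ domain K, IsHydrodynamicSymmetryAt K (wnsFlow K n) θ) ∧
      (∀ θ ∈ domain K, LinearIndependent ℝ (fun n : ℕ => wnsFlow K n θ)) ∧
      (∀ m n, FlowsCommute (domain K) (wnsFlow K m) (wnsFlow K n)) ∧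
      (∀ n, FlowsCommute (domain K) (velocity K) (wnsFlow K n))) ∧
    -- countably many first integrals, with functionally independent densities
    ((∀ n, IsFirstIntegral (domain K) (velocity K) (chargeDensity K n)) ∧
      (∀ θ ∈ domain K, ∃ g : ℕ → ℝ → ℝ,
        (∀ n, HasFunctionalDeriv (chargeDensity K n) θ (g n)) ∧ LinearIndependent ℝ g)) ∧
    -- hydrodynamic symmetries parameterized by functions of two variables
    (∀ θ₀ : ℝ → ℝ, IsState θ₀ →
      (∀ f : ℝ → ℝ → ℝ, ∀ θ ∈ domain K, IsAdmissible f θ₀ θ →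
        (∀ k, IntervalIntegrable (fun ξ => 1 / f ξ k) volume (θ₀ k) (θ k)) ∧
        (∀ k', Integrable (fun k'' => K k' k'' * ∫ ξ in θ₀ k''..θ k'', ξ / f ξ k'')) ∧
        (∃! Q, IsDressing K θ (symmetrySource K f θ₀ θ) Q) ∧
        IsHydrodynamicSymmetryAt K (symmetryFlow K f θ₀) θ) ∧
      (∀ f₁ f₂ : ℝ → ℝ → ℝ, (∀ θ ∈ domain K, IsAdmissible f₁ θ₀ θ) →
        (∀ θ ∈ domain K, IsAdmissible f₂ θ₀ θ) →
        (∀ θ ∈ domain K, symmetryFlow K f₁ θ₀ θ = symmetryFlow K f₂ θ₀ θ) → f₁ = f₂) ∧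
      ¬ {w : domain K → ℝ → ℝ | ∃ f : ℝ → ℝ → ℝ, (∀ θ ∈ domain K, IsAdmissible f θ₀ θ) ∧
        ∀ θ : domain K, w θ = symmetryFlow K f θ₀ θ}.Countable) := by
  refine ⟨exists_mem_domain_of_eLpNorm_lt hK, fun θ hθ n => ?_,
    ⟨hasContinuumWNS_wnsFlow hK, fun n θ hθ => isHydrodynamicSymmetryAt_wnsFlow hK n hθ,
      fun θ hθ => linearIndependent_wnsFlow hK hθ, fun m n => flowsCommute_wnsFlow hK m n,
      fun n => ?_⟩,
    ⟨isFirstIntegral_chargeDensity hK, fun θ hθ => ⟨_, fun n =>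
      hasFunctionalDeriv_chargeDensity hK hθ n, linearIndependent_chargeDensity hK hθ⟩⟩,
    fun θ₀ hθ₀ => ⟨fun f θ hθ hf => ?_,
      fun f₁ f₂ h₁ h₂ h => symmetryFlow_injective hK hθ₀ h₁ h₂ h,
      not_countable_symmetryFlow hK hθ₀⟩⟩
  · have hr := regular_of_mem hK hθ
    refine ⟨?_, ?_⟩
    · rw [deriv_bareCharge_succ]
      exact existsUnique_isDressing hr.integrable hr.resolvable (hr.moments n)
    · have := (hr.moments.integrable_mul
        ((hr.polyGrowth_monoDress (hK := hK) 0).mul (PolyGrowth.pow n)))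
      refine (this.const_mul (1 / (2 * Real.pi) * chargeCoeff n)).congr (Filter.Eventually.of_forall fun k => ?_)
      simp only [rootDensity, stateDensity, bareCharge_eq, momentumDeriv_eq]
      ring
  · rw [velocity_eq]
    exact flowsCommute_wnsFlow hK 1 n
  · obtain ⟨C, m, hb⟩ := hf.sourceBound
    have hbθ : SourceBound f θ₀ θ C m := hb θ fun k => by linarith
    refine ⟨hbθ.intervalIntegrable hf.1, fun k' => ?_,
      hbθ.existsUnique_dressing hK hf.1 hθ₀ hθ.1 (regular_of_mem hK hθ).resolvable,
      isHydrodynamicSymmetryAt_symmetryFlow hK hf hθ₀ hθ⟩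
    exact (integrable_mul_bcf (hbθ.hasMoments_nonlocalSource hf.1 hθ₀ hθ.1).integrable
      (kernelRow hK k')).congr (Filter.Eventually.of_forall fun l => mul_comm _ _)
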